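/- **Setting.** Let $N\ge1$. Functions $F:\mathbb R^n\to\mathbb R\cup\{\infty\}$ have domain $\operatorname{dom}F=\{F<\infty\}$ and conjugate $F^*(y)=\sup_x\{\langle y,x\rangle-F(x)\}$; $D_F(x,y)=F(x)-F(y)-\langle\nabla F(y),x-y\rangle$ if $y\in\operatorname{int}\operatorname{dom}F$ and $D_F(x,y)=\infty$ otherwise; minimizers are points attaining a finite minimum; $v\in\hat\partial F(x)$ means $F(x)<\infty$ and $\liminf_{x\ne y\to x}\frac{F(y)-F(x)-\langle v,y-x\rangle}{\|y-x\|}\ge0$. A *Legendre kernel* is a proper, lsc, strictly convex function $h$ that is $C^1$ on $\operatorname{int}\operatorname{dom}h\neq\emptyset$, with $h(x)/\|x\|\to\infty$ as $\|x\|\to\infty$ and $\|\nabla h(x^k)\|\to\infty$ whenever $\operatorname{int}\operatorname{dom}h\ni x^k\to x\in\operatorname{bdry}\operatorname{dom}h$. For $i=1,\dots,N$ let $h_i$ be Legendre kernels and $f_i$ be $L_i$-smooth relative to $h_i$: $f_i$ is proper and lsc, $\operatorname{dom}f_i\supseteq\operatorname{dom}h_i$, $L_i\ge0$, and $L_ih_i\pm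 f_i$ are convex on $\operatorname{int}\operatorname{dom}h_i$. Let $g$ be proper and lsc, $\varphi=\frac1N\sum_if_i+g$, $C=\bigcap_i\operatorname{int}\operatorname{dom}h_i$, $\gamma_i\in(0,N/L_i)$ (any $\gamma_i>0$ if $L_i=0$). Assume that $\varphi$ has a minimizer over $\overline C$ and that $$T(s)=\operatorname*{arg\,min}_{w\in\mathbb R^n}\Big\{g(w)+\sum_i\tfrac1{\gamma_i}h_i(w)-\langle s,w\rangle\Big\}\subseteq C\qquad\forall s\in\mathbb R^n .$$ **Algorithm.** Let $\hat h_i=h_i/\gamma_i-f_i/N$ (with $\infty-\infty=\infty$), $x^{\rm init}\in C$, $s_i^0=\frac1{\gamma_i}\nabla h_i(x^{\rm init})-\frac1N\nabla f_i(x^{\rm init})$, $\tilde s^0=\sum_is_i^0$. For $k=0,1,\dots$: take $z^k\in T(\tilde s^k)$; select a random $\mathcal I^{k+1}\subseteq\{1,\dots,N\}$; set $s_i^{k+1}=\frac1{\gamma_i}\nabla h_i(z^k)-\frac1N\nabla f_i(z^k)$ for $i\in\mathcal I^{k+1}$, $s_i^{k+1}=s_i^k$ otherwise, and $\tilde s^{k+1}=\tilde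 s^k+\sum_{i\in\mathcal I^{k+1}}(s_i^{k+1}-s_i^k)$. The rule is randomized: there are $p_1,\dots,p_N>0$ with $\mathbb P(i\in\mathcal I^{k+1}\mid\mathcal F_k)=p_i$ for all $i,k$, where the filtration $(\mathcal F_k)$ represents the information at iteration $k$ ($z^k$ and $\mathcal I^k$ are $\mathcal F_k$-measurable). Put $p_{\min}=\min_ip_i$, $\mathbb E_k=\mathbb E[\,\cdot\mid\mathcal F_k]$, $$\mathcal L(z,\boldsymbol s)=\varphi(z)+\sum_{i=1}^ND_{\hat h_i^*}\big(s_i,\nabla\hat h_i(z)\big).$$ On $(\mathbb R^n)^N$ let $\Phi(x_1,\dots,x_N)=\frac1N\sum_if_i(x_i)+\frac1N\sum_ig(x_i)$ if $x_1=\dots=x_N$ and $\Phi=\infty$ otherwise, let $\Phi^{\hat h}(\boldsymbol x)=\inf_{\boldsymbol w}\{\Phi(\boldsymbol w)+\sum_iD_{\hat h_i}(w_i,x_i)\}$, and let $x_i^k=\nabla\hat h_i^*(s_i^k)$. **Assumption II.** Every $\operatorname{dom}h_i$ is closed, and $D_{h_i}(x,x^k)\to0$ whenever $\operatorname{int}\operatorname{dom}h_i\ni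 x^k\to x\in\operatorname{bdry}\operatorname{dom}h_i$. **Theorem.** For every $k$ the numbers $\varphi(z^k)$, $\mathcal L(z^k,\boldsymbol s^k)$ and $D_{\hat h_i^*}(s_i^k,\nabla\hat h_i(z^k))\ge0$ are finite, $\mathcal L(z^k,\boldsymbol s^k)$ is integrable and equals $\Phi^{\hat h}(\boldsymbol x^k)$, and almost surely $$\mathbb E_k\big[\mathcal L(z^{k+1},\boldsymbol s^{k+1})\big]\le\mathcal L(z^k,\boldsymbol s^k)-p_{\min}\sum_{i=1}^ND_{\hat h_i^*}\big(s_i^k,\nabla\hat h_i(z^k)\big).$$ Moreover $\Phi^{\hat h}(\boldsymbol x^k)$ is (surely) nonincreasing and converges to a finite value $\varphi_\star\ge\inf_C\varphi$ (which may depend on the realization). With $\omega$ the set of limit points of $(z^k)$, the following hold almost surely. 1. For every $i$, $\sum_kD_{\hat h_i^*}(s_i^k,\nabla\hat h_i(z^k))<\infty$; in particular these residuals vanish. 2. $\varphi(z^k)\to\varphi_\star\le\varphi(x^{\rm init})$. 3. If Assumption II holds and, for every $i$, $L_ih_i\pm f_i$ are convex on all of $\operatorname{dom}h_i$, then $\varphi\equiv\varphi_\star$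 on $\omega$. 4. If $C=\mathbb R^n$, then $0\in\hat\partial\varphi(z^\star)$ for every $z^\star\in\omega$. If $\varphi$ is convex (with neither $g$ nor any $f_i$ necessarily so) and every $\operatorname{dom}h_i$ is closed, then also, almost surely: 5. $\varphi(z^k)\to\min_{\overline C}\varphi$, and $\min_{0\le\ell\le k}\varphi(z^\ell)-\min_{\overline C}\varphi=o(1/k)$. 6. Every point of $\omega$ belongs to $\operatorname{arg\,min}_{\overline C}\varphi$. 7. If either Assumption II holds and all sublevel sets of $\varphi$ within $\overline C$ are bounded, or $C=\mathbb R^n$, then $(z^k)$ and all the sequences $(\nabla\hat h_i^*(s_i^k))$, $i=1,\dots,N$, converge to one and the same point of $\operatorname{arg\,min}_{\overline C}\varphi$. -/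

import Mathlib

open Filter Topology MeasureTheory ProbabilityTheory

noncomputable section

namespace BFinito

/-- The Euclidean space `ℝⁿ`. -/
abbrev Euc (n : ℕ) := EuclideanSpace ℝ (Fin n)

variable {n N : ℕ}

/-! ### Extended-real-valued functions

A function `ℝⁿ → ℝ ∪ {∞}` is a map into `EReal` that never takes the value `⊥`. -/

/-- Effective domain. -/
def edom (F : Euc n → EReal) : Set (Euc n) := {x | F x < ⊤}

/-- Real-valued version of `F`, meaningful on `edom F`. -/
def re (F : Euc n → EReal) (x : Euc n) : ℝ := (F x).toReal

/-- Proper: never `-∞`, and finite somewhere. -/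
def IsProper (F : Euc n → EReal) : Prop := (∀ x, F x ≠ ⊥) ∧ (edom F).Nonempty

/-- Gradient of `F` (meaningful at points of `interior (edom F)` where `F` is differentiable). -/
def grad (F : Euc n → EReal) (x : Euc n) : Euc n := gradient (re F) x

/-- Convex conjugate `F*(y) = sup_x ⟨y, x⟩ - F x`. -/
def conjugate (F : Euc n → EReal) (y : Euc n) : EReal :=
  ⨆ x : Euc n, ((inner ℝ y x : ℝ) : EReal) - F x

open Classical in
/-- Bregman distance `D_F(x, y)`, equal to `∞` when `y` is not interior to the domain. -/
def bregman (F : Euc n → EReal) (x y : Euc n) : EReal :=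
  if y ∈ interior (edom F) then
    F x - ((re F y : ℝ) : EReal) - ((inner ℝ (grad F y) (x - y) : ℝ) : EReal)
  else ⊤

/-- The minimizers of `F` over `S`; a minimizer has a finite value. -/
def argminOn (F : Euc n → EReal) (S : Set (Euc n)) : Set (Euc n) :=
  {x | x ∈ S ∧ F x < ⊤ ∧ ∀ w ∈ S, F x ≤ F w}

/-- Convexity of an extended-real-valued function that never takes the value `-∞`. -/
def IsConvexFun (F : Euc n → EReal) : Prop := ConvexOn ℝ (edom F) (re F)

/-- Level boundedness of `F + δ_S`: all sublevel sets of `F` within `S` are bounded. -/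
def LevelBoundedOn (F : Euc n → EReal) (S : Set (Euc n)) : Prop :=
  ∀ α : ℝ, Bornology.IsBounded {x | x ∈ S ∧ F x ≤ (α : EReal)}

/-- `v` is a regular subgradient of `F` at `x`. -/
def IsRegSubgradient (F : Euc n → EReal) (x v : Euc n) : Prop :=
  F x < ⊤ ∧
    0 ≤ liminf
      (fun y => (F y - F x - ((inner ℝ v (y - x) : ℝ) : EReal)) / ((‖y - x‖ : ℝ) : EReal))
      (𝓝[≠] x)

/-- Set of limit points of a sequence. -/
def limitSet (u : ℕ → Euc n) : Set (Euc n) := {x | MapClusterPt x atTop u}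

/-- Legendre kernel: proper, lsc, strictly convex, `C¹` on the nonempty interior of the domain,
`1`-coercive and essentially smooth. -/
structure IsLegendre (h : Euc n → EReal) : Prop where
  proper : IsProper h
  lsc : LowerSemicontinuous h
  strictConvex : StrictConvexOn ℝ (edom h) (re h)
  interior_nonempty : (interior (edom h)).Nonempty
  contDiffOn : ContDiffOn ℝ 1 (re h) (interior (edom h))
  coercive : Tendsto (fun x => h x / ((‖x‖ : ℝ) : EReal)) (Bornology.cobounded (Euc n)) (𝓝 ⊤)
  essSmooth : ∀ (x : ℕ → Euc n) (a : Euc n), (∀ k, x k ∈ interior (edom h)) →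
    a ∈ frontier (edom h) → Tendsto x atTop (𝓝 a) →
    Tendsto (fun k => ‖grad h (x k)‖) atTop atTop

/-- `L h ± f` are convex on the set `S`. -/
def ConvexPM (f h : Euc n → EReal) (L : ℝ) (S : Set (Euc n)) : Prop :=
  ConvexOn ℝ S (fun x => L * re h x + re f x) ∧ ConvexOn ℝ S (fun x => L * re h x - re f x)

/-- The proper lsc function `f` is `L`-smooth relative to `h`. -/
structure IsRelSmooth (f h : Euc n → EReal) (L : ℝ) : Prop where
  proper : IsProper f
  lsc : LowerSemicontinuous f
  dom_subset : edom h ⊆ edom f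
  nonneg : 0 ≤ L
  convexPM : ConvexPM f h L (interior (edom h))

/-! ### The problem -/

/-- `C = ⋂ᵢ int dom hᵢ`. -/
def Cset (h : Fin N → Euc n → EReal) : Set (Euc n) := ⋂ i, interior (edom (h i))

/-- `φ = (1/N) ∑ᵢ fᵢ + g`. -/
def cost (f : Fin N → Euc n → EReal) (g : Euc n → EReal) (x : Euc n) : EReal :=
  (((1 : ℝ) / (N : ℝ) : ℝ) : EReal) * ∑ i, f i x + g x

/-- The inner subproblem's solution set
`T(s) = argmin_w g(w) + ∑ᵢ hᵢ(w)/γᵢ - ⟨s, w⟩`. -/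
def Tmap (h : Fin N → Euc n → EReal) (g : Euc n → EReal) (γ : Fin N → ℝ) (s : Euc n) :
    Set (Euc n) :=
  argminOn (fun w => g w + ∑ i, ((1 / γ i : ℝ) : EReal) * h i w - ((inner ℝ s w : ℝ) : EReal))
    Set.univ

/-- The basic assumption, with stepsizes `0 < γᵢ < N / Lᵢ` (any `γᵢ > 0` when `Lᵢ = 0`). -/
structure BasicAssumption (f h : Fin N → Euc n → EReal) (g : Euc n → EReal)
    (L γ : Fin N → ℝ) : Prop where
  legendre : ∀ i, IsLegendre (h i)
  relSmooth : ∀ i, IsRelSmooth (f i) (h i) (L i)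
  g_proper : IsProper g
  g_lsc : LowerSemicontinuous g
  exists_sol : (argminOn (cost f g) (closure (Cset h))).Nonempty
  γ_pos : ∀ i, 0 < γ i
  γ_lt : ∀ i, γ i * L i < N
  range_T : ∀ s, Tmap h g γ s ⊆ Cset h

/-- Additional requirement on the distance-generating functions: each `dom hᵢ` is closed, and
`D_{hᵢ}(a, xᵏ) → 0` whenever `int dom hᵢ ∋ xᵏ → a ∈ bdry dom hᵢ`. -/
def KernelAssumption (h : Fin N → Euc n → EReal) : Prop :=
  ∀ i, IsClosed (edom (h i)) ∧
    ∀ (x : ℕ → Euc n) (a : Euc n), (∀ k, x k ∈ interior (edom (h i))) →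
      a ∈ frontier (edom (h i)) → Tendsto x atTop (𝓝 a) →
      Tendsto (fun k => bregman (h i) a (x k)) atTop (𝓝 0)

open Classical in
/-- `ĥᵢ = hᵢ/γᵢ - fᵢ/N`, with the convention `∞ - ∞ = ∞`. -/
def hhat (f h : Fin N → Euc n → EReal) (γ : Fin N → ℝ) (i : Fin N) (x : Euc n) : EReal :=
  if h i x = ⊤ then ⊤
  else ((1 / γ i : ℝ) : EReal) * h i x - (((1 : ℝ) / (N : ℝ) : ℝ) : EReal) * f i x

/-- The `i`-th residual `D_{ĥᵢ*}(sᵢ, ∇ĥᵢ(z))`. -/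
def bresidual (f h : Fin N → Euc n → EReal) (γ : Fin N → ℝ) (z : Euc n) (s : Fin N → Euc n)
    (i : Fin N) : EReal :=
  bregman (conjugate (hhat f h γ i)) (s i) (grad (hhat f h γ i) z)

/-- The Lyapunov function `𝓛(z, s) = φ(z) + ∑ᵢ D_{ĥᵢ*}(sᵢ, ∇ĥᵢ(z))`. -/
def lyapunov (f h : Fin N → Euc n → EReal) (g : Euc n → EReal) (γ : Fin N → ℝ)
    (z : Euc n) (s : Fin N → Euc n) : EReal :=
  cost f g z + ∑ i, bresidual f h γ z s i

open Classical in
/-- The lifted cost `Φ(x) = (1/N) ∑ᵢ fᵢ(xᵢ) + (1/N) ∑ᵢ g(xᵢ) + δ_Δ(x)`, where `Δ` is the consensus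
set `x₁ = ⋯ = x_N`. -/
def liftedCost (f : Fin N → Euc n → EReal) (g : Euc n → EReal) (x : Fin N → Euc n) : EReal :=
  (((1 : ℝ) / (N : ℝ) : ℝ) : EReal) * ∑ i, f i (x i)
    + (((1 : ℝ) / (N : ℝ) : ℝ) : EReal) * ∑ i, g (x i)
    + if ∀ i j, x i = x j then 0 else ⊤

/-- The Bregman-Moreau envelope `x ↦ inf_w Φ(w) + D_ĥ(w, x)` of the lifted cost with respect to the
separable kernel `ĥ(x) = ∑ᵢ ĥᵢ(xᵢ)`, for which `D_ĥ(w, x) = ∑ᵢ D_{ĥᵢ}(wᵢ, xᵢ)`. -/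
def envelope (f h : Fin N → Euc n → EReal) (g : Euc n → EReal) (γ : Fin N → ℝ)
    (x : Fin N → Euc n) : EReal :=
  ⨅ w : Fin N → Euc n, liftedCost f g w + ∑ i, bregman (hhat f h γ i) (w i) (x i)

/-- The primal table `xᵢ = ∇ĥᵢ*(sᵢ)` associated with a table `s`. -/
def primal (f h : Fin N → Euc n → EReal) (γ : Fin N → ℝ) (s : Fin N → Euc n) (i : Fin N) :
    Euc n :=
  grad (conjugate (hhat f h γ i)) (s i)

/-! ### The algorithm -/

/-- `(zᵏ, sᵏ, s̃ᵏ, Iᵏ)` is a run of the Bregman Finito/MISO algorithm started at `xinit`. The index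
set selected at iteration `k` is `I (k + 1)`; the value `I 0` is not used. -/
structure IsRun (f h : Fin N → Euc n → EReal) (g : Euc n → EReal) (γ : Fin N → ℝ)
    (xinit : Euc n) (z : ℕ → Euc n) (s : ℕ → Fin N → Euc n) (st : ℕ → Euc n)
    (I : ℕ → Finset (Fin N)) : Prop where
  s_zero : ∀ i, s 0 i =
    (1 / γ i : ℝ) • grad (h i) xinit - ((1 : ℝ) / (N : ℝ)) • grad (f i) xinit
  st_zero : st 0 = ∑ i, s 0 i
  z_mem : ∀ k, z k ∈ Tmap h g γ (st k)
  s_succ_mem : ∀ k, ∀ i ∈ I (k + 1), s (k + 1) i =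
    (1 / γ i : ℝ) • grad (h i) (z k) - ((1 : ℝ) / (N : ℝ)) • grad (f i) (z k)
  s_succ_notMem : ∀ k, ∀ i ∉ I (k + 1), s (k + 1) i = s k i
  st_succ : ∀ k, st (k + 1) = st k + ∑ i ∈ I (k + 1), (s (k + 1) i - s k i)

/-- The randomized rule: conditionally on the information `ℱ k` available at iteration `k`, the
index `i` belongs to `I (k + 1)` with probability `pᵢ > 0`. -/
structure RandomizedRule {Ω : Type*} {mΩ : MeasurableSpace Ω} (μ : Measure Ω)
    (ℱ : Filtration ℕ mΩ) (p : Fin N → ℝ)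
    (I : ℕ → Ω → Finset (Fin N)) : Prop where
  p_pos : ∀ i, 0 < p i
  meas : ∀ k i, MeasurableSet[ℱ (k + 1)] {ω | i ∈ I (k + 1) ω}
  prob : ∀ k i, μ⟦{ω | i ∈ I (k + 1) ω} | ℱ k⟧ =ᵐ[μ] fun _ => p i

end BFinito

end

open BFinito

/-!
The method is a descent method for one deterministic function of its table, and the randomization
only decides how often that function decreases.

Put `ĥᵢ = hᵢ/γᵢ - fᵢ/N`. On the interior of `dom hᵢ` the Bregman distance of `ĥᵢ` lies between
positive multiples of that of `hᵢ` (`IsEquivalentKernel`), so `∇ĥᵢ` maps this interior bijectively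
onto `ℝⁿ`; `∇ĥᵢ*` is its inverse, and `D_{ĥᵢ*}(sᵢ, ∇ĥᵢ(z)) = D_{ĥᵢ}(z, xᵢ)` for the primal table
`xᵢ = ∇ĥᵢ*(sᵢ)`. The subproblem defining `T` at `∑ᵢ sᵢ` is, up to a constant, the minimization of
`φ(w) + ∑ᵢ D_{ĥᵢ}(w, xᵢ)`. So the Lyapunov function (`lyapR`) is the Bregman-Moreau envelope of the
lifted cost at the primal table (`BasicAssumption.envelope_eq`). Replacing `xᵢ` by `z` for the
selected indices removes the corresponding residuals, and minimizing again can only decrease the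
value: this is the sure descent `IsRun.lyapR_succ_le`. Taking conditional expectations turns it into
the expected descent, and as the Lyapunov function is bounded below by the minimum of `φ`, the
residuals are almost surely summable (`ae_summable_residual`).

Everything else that does not need convexity holds for a single run with vanishing residuals. The
cost has the same limit as the Lyapunov function. If `z` converges to `a` along a subsequence, then
under the assumption on the kernels so do the entries of the primal table, with
`D_{hᵢ}(a, xᵢ) → 0` (`IsRun.tendsto_bregR_subseq`); comparing `z` with the competitor `a` in the
subproblem and using lower semicontinuity gives `φ(a) = φ⋆`. When all domains are the whole space,
comparing with arbitrary competitors and passing to the limit makes `a` a minimizer of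
`φ + ∑ᵢ (1/γᵢ + Lᵢ/N) D_{hᵢ}(·, a)`, whose second term has vanishing derivative at `a`.

When `φ` is convex, first-order optimality in the subproblem and the three-point identity bound
`∑ᵢ D_{ĥᵢ}(w, z)` by `∑ᵢ D_{ĥᵢ}(w, xᵢ)` minus the gap of the Lyapunov function to `φ(w)`, for every
minimizer `w`. Since index `i` is refreshed with probability `pᵢ`, the distances weighted by `1/pᵢ`
form a supermartingale with that gap as decrement (`weighted_bregR_supermartingale`). The gaps are
nonincreasing and summable, hence `o(1/k)`. The weighted distances converge almost surely for each
fixed `w`; simultaneous convergence for all minimizers follows because, up to a term that does not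
depend on the iterates, they are affine in `w`, so that a finite affinely spanning set of minimizers
suffices (`BasicAssumption.exists_finite_forall_tendsto_bregR`). Convergence of the iterates is then
an Opial-type argument with this common family of distances (`IsRun.exists_tendsto_of_isBounded`).
At a minimizer on the boundary of `dom hᵢ` the value of `ĥᵢ` may exceed its limit from the interior,
so the argument is run with corrected boundary values (`bregVal`).
-/

noncomputable section

namespace BFinito

/-! ### Gradients and convexity of real-valued functions -/

section Gradient

variable {E : Type*} [NormedAddCommGroup E] [InnerProductSpace ℝ E] [CompleteSpace E]

theorem _root_.HasGradientAt.tendsto_slope_right {F : E → ℝ} {v x : E} (hF : HasGradientAt F v x)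
    (d : E) :
    Tendsto (fun t : ℝ => (F (x + t • d) - F x) / t) (𝓝[>] 0) (𝓝 (inner ℝ v d)) := by
  have h1 : HasDerivAt (fun t : ℝ => F (x + t • d)) (inner ℝ v d) 0 := by
    have h2 : HasDerivAt (fun t : ℝ => x + t • d) d 0 := by
      simpa using ((hasDerivAt_id (0 : ℝ)).smul_const d).const_add x
    have h3 : HasFDerivAt F ((InnerProductSpace.toDual ℝ E) v) (x + (0 : ℝ) • d) := by
      simpa using hF.hasFDerivAt
    have h5 := h3.comp_hasDerivAt (0 : ℝ) h2
    rwa [InnerProductSpace.toDual_apply_apply] at h5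
  have h4 := (hasDerivAt_iff_tendsto_slope.1 h1).mono_left
    (nhdsWithin_mono (0 : ℝ) (fun t (ht : 0 < t) => ne_of_gt ht))
  refine h4.congr fun t => ?_
  simp [slope_def_field]

/-- A convex function lies above its tangent planes. -/
theorem _root_.ConvexOn.add_inner_gradient_le {S : Set E} {F : E → ℝ} {v x y : E}
    (hF : ConvexOn ℝ S F) (hv : HasGradientAt F v x) (hx : x ∈ S) (hy : y ∈ S) :
    F x + inner ℝ v (y - x) ≤ F y := by
  have h1 := hv.tendsto_slope_right (y - x)
  suffices inner ℝ v (y - x) ≤ F y - F x by linarith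
  refine le_of_tendsto h1 ?_
  filter_upwards [Ioc_mem_nhdsGT (zero_lt_one' ℝ)] with t ht
  rw [div_le_iff₀ ht.1]
  have h2 := hF.2 hx hy (sub_nonneg.2 ht.2) ht.1.le (sub_add_cancel 1 t)
  have h3 : (1 - t) • x + t • y = x + t • (y - x) := by module
  rw [h3] at h2
  simp only [smul_eq_mul] at h2
  nlinarith

/-- A subgradient at a point of differentiability is the gradient. -/
theorem _root_.HasGradientAt.eq_of_add_inner_le {F : E → ℝ} {v w x : E} (hv : HasGradientAt F v x)
    (hw : ∀ᶠ y in 𝓝 x, F x + inner ℝ w (y - x) ≤ F y) : w = v := by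
  have h1 := hv.tendsto_slope_right (w - v)
  have h2 : Tendsto (fun t : ℝ => x + t • (w - v)) (𝓝[>] 0) (𝓝 x) := by
    have : Continuous fun t : ℝ => x + t • (w - v) := by fun_prop
    simpa using (this.tendsto 0).mono_left nhdsWithin_le_nhds
  have h3 : inner ℝ w (w - v) ≤ inner ℝ v (w - v) := by
    refine ge_of_tendsto h1 ?_
    filter_upwards [h2.eventually hw, self_mem_nhdsWithin] with t ht (ht0 : 0 < t)
    rw [le_div_iff₀ ht0]
    simp only [add_sub_cancel_left, inner_smul_right] at ht
    linarith
  have h4 : inner ℝ (w - v) (w - v) ≤ 0 := by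
    rw [inner_sub_left]; linarith
  rw [real_inner_self_eq_norm_sq] at h4
  exact sub_eq_zero.1 (norm_eq_zero.1 (by nlinarith [norm_nonneg (w - v)]))

/-- A function squeezed between two functions touching it at `x` and having the same gradient there
has that gradient at `x`. -/
theorem _root_.HasGradientAt.of_squeeze {A B F : E → ℝ} {v x : E} (hA : HasGradientAt A v x)
    (hB : HasGradientAt B v x) (hAx : A x = F x) (hBx : B x = F x)
    (hAF : ∀ᶠ y in 𝓝 x, A y ≤ F y) (hFB : ∀ᶠ y in 𝓝 x, F y ≤ B y) : HasGradientAt F v x := by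
  rw [hasGradientAt_iff_isLittleO] at hA hB ⊢
  rw [Asymptotics.isLittleO_iff] at hA hB ⊢
  intro c hc
  filter_upwards [hA hc, hB hc, hAF, hFB] with y h1 h2 h3 h4
  rw [Real.norm_eq_abs, abs_le] at h1 h2 ⊢
  constructor <;> linarith [h1.1, h1.2, h2.1, h2.2]

end Gradient

section FiniteDim

variable {E : Type*} [NormedAddCommGroup E] [InnerProductSpace ℝ E] [FiniteDimensional ℝ E]
  [CompleteSpace E]

/-- A convex function on an open set has a subgradient at every point. -/
theorem _root_.ConvexOn.exists_subgradient {U : Set E} {F : E → ℝ} {x : E} (hF : ConvexOn ℝ U F)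
    (hU : IsOpen U) (hx : x ∈ U) : ∃ v : E, ∀ y ∈ U, F x + inner ℝ v (y - x) ≤ F y := by
  have hc : ContinuousOn F U := by simpa [hU.interior_eq] using hF.continuousOn_interior
  have hopen : IsOpen {p : E × ℝ | p.1 ∈ U ∧ F p.1 < p.2} := by
    have h1 : ContinuousOn (fun p : E × ℝ => p.2 - F p.1) (Prod.fst ⁻¹' U) :=
      continuousOn_snd.sub (hc.comp continuousOn_fst fun p hp => hp)
    have h2 := h1.isOpen_inter_preimage (hU.preimage continuous_fst) isOpen_Ioi (t := Set.Ioi 0)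
    convert h2 using 1
    ext p; simp
  obtain ⟨l, hl⟩ := geometric_hahn_banach_open_point hF.convex_strict_epigraph hopen
    (x := (x, F x)) (by simp)
  have hdec : ∀ (y : E) (r : ℝ), l (y, r) = l (y, 0) + r * l (0, 1) := by
    intro y r
    have : ((y, r) : E × ℝ) = (y, 0) + r • (0, 1) := by ext <;> simp
    rw [this, map_add, map_smul, smul_eq_mul]
  set β := l (0, 1) with hβ
  have hβneg : β < 0 := by
    have := hl (x, F x + 1) ⟨hx, by simp⟩
    rw [hdec x (F x + 1), hdec x (F x)] at this
    linarith
  have hle : ∀ y ∈ U, l (y, 0) + F y * β ≤ l (x, 0) + F x * β := by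
    intro y hy
    refine le_of_forall_pos_le_add fun ε hε => ?_
    have := hl (y, F y + ε / (-β)) ⟨hy, by simpa using div_pos hε (neg_pos.2 hβneg)⟩
    rw [hdec y, hdec x (F x)] at this
    have h5 : ε / (-β) * β = -ε := by
      rw [div_neg, neg_mul, div_mul_cancel₀ _ hβneg.ne]
    linarith
  let l' : E →L[ℝ] ℝ := (-β)⁻¹ • l.comp (ContinuousLinearMap.inl ℝ E ℝ)
  refine ⟨(InnerProductSpace.toDual ℝ E).symm l', fun y hy => ?_⟩
  rw [InnerProductSpace.toDual_symm_apply]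
  have h6 : l' (y - x) = (-β)⁻¹ * (l (y, 0) - l (x, 0)) := by
    simp only [l', _root_.smul_apply, ContinuousLinearMap.comp_apply,
      ContinuousLinearMap.inl_apply, smul_eq_mul, ← map_sub]
    simp
  rw [h6]
  have h7 := hle y hy
  have h8 : (-β)⁻¹ * (l (y, 0) - l (x, 0)) ≤ F y - F x := by
    rw [inv_mul_le_iff₀ (neg_pos.2 hβneg)]
    nlinarith
  linarith

/-- If both `H + f` and `H - f` are convex on an open set, then `f` is differentiable wherever `H`
is: the sum of a subgradient of each is a subgradient of `2H`, hence equal to its gradient, and `H +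
f` is squeezed between two functions with the same gradient. -/
theorem differentiableAt_of_convexOn_add_sub {U : Set E} {H f : E → ℝ} {x : E} (hU : IsOpen U)
    (hx : x ∈ U) (hadd : ConvexOn ℝ U fun y => H y + f y) (hsub : ConvexOn ℝ U fun y => H y - f y)
    (hH : DifferentiableAt ℝ H x) : DifferentiableAt ℝ f x := by
  obtain ⟨v₁, h₁⟩ := hadd.exists_subgradient hU hx
  obtain ⟨v₂, h₂⟩ := hsub.exists_subgradient hU hx
  have hUx : ∀ᶠ y in 𝓝 x, y ∈ U := hU.mem_nhds hx
  have hG : HasGradientAt (fun y => H y + H y) (gradient H x + gradient H x) x := by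
    have := hH.hasGradientAt.hasFDerivAt
    rw [hasGradientAt_iff_hasFDerivAt, map_add]
    exact this.add this
  have hv : v₁ + v₂ = gradient H x + gradient H x := by
    refine hG.eq_of_add_inner_le ?_
    filter_upwards [hUx] with y hy
    have := h₁ y hy
    have := h₂ y hy
    simp only [inner_add_left] at *
    linarith
  have hlin : ∀ (w : E) (c : ℝ), HasGradientAt (fun y => c + inner ℝ w (y - x)) w x := by
    intro w c
    rw [hasGradientAt_iff_hasFDerivAt]
    exact ((InnerProductSpace.toDual ℝ E w).hasFDerivAt.comp x
      ((hasFDerivAt_id x).sub_const x)).const_add c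
  have hB : HasGradientAt (fun y => (H y + H y) - ((H x - f x) + inner ℝ v₂ (y - x))) v₁ x := by
    have h4 := hG.hasFDerivAt.sub (hlin v₂ (H x - f x)).hasFDerivAt
    rw [hasGradientAt_iff_hasFDerivAt, show v₁ = (gradient H x + gradient H x) - v₂ by
      rw [← hv]; abel, map_sub]
    exact h4
  have h5 : HasGradientAt (fun y => H y + f y) v₁ x := by
    refine HasGradientAt.of_squeeze (hlin v₁ (H x + f x)) hB (by simp) (by simp) ?_ ?_
    · filter_upwards [hUx] with y hy using h₁ y hy
    · filter_upwards [hUx] with y hy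
      have := h₂ y hy
      linarith
  have h6 := h5.differentiableAt.sub hH
  refine h6.congr_of_eventuallyEq (Eventually.of_forall fun y => ?_)
  simp

end FiniteDim

variable {n N : ℕ}

/-! ### Bregman distances of Legendre kernels -/

/-- Real-valued Bregman distance, meaningful when `a ∈ dom F` and `x ∈ int dom F`. -/
def bregR (F : Euc n → EReal) (a x : Euc n) : ℝ :=
  re F a - re F x - inner ℝ (grad F x) (a - x)

/-- The Bregman distance `D_F(a, x)` with the value of `F` at `a` replaced by `e`. -/
def bregVal (F : Euc n → EReal) (e : ℝ) (a x : Euc n) : ℝ :=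
  e - re F x - inner ℝ (grad F x) (a - x)

theorem coe_re {F : Euc n → EReal} {x : Euc n} (hbot : F x ≠ ⊥) (hx : x ∈ edom F) :
    ((re F x : ℝ) : EReal) = F x :=
  EReal.coe_toReal (ne_of_lt hx) hbot

@[simp] theorem bregR_self (F : Euc n → EReal) (x : Euc n) : bregR F x x = 0 := by
  simp [bregR]

theorem bregR_three_point (F : Euc n → EReal) (a z x : Euc n) :
    bregR F a x = bregR F a z + bregR F z x + inner ℝ (grad F z - grad F x) (a - z) := by
  have : a - x = (a - z) + (z - x) := by abel
  simp only [bregR, this, inner_add_right, inner_sub_left]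
  ring

theorem bregVal_three_point (F : Euc n → EReal) (e : ℝ) (a z x : Euc n) :
    bregVal F e a x = bregVal F e a z + bregR F z x + inner ℝ (grad F z - grad F x) (a - z) := by
  have : a - x = (a - z) + (z - x) := by abel
  simp only [bregVal, bregR, this, inner_add_right, inner_sub_left]
  ring

theorem bregR_add_bregR_swap (F : Euc n → EReal) (a x : Euc n) :
    bregR F a x + bregR F x a = inner ℝ (grad F a - grad F x) (a - x) := by
  have : x - a = -(a - x) := by abel
  simp only [bregR, this, inner_neg_right, inner_sub_left]
  ring

/-- The Bregman distance in its first argument differs from the function by an affine map, so both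
have the same midpoint convexity gap. -/
theorem bregR_midpoint (F : Euc n → EReal) (a b x : Euc n) :
    bregR F ((2⁻¹ : ℝ) • (a + b)) x = 2⁻¹ * bregR F a x + 2⁻¹ * bregR F b x
      - (2⁻¹ * re F a + 2⁻¹ * re F b - re F ((2⁻¹ : ℝ) • (a + b))) := by
  have : (2⁻¹ : ℝ) • (a + b) - x = (2⁻¹ : ℝ) • (a - x) + (2⁻¹ : ℝ) • (b - x) := by module
  simp only [bregR, this, inner_add_right, inner_smul_right]
  ring

theorem bregman_eq_coe {F : Euc n → EReal} {a x : Euc n} (ha : F a ≠ ⊥) (hda : a ∈ edom F)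
    (hx : x ∈ interior (edom F)) : bregman F a x = ((bregR F a x : ℝ) : EReal) := by
  rw [bregman, if_pos hx, ← coe_re ha hda]
  simp only [bregR, EReal.coe_sub]

theorem add_smul_sub_mem_interior {S : Set (Euc n)} (hS : Convex ℝ S) {a u : Euc n}
    (ha : a ∈ closure S) (hu : u ∈ interior S) {t : ℝ} (ht : t ∈ Set.Ioc (0 : ℝ) 1) :
    a + t • (u - a) ∈ interior S := by
  have := hS.combo_closure_interior_mem_interior ha hu (sub_nonneg.2 ht.2) ht.1
    (sub_add_cancel 1 t)
  convert this using 1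
  module

theorem tendsto_add_smul_sub (a u : Euc n) :
    Tendsto (fun t : ℝ => a + t • (u - a)) (𝓝[>] 0) (𝓝 a) := by
  have : Continuous fun t : ℝ => a + t • (u - a) := by fun_prop
  simpa using (this.tendsto 0).mono_left nhdsWithin_le_nhds

theorem eventually_lt_re {F : Euc n → EReal} (hF : LowerSemicontinuous F) (hbot : ∀ x, F x ≠ ⊥)
    {a : Euc n} (ha : a ∈ edom F) {y : ℝ} (hy : y < re F a) :
    ∀ᶠ x in 𝓝 a, x ∈ edom F → y < re F x := by
  have h1 : (y : EReal) < F a := by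
    rw [← coe_re (hbot a) ha]; exact_mod_cast hy
  filter_upwards [hF a _ h1] with x hx hxd
  rw [← coe_re (hbot x) hxd] at hx
  exact_mod_cast hx

namespace IsLegendre

variable {h : Euc n → EReal} (hh : IsLegendre h)
include hh

theorem ne_bot (x : Euc n) : h x ≠ ⊥ := hh.proper.1 x

theorem convex_edom : Convex ℝ (edom h) := hh.strictConvex.1

theorem convexOn : ConvexOn ℝ (edom h) (re h) := hh.strictConvex.convexOn

theorem hasGradientAt {x : Euc n} (hx : x ∈ interior (edom h)) :
    HasGradientAt (re h) (grad h x) x :=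
  ((hh.contDiffOn.contDiffAt (isOpen_interior.mem_nhds hx)).differentiableAt
    one_ne_zero).hasGradientAt

theorem continuousOn_grad : ContinuousOn (grad h) (interior (edom h)) := by
  have h1 := hh.contDiffOn.continuousOn_fderiv_of_isOpen isOpen_interior le_rfl
  exact (InnerProductSpace.toDual ℝ (Euc n)).symm.continuous.comp_continuousOn h1

theorem continuousOn_re : ContinuousOn (re h) (interior (edom h)) := hh.contDiffOn.continuousOn

theorem bregR_nonneg {a x : Euc n} (ha : a ∈ edom h) (hx : x ∈ interior (edom h)) :
    0 ≤ bregR h a x := by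
  have := hh.convexOn.add_inner_gradient_le (hh.hasGradientAt hx) (interior_subset hx) ha
  simp only [bregR]; linarith

theorem midpoint_gap_pos {a b : Euc n} (ha : a ∈ edom h) (hb : b ∈ edom h) (hab : a ≠ b) :
    0 < 2⁻¹ * re h a + 2⁻¹ * re h b - re h ((2⁻¹ : ℝ) • (a + b)) := by
  have := hh.strictConvex.2 ha hb hab (show (0 : ℝ) < 2⁻¹ by norm_num)
    (show (0 : ℝ) < 2⁻¹ by norm_num) (by norm_num)
  rw [← smul_add] at this
  simp only [smul_eq_mul] at this
  linarith

theorem midpoint_mem {a b : Euc n} (ha : a ∈ edom h) (hb : b ∈ edom h) :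
    (2⁻¹ : ℝ) • (a + b) ∈ edom h := by
  rw [smul_add]
  exact hh.convex_edom ha hb (by norm_num) (by norm_num) (by norm_num)

theorem midpoint_mem_interior {a b : Euc n} (ha : a ∈ edom h) (hb : b ∈ interior (edom h)) :
    (2⁻¹ : ℝ) • (a + b) ∈ interior (edom h) := by
  rw [smul_add]
  exact hh.convex_edom.combo_self_interior_mem_interior ha hb (by norm_num) (by norm_num)
    (by norm_num)

theorem bregR_pos {a x : Euc n} (ha : a ∈ edom h) (hx : x ∈ interior (edom h)) (hax : a ≠ x) :
    0 < bregR h a x := by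
  have h1 := bregR_midpoint h a x x
  have h2 := hh.midpoint_gap_pos ha (interior_subset hx) hax
  have h3 := hh.bregR_nonneg (hh.midpoint_mem ha (interior_subset hx)) hx
  rw [bregR_self] at h1
  linarith

/-- Along a segment of the domain a kernel is continuous at the endpoint. -/
theorem tendsto_radial {a u : Euc n} (ha : a ∈ edom h) (hu : u ∈ edom h) :
    Tendsto (fun t : ℝ => re h (a + t • (u - a))) (𝓝[>] 0) (𝓝 (re h a)) := by
  have hseg : ∀ t ∈ Set.Ioc (0 : ℝ) 1, a + t • (u - a) = (1 - t) • a + t • u := fun t _ => by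
    module
  rw [tendsto_order]
  refine ⟨fun y hy => ?_, fun y hy => ?_⟩
  · filter_upwards [(tendsto_add_smul_sub a u).eventually
      (eventually_lt_re hh.lsc hh.ne_bot ha hy), Ioc_mem_nhdsGT (zero_lt_one' ℝ)] with t h1 ht
    refine h1 ?_
    rw [hseg t ht]
    exact hh.convex_edom ha hu (sub_nonneg.2 ht.2) ht.1.le (sub_add_cancel 1 t)
  · have h1 : Tendsto (fun t : ℝ => (1 - t) * re h a + t * re h u) (𝓝[>] 0) (𝓝 (re h a)) := by
      have : Continuous fun t : ℝ => (1 - t) * re h a + t * re h u := by fun_prop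
      simpa using (this.tendsto 0).mono_left nhdsWithin_le_nhds
    filter_upwards [h1.eventually (gt_mem_nhds hy), Ioc_mem_nhdsGT (zero_lt_one' ℝ)] with t h1 ht
    rw [hseg t ht]
    exact (hh.convexOn.2 ha hu (sub_nonneg.2 ht.2) ht.1.le (sub_add_cancel 1 t)).trans_lt h1

theorem tendsto_bregR_radial {a u x : Euc n} (ha : a ∈ edom h) (hu : u ∈ edom h) :
    Tendsto (fun t : ℝ => bregR h (a + t • (u - a)) x) (𝓝[>] 0) (𝓝 (bregR h a x)) := by
  refine ((hh.tendsto_radial ha hu).sub_const _).sub ?_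
  exact tendsto_const_nhds.inner ((tendsto_add_smul_sub a u).sub_const x)

theorem tendsto_bregR_of_mem_interior {ι : Type*} {l : Filter ι} {x : ι → Euc n} {a b : Euc n}
    (ha : a ∈ interior (edom h)) (hx : Tendsto x l (𝓝 a)) :
    Tendsto (fun k => bregR h b (x k)) l (𝓝 (bregR h b a)) := by
  have h1 : Tendsto (fun k => re h (x k)) l (𝓝 (re h a)) :=
    ((hh.continuousOn_re.continuousAt (isOpen_interior.mem_nhds ha)).tendsto).comp hx
  have h2 : Tendsto (fun k => grad h (x k)) l (𝓝 (grad h a)) :=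
    ((hh.continuousOn_grad.continuousAt (isOpen_interior.mem_nhds ha)).tendsto).comp hx
  exact (h1.const_sub _).sub (h2.inner (hx.const_sub b))

theorem exists_forall_mul_norm_le (M : ℝ) :
    ∃ R : ℝ, 0 < R ∧ ∀ x ∈ edom h, R ≤ ‖x‖ → M * ‖x‖ ≤ re h x := by
  have h1 := hh.coercive.eventually (lt_mem_nhds (EReal.coe_lt_top M))
  rw [← comap_norm_atTop, eventually_comap, eventually_atTop] at h1
  obtain ⟨R, hR⟩ := h1
  refine ⟨max R 1, by positivity, fun x hx hRx => ?_⟩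
  have h2 := hR ‖x‖ ((le_max_left _ _).trans hRx) x rfl
  have hpos : 0 < ‖x‖ := lt_of_lt_of_le (by positivity) hRx
  rw [← coe_re (hh.ne_bot x) hx, ← EReal.coe_div, EReal.coe_lt_coe_iff, lt_div_iff₀ hpos] at h2
  exact h2.le

/-- Essential smoothness in directional form: approaching a boundary point radially from the
interior, the slope tends to `-∞`. -/
theorem tendsto_inner_grad_atBot {a u : Euc n} (ha : a ∈ frontier (edom h))
    (hu : u ∈ interior (edom h)) :
    Tendsto (fun t : ℝ => inner ℝ (grad h (a + t • (u - a))) (u - a)) (𝓝[>] 0) atBot := by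
  have hmem : ∀ t ∈ Set.Ioc (0 : ℝ) 1, a + t • (u - a) ∈ interior (edom h) := fun t ht =>
    add_smul_sub_mem_interior hh.convex_edom (frontier_subset_closure ha) hu ht
  have hnorm : Tendsto (fun t : ℝ => ‖grad h (a + t • (u - a))‖) (𝓝[>] 0) atTop := by
    rw [tendsto_iff_seq_tendsto]
    intro τ hτ
    have hev := hτ.eventually (Ioc_mem_nhdsGT (zero_lt_one' ℝ))
    obtain ⟨K, hK⟩ := eventually_atTop.1 hev
    rw [← tendsto_add_atTop_iff_nat K]
    refine hh.essSmooth (fun k => a + τ (k + K) • (u - a)) a (fun k => hmem _ (hK _ (by omega))) ha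
      ?_
    exact ((tendsto_add_smul_sub a u).comp hτ).comp (tendsto_add_atTop_nat K)
  -- a ball around `u` on which `h` is bounded
  obtain ⟨r, hr, hball⟩ : ∃ r > 0, ∀ w ∈ Metric.closedBall u r,
      w ∈ interior (edom h) ∧ re h w ≤ re h u + 1 := by
    have h1 := (hh.continuousOn_re.continuousAt (isOpen_interior.mem_nhds hu)).tendsto.eventually
      (gt_mem_nhds (show re h u < re h u + 1 by linarith))
    obtain ⟨r, hr, h2⟩ := Metric.nhds_basis_closedBall.eventually_iff.1
      (h1.and (isOpen_interior.mem_nhds hu))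
    exact ⟨r, hr, fun w hw => ⟨(h2 hw).2, (h2 hw).1.le⟩⟩
  set M : ℝ := 1 + ‖grad h u‖ * ‖u - a‖ with hM
  have hkey : ∀ t ∈ Set.Ioc (0 : ℝ) 1, (1 - t) * inner ℝ (grad h (a + t • (u - a))) (u - a) ≤
      M - r * ‖grad h (a + t • (u - a))‖ := by
    intro t ht
    set x := a + t • (u - a) with hx
    set g := grad h x with hg
    set w := u + (r / ‖g‖) • g with hw
    have hgw : inner ℝ g (w - u) = r * ‖g‖ := by
      simp only [hw, add_sub_cancel_left, inner_smul_right, real_inner_self_eq_norm_sq]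
      by_cases h0 : ‖g‖ = 0
      · simp [h0]
      · field_simp
    have hwb : w ∈ Metric.closedBall u r := by
      simp only [hw, Metric.mem_closedBall, dist_self_add_left, norm_smul, norm_div, norm_norm,
        Real.norm_of_nonneg hr.le]
      by_cases h0 : ‖g‖ = 0
      · simp [h0, hr.le]
      · rw [div_mul_cancel₀ _ h0]
    have h1 := hh.convexOn.add_inner_gradient_le (hh.hasGradientAt (hmem t ht))
      (interior_subset (hmem t ht)) (interior_subset (hball w hwb).1)
    have h2 := hh.convexOn.add_inner_gradient_le (hh.hasGradientAt hu)
      (interior_subset hu) (interior_subset (hmem t ht))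
    rw [← hx] at h1 h2
    have h3 : w - x = (w - u) + (1 - t) • (u - a) := by rw [hx]; module
    have h4 : x - u = -((1 - t) • (u - a)) := by rw [hx]; module
    rw [← hg, h3, inner_add_right, inner_smul_right, hgw] at h1
    rw [h4, inner_neg_right, inner_smul_right] at h2
    have h5 : (1 - t) * inner ℝ (grad h u) (u - a) ≤ ‖grad h u‖ * ‖u - a‖ := by
      have h6 := abs_real_inner_le_norm (grad h u) (u - a)
      calc (1 - t) * inner ℝ (grad h u) (u - a) ≤ (1 - t) * |inner ℝ (grad h u) (u - a)| :=
            mul_le_mul_of_nonneg_left (le_abs_self _) (sub_nonneg.2 ht.2)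
        _ ≤ 1 * |inner ℝ (grad h u) (u - a)| :=
            mul_le_mul_of_nonneg_right (by linarith [ht.1]) (abs_nonneg _)
        _ ≤ _ := by linarith
    linarith [(hball w hwb).2]
  rw [tendsto_atBot]
  intro b
  filter_upwards [hnorm.eventually_ge_atTop ((M + |b|) / r), Ioo_mem_nhdsGT (zero_lt_one' ℝ)]
    with t h1 ht
  have h2 := hkey t ⟨ht.1, ht.2.le⟩
  rw [div_le_iff₀ hr] at h1
  have h3 : (1 - t) * inner ℝ (grad h (a + t • (u - a))) (u - a) ≤ -|b| := by linarith
  have h4 : inner ℝ (grad h (a + t • (u - a))) (u - a) ≤ -|b| := by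
    by_contra hcon
    push Not at hcon
    have : -|b| ≤ (1 - t) * -|b| := by nlinarith [abs_nonneg b, ht.1]
    have := mul_lt_mul_of_pos_left hcon (sub_pos.2 ht.2)
    linarith
  exact h4.trans (neg_abs_le b)

end IsLegendre

/-! ### Consistency of Bregman distances with convergence -/

/-- A kernel with closed domain for which `D_h(a, xᵏ) → 0` whenever interior points `xᵏ` converge to
a point `a` of the domain. -/
structure IsBregmanConsistent (h : Euc n → EReal) : Prop where
  isClosed : IsClosed (edom h)
  tendsto : ∀ (x : ℕ → Euc n) (a : Euc n), (∀ k, x k ∈ interior (edom h)) → a ∈ edom h →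
    Tendsto x atTop (𝓝 a) → Tendsto (fun k => bregR h a (x k)) atTop (𝓝 0)

theorem KernelAssumption.isBregmanConsistent {h : Fin N → Euc n → EReal} (hK : KernelAssumption h)
    {i : Fin N} (hh : IsLegendre (h i)) : IsBregmanConsistent (h i) := by
  refine ⟨(hK i).1, fun x a hx ha hxa => ?_⟩
  by_cases hai : a ∈ interior (edom (h i))
  · simpa using hh.tendsto_bregR_of_mem_interior (b := a) hai hxa
  · have h1 := (hK i).2 x a hx (by rw [(hK i).1.frontier_eq]; exact ⟨ha, hai⟩) hxa
    have h2 : ∀ k, bregman (h i) a (x k) = ((bregR (h i) a (x k) : ℝ) : EReal) := fun k =>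
      bregman_eq_coe (hh.ne_bot a) ha (hx k)
    simp only [h2] at h1
    exact EReal.tendsto_coe.1 h1

theorem kernelAssumption_of_Cset_eq_univ {h : Fin N → Euc n → EReal} (hC : Cset h = Set.univ) :
    KernelAssumption h := by
  intro i
  have h1 : edom (h i) = Set.univ := by
    refine Set.eq_univ_of_forall fun x => interior_subset ?_
    have : x ∈ Cset h := hC ▸ Set.mem_univ x
    exact Set.mem_iInter.1 this i
  rw [h1]
  exact ⟨isClosed_univ, fun x a _ ha => by simp at ha⟩

namespace IsLegendre

variable {h : Euc n → EReal} (hh : IsLegendre h)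
include hh

/-- The Bregman distance to a fixed point decreases when the second argument moves towards it. -/
theorem bregR_segment_le {z x : Euc n} (hz : z ∈ edom h) (hx : x ∈ interior (edom h)) {t : ℝ}
    (ht : t ∈ Set.Ioc (0 : ℝ) 1) : bregR h z (z + t • (x - z)) ≤ bregR h z x := by
  set y := z + t • (x - z) with hy
  have hyU : y ∈ interior (edom h) :=
    add_smul_sub_mem_interior hh.convex_edom (subset_closure hz) hx ht
  rcases eq_or_lt_of_le ht.2 with rfl | ht1
  · rw [hy, one_smul, add_sub_cancel]
  have h1 := bregR_three_point h z y x
  have h2 := hh.bregR_nonneg (interior_subset hyU) hx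
  have h3 := hh.bregR_nonneg (interior_subset hx) hyU
  have h4 := bregR_add_bregR_swap h y x
  have h5 : y - x = -((1 - t) • (x - z)) := by rw [hy]; module
  have h6 : z - y = -(t • (x - z)) := by rw [hy]; module
  rw [h5, inner_neg_right, inner_smul_right] at h4
  rw [h6, inner_neg_right, inner_smul_right] at h1
  have h7 : inner ℝ (grad h y - grad h x) (x - z) ≤ 0 := by
    by_contra hcon
    push Not at hcon
    have := mul_pos (sub_pos.2 ht1) hcon
    linarith
  have := mul_nonneg ht.1.le (neg_nonneg.2 h7)
  linarith

/-- If the second arguments do not converge to the limit of the first ones, they may be moved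
closer, along segments, to converge to a different point. -/
theorem exists_subseq_segment {z x : ℕ → Euc n} {a : Euc n} (hz : ∀ k, z k ∈ edom h)
    (hx : ∀ k, x k ∈ interior (edom h)) (hza : Tendsto z atTop (𝓝 a))
    (hxa : ¬ Tendsto x atTop (𝓝 a)) :
    ∃ (φ : ℕ → ℕ) (y : ℕ → Euc n) (b : Euc n), StrictMono φ ∧ b ≠ a ∧
      (∀ k, y k ∈ interior (edom h)) ∧ Tendsto y atTop (𝓝 b) ∧
      ∀ k, bregR h (z (φ k)) (y k) ≤ bregR h (z (φ k)) (x (φ k)) := by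
  obtain ⟨ε, hε, hfr⟩ : ∃ ε > 0, ∃ᶠ k in atTop, ε ≤ dist (x k) a := by
    by_contra hcon
    push Not at hcon
    refine hxa (Metric.tendsto_nhds.2 fun ε hε => ?_)
    filter_upwards [hcon ε hε] with k hk using hk
  have hfr2 : ∃ᶠ k in atTop, ε / 2 ≤ ‖x k - z k‖ := by
    refine (hfr.and_eventually (Metric.tendsto_nhds.1 hza (ε / 2) (half_pos hε))).mono ?_
    rintro k ⟨h1, h2⟩
    have := dist_triangle (x k) (z k) a
    rw [dist_eq_norm (x k) (z k)] at this
    linarith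
  obtain ⟨φ₁, hφ₁, hφ₁'⟩ := extraction_of_frequently_atTop hfr2
  set τ : ℕ → ℝ := fun k => (ε / 2) / ‖x (φ₁ k) - z (φ₁ k)‖ with hτ
  have hpos : ∀ k, 0 < ‖x (φ₁ k) - z (φ₁ k)‖ := fun k => (half_pos hε).trans_le (hφ₁' k)
  have hτmem : ∀ k, τ k ∈ Set.Ioc (0 : ℝ) 1 := fun k =>
    ⟨div_pos (half_pos hε) (hpos k), (div_le_one (hpos k)).2 (hφ₁' k)⟩
  set d : ℕ → Euc n := fun k => τ k • (x (φ₁ k) - z (φ₁ k)) with hd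
  have hdmem : ∀ k, d k ∈ Metric.sphere (0 : Euc n) (ε / 2) := by
    intro k
    rw [mem_sphere_zero_iff_norm, hd]
    simp only [norm_smul, Real.norm_of_nonneg (hτmem k).1.le]
    exact div_mul_cancel₀ _ (hpos k).ne'
  obtain ⟨e, he, φ₂, hφ₂, hlim⟩ := (isCompact_sphere (0 : Euc n) (ε / 2)).tendsto_subseq hdmem
  refine ⟨φ₁ ∘ φ₂, fun k => z (φ₁ (φ₂ k)) + d (φ₂ k), a + e, hφ₁.comp hφ₂, ?_, fun k => ?_, ?_,
    fun k => ?_⟩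
  · rw [mem_sphere_zero_iff_norm] at he
    intro hcon
    have : e = 0 := by simpa using hcon
    rw [this, norm_zero] at he
    linarith
  · exact add_smul_sub_mem_interior hh.convex_edom (subset_closure (hz _)) (hx _) (hτmem _)
  · exact (hza.comp (hφ₁.comp hφ₂).tendsto_atTop).add hlim
  · exact hh.bregR_segment_le (hz _) (hx _) (hτmem _)

/-- If `D_h(a, xᵏ) → 0` then `xᵏ → a`: a cluster point `b ≠ a` would satisfy `D_h(b, xᵏ) → 0` as
well, and the midpoint of `a` and `b` would then have a negative limiting Bregman distance. -/
theorem tendsto_of_bregR_tendsto_zero (hK : IsBregmanConsistent h) {x : ℕ → Euc n} {a : Euc n}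
    (ha : a ∈ edom h) (hx : ∀ k, x k ∈ interior (edom h))
    (hD : Tendsto (fun k => bregR h a (x k)) atTop (𝓝 0)) : Tendsto x atTop (𝓝 a) := by
  by_contra hxa
  obtain ⟨φ, y, b, hφ, hba, hyU, hyb, hle⟩ :=
    hh.exists_subseq_segment (fun _ => ha) hx tendsto_const_nhds hxa
  have hb : b ∈ edom h :=
    hK.isClosed.mem_of_tendsto hyb (Eventually.of_forall fun k => interior_subset (hyU k))
  have h1 : Tendsto (fun k => bregR h a (y k)) atTop (𝓝 0) :=
    squeeze_zero (fun k => hh.bregR_nonneg ha (hyU k)) hle (hD.comp hφ.tendsto_atTop)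
  have h2 := hK.tendsto y b hyU hb hyb
  have h3 := hh.midpoint_gap_pos ha hb hba.symm
  have h4 : ∀ k, 2⁻¹ * re h a + 2⁻¹ * re h b - re h ((2⁻¹ : ℝ) • (a + b)) ≤
      2⁻¹ * bregR h a (y k) + 2⁻¹ * bregR h b (y k) := fun k => by
    have := bregR_midpoint h a b (y k)
    have := hh.bregR_nonneg (hh.midpoint_mem ha hb) (hyU k)
    linarith
  have h5 := ge_of_tendsto' ((h1.const_mul 2⁻¹).add (h2.const_mul 2⁻¹)) h4
  simp only [mul_zero, add_zero] at h5
  linarith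

/-- If `D_h(zᵏ, xᵏ) → 0` and `zᵏ → a`, then `xᵏ → a`. When `xᵏ → b` instead, the midpoint convexity
gap between `b` and `zᵏ` vanishes, so `D_h(b, mᵏ) → 0` for the midpoints `mᵏ` of `b` and `zᵏ`; hence
`mᵏ → b` and `a = b`. -/
theorem tendsto_of_bregR_tendsto_zero_left (hK : IsBregmanConsistent h) {z x : ℕ → Euc n}
    {a : Euc n} (hz : ∀ k, z k ∈ interior (edom h)) (hx : ∀ k, x k ∈ interior (edom h))
    (hza : Tendsto z atTop (𝓝 a)) (hD : Tendsto (fun k => bregR h (z k) (x k)) atTop (𝓝 0)) :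
    Tendsto x atTop (𝓝 a) := by
  by_contra hxa
  obtain ⟨φ, y, b, hφ, hba, hyU, hyb, hle⟩ :=
    hh.exists_subseq_segment (fun k => interior_subset (hz k)) hx hza hxa
  have hb : b ∈ edom h :=
    hK.isClosed.mem_of_tendsto hyb (Eventually.of_forall fun k => interior_subset (hyU k))
  have h1 : Tendsto (fun k => bregR h (z (φ k)) (y k)) atTop (𝓝 0) :=
    squeeze_zero (fun k => hh.bregR_nonneg (interior_subset (hz _)) (hyU k)) hle
      (hD.comp hφ.tendsto_atTop)
  have h2 := hK.tendsto y b hyU hb hyb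
  set m : ℕ → Euc n := fun k => (2⁻¹ : ℝ) • (b + z (φ k)) with hm
  have hmU : ∀ k, m k ∈ interior (edom h) := fun k => hh.midpoint_mem_interior hb (hz _)
  have h3 : ∀ k, bregR h b (m k) ≤ bregR h b (y k) + bregR h (z (φ k)) (y k) := by
    intro k
    have e1 := bregR_midpoint h b (z (φ k)) (y k)
    have e2 := hh.bregR_nonneg (interior_subset (hmU k)) (hyU k)
    have e3 := hh.bregR_nonneg (interior_subset (hz (φ k))) (hmU k)
    have e4 := bregR_midpoint h b (z (φ k)) (m k)
    rw [show (2⁻¹ : ℝ) • (b + z (φ k)) = m k from rfl] at e1 e4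
    rw [bregR_self] at e4
    linarith
  have h4 : Tendsto (fun k => bregR h b (m k)) atTop (𝓝 0) := by
    refine squeeze_zero (fun k => hh.bregR_nonneg hb (hmU k)) h3 ?_
    simpa using h2.add h1
  have h5 := hh.tendsto_of_bregR_tendsto_zero hK hb hmU h4
  have h6 : Tendsto m atTop (𝓝 ((2⁻¹ : ℝ) • (b + a))) :=
    ((hza.comp hφ.tendsto_atTop).const_add b).const_smul _
  have h7 := tendsto_nhds_unique h5 h6
  have h8 : (2⁻¹ : ℝ) • (b + a) - b = (2⁻¹ : ℝ) • (a - b) := by module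
  rw [← h7, sub_self] at h8
  have h9 : a - b = 0 := by simpa using h8.symm
  exact hba (sub_eq_zero.1 h9).symm

end IsLegendre

/-! ### Functions equivalent to a Legendre kernel -/

/-- A function `F` with the same domain as the Legendre kernel `h`, differentiable on its interior
`U`, whose Bregman distance satisfies `c D_h ≤ D_F ≤ C D_h` on `U × U` with `c > 0`, and whose value
at any point of the domain is at least its upper limits along segments from `U` to that point. -/
structure IsEquivalentKernel (h F : Euc n → EReal) (c C : ℝ) : Prop where
  legendre : IsLegendre h
  pos : 0 < c
  ne_bot : ∀ x, F x ≠ ⊥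
  edom_eq : edom F = edom h
  differentiableAt : ∀ x ∈ interior (edom h), DifferentiableAt ℝ (re F) x
  lower : ∀ a ∈ interior (edom h), ∀ x ∈ interior (edom h), c * bregR h a x ≤ bregR F a x
  upper : ∀ a ∈ interior (edom h), ∀ x ∈ interior (edom h), bregR F a x ≤ C * bregR h a x
  radial : ∀ a ∈ edom h, ∀ u ∈ interior (edom h), ∀ y > re F a,
    ∀ᶠ t : ℝ in 𝓝[>] 0, re F (a + t • (u - a)) < y

namespace IsEquivalentKernel

variable {h F : Euc n → EReal} {c C : ℝ} (hF : IsEquivalentKernel h F c C)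
include hF

theorem hasGradientAt {x : Euc n} (hx : x ∈ interior (edom h)) :
    HasGradientAt (re F) (grad F x) x :=
  (hF.differentiableAt x hx).hasGradientAt

/-- At a point `a` of the domain, a boundary point possibly, there is a value `e ≤ F a` which
replaces `F a` so that the comparison of Bregman distances persists: a limit of the values of `F`
along a segment ending at `a`. -/
theorem exists_boundary_value {a : Euc n} (ha : a ∈ edom h) :
    ∃ e : ℝ, e ≤ re F a ∧ ∀ x ∈ interior (edom h),
      c * bregR h a x ≤ bregVal F e a x ∧ bregVal F e a x ≤ C * bregR h a x := by
  have hh := hF.legendre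
  obtain ⟨u, hu⟩ := hh.interior_nonempty
  have hmem : ∀ t ∈ Set.Ioc (0 : ℝ) 1, a + t • (u - a) ∈ interior (edom h) := fun t ht =>
    add_smul_sub_mem_interior hh.convex_edom (subset_closure ha) hu ht
  have hτ : Tendsto (fun k : ℕ => 1 / ((k : ℝ) + 1)) atTop (𝓝[>] 0) := by
    refine tendsto_nhdsWithin_iff.2 ⟨tendsto_one_div_add_atTop_nhds_zero_nat, ?_⟩
    exact Eventually.of_forall fun k => by simp only [Set.mem_Ioi]; positivity
  have hτm : ∀ k : ℕ, 1 / ((k : ℝ) + 1) ∈ Set.Ioc (0 : ℝ) 1 := fun k =>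
    ⟨by positivity, (div_le_one (by positivity)).2 (by linarith [k.cast_nonneg (α := ℝ)])⟩
  set w : ℕ → Euc n := fun k => a + (1 / ((k : ℝ) + 1)) • (u - a) with hw
  have hwU : ∀ k, w k ∈ interior (edom h) := fun k => hmem _ (hτm k)
  have hwa : Tendsto w atTop (𝓝 a) := (tendsto_add_smul_sub a u).comp hτ
  have hhw : ∀ x, Tendsto (fun k => bregR h (w k) x) atTop (𝓝 (bregR h a x)) := fun x =>
    (hh.tendsto_bregR_radial ha (interior_subset hu)).comp hτ
  have hin : ∀ x, Tendsto (fun k => inner ℝ (grad F x) (w k - x)) atTop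
      (𝓝 (inner ℝ (grad F x) (a - x))) := fun x =>
    tendsto_const_nhds.inner (hwa.sub_const x)
  -- the values of `F` along the segment are bounded
  have hbd : ∃ M : ℝ, ∀ k, re F (w k) ∈ Metric.closedBall (0 : ℝ) M := by
    have hlo : Tendsto (fun k => c * bregR h (w k) u + re F u + inner ℝ (grad F u) (w k - u))
        atTop (𝓝 _) := (((hhw u).const_mul c).add_const _).add (hin u)
    have hup : Tendsto (fun k => C * bregR h (w k) u + re F u + inner ℝ (grad F u) (w k - u))
        atTop (𝓝 _) := (((hhw u).const_mul C).add_const _).add (hin u)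
    obtain ⟨A, hA⟩ := hlo.bddBelow_range
    obtain ⟨B, hB⟩ := hup.bddAbove_range
    refine ⟨max |A| |B|, fun k => ?_⟩
    rw [mem_closedBall_zero_iff, Real.norm_eq_abs]
    refine abs_le_max_abs_abs ?_ ?_
    · have h1 := hA ⟨k, rfl⟩
      have h2 := hF.lower (w k) (hwU k) u hu
      simp only [bregR] at h1 h2
      linarith
    · have h1 := hB ⟨k, rfl⟩
      have h2 := hF.upper (w k) (hwU k) u hu
      simp only [bregR] at h1 h2
      linarith
  obtain ⟨M, hM⟩ := hbd
  obtain ⟨e, -, φ, hφ, he⟩ := (isCompact_closedBall (0 : ℝ) M).tendsto_subseq hM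
  have hφt := hφ.tendsto_atTop
  refine ⟨e, ?_, fun x hx => ?_⟩
  · refine le_of_forall_gt_imp_ge_of_dense fun y hy => ?_
    refine le_of_tendsto he ?_
    filter_upwards [(hτ.comp hφt).eventually (hF.radial a ha u hu y hy)] with k hk using hk.le
  · have h1 : Tendsto (fun k => bregR F (w (φ k)) x) atTop
        (𝓝 (bregVal F e a x)) :=
      (he.sub_const _).sub ((hin x).comp hφt)
    exact ⟨le_of_tendsto_of_tendsto' (((hhw x).comp hφt).const_mul c) h1 fun k =>
        hF.lower _ (hwU _) x hx,
      le_of_tendsto_of_tendsto' h1 (((hhw x).comp hφt).const_mul C) fun k =>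
        hF.upper _ (hwU _) x hx⟩

theorem mul_bregR_le {a x : Euc n} (ha : a ∈ edom h) (hx : x ∈ interior (edom h)) :
    c * bregR h a x ≤ bregR F a x := by
  obtain ⟨e, he, h1⟩ := hF.exists_boundary_value ha
  have := (h1 x hx).1
  simp only [bregR, bregVal] at *
  linarith

theorem bregR_nonneg {a x : Euc n} (ha : a ∈ edom h) (hx : x ∈ interior (edom h)) :
    0 ≤ bregR F a x :=
  (mul_nonneg hF.pos.le (hF.legendre.bregR_nonneg ha hx)).trans (hF.mul_bregR_le ha hx)

theorem bregR_pos {a x : Euc n} (ha : a ∈ edom h) (hx : x ∈ interior (edom h)) (hax : a ≠ x) :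
    0 < bregR F a x :=
  (mul_pos hF.pos (hF.legendre.bregR_pos ha hx hax)).trans_le (hF.mul_bregR_le ha hx)

theorem add_inner_le {a x : Euc n} (ha : a ∈ edom h) (hx : x ∈ interior (edom h)) :
    re F x + inner ℝ (grad F x) (a - x) ≤ re F a := by
  have := hF.bregR_nonneg ha hx
  simp only [bregR] at this
  linarith

theorem continuousOn_re : ContinuousOn (re F) (interior (edom h)) := fun x hx =>
  (hF.differentiableAt x hx).continuousAt.continuousWithinAt

theorem convexOn_interior : ConvexOn ℝ (interior (edom h)) (re F) := by
  refine ⟨hF.legendre.convex_edom.interior, fun x hx y hy a b ha hb hab => ?_⟩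
  have hz := hF.legendre.convex_edom.interior hx hy ha hb hab
  have h1 := hF.add_inner_le (interior_subset hx) hz
  have h2 := hF.add_inner_le (interior_subset hy) hz
  set z := a • x + b • y with hzdef
  have h3 : a • (x - z) + b • (y - z) = 0 := by
    have : a • (x - z) + b • (y - z) = (a • x + b • y) - (a + b) • z := by module
    rw [this, hab, one_smul, sub_self]
  have h4 : a * inner ℝ (grad F z) (x - z) + b * inner ℝ (grad F z) (y - z) = 0 := by
    rw [← inner_smul_right, ← inner_smul_right, ← inner_add_right, h3, inner_zero_right]
  simp only [smul_eq_mul]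
  have h5 : re F z = a * re F z + b * re F z := by rw [← add_mul, hab, one_mul]
  have h6 := mul_le_mul_of_nonneg_left h1 ha
  have h7 := mul_le_mul_of_nonneg_left h2 hb
  rw [mul_add] at h6 h7
  linarith

theorem tendsto_inner_grad_atBot {a u : Euc n} (ha : a ∈ frontier (edom h))
    (hu : u ∈ interior (edom h)) :
    Tendsto (fun t : ℝ => inner ℝ (grad F (a + t • (u - a))) (u - a)) (𝓝[>] 0) atBot := by
  have hh := hF.legendre
  have h1 : Tendsto (fun t : ℝ => inner ℝ (grad F u) (u - a) - c * inner ℝ (grad h u) (u - a)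
      + c * inner ℝ (grad h (a + t • (u - a))) (u - a)) (𝓝[>] 0) atBot :=
    tendsto_atBot_add_const_left _ _
      ((hh.tendsto_inner_grad_atBot ha hu).const_mul_atBot hF.pos)
  refine tendsto_atBot_mono' _ ?_ h1
  filter_upwards [Ioo_mem_nhdsGT (zero_lt_one' ℝ)] with t ht
  have hx : a + t • (u - a) ∈ interior (edom h) :=
    add_smul_sub_mem_interior hh.convex_edom (frontier_subset_closure ha) hu ⟨ht.1, ht.2.le⟩
  set x := a + t • (u - a) with hxdef
  have e1 := bregR_add_bregR_swap F u x
  have e2 := bregR_add_bregR_swap h u x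
  have e3 := hF.lower u hu x hx
  have e4 := hF.lower x hx u hu
  have e5 : u - x = (1 - t) • (u - a) := by rw [hxdef]; module
  rw [e5, inner_smul_right, inner_sub_left] at e1 e2
  have e6 : 0 ≤ (1 - t) * ((inner ℝ (grad F u) (u - a) - inner ℝ (grad F x) (u - a))
      - c * (inner ℝ (grad h u) (u - a) - inner ℝ (grad h x) (u - a))) := by
    linear_combination e3 + e4 + e1 - c * e2
  have e7 := nonneg_of_mul_nonneg_right e6 (sub_pos.2 ht.2)
  linarith

/-- Superlinear growth is inherited from the kernel. -/
theorem exists_forall_mul_norm_le (M : ℝ) :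
    ∃ R : ℝ, 0 < R ∧ ∀ x ∈ edom h, R ≤ ‖x‖ → M * ‖x‖ ≤ re F x := by
  have hh := hF.legendre
  obtain ⟨u, hu⟩ := hh.interior_nonempty
  -- `F` is bounded below by `c h` plus an affine function of slope `v`
  set v := grad F u - c • grad h u with hv
  set κ : ℝ := re F u - inner ℝ (grad F u) u - c * (re h u - inner ℝ (grad h u) u) with hκ
  have hlow : ∀ x ∈ edom h, c * re h x - ‖v‖ * ‖x‖ - |κ| ≤ re F x := by
    intro x hx
    have h1 := hF.mul_bregR_le hx hu
    have h2 : -(‖v‖ * ‖x‖) ≤ inner ℝ v x := (abs_le.1 (abs_real_inner_le_norm v x)).1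
    have h3 := neg_abs_le κ
    simp only [bregR, inner_sub_right] at h1
    rw [hv, inner_sub_left, inner_smul_left, RCLike.conj_to_real] at h2
    rw [← hv] at h2
    linarith
  obtain ⟨R, hR, hR'⟩ := hh.exists_forall_mul_norm_le ((M + ‖v‖ + |κ|) / c)
  refine ⟨max R 1, by positivity, fun x hx hRx => ?_⟩
  have h1 := hR' x hx ((le_max_left _ _).trans hRx)
  have h2 := hlow x hx
  have h3 : 1 ≤ ‖x‖ := (le_max_right _ _).trans hRx
  have h4 : (M + ‖v‖ + |κ|) * ‖x‖ ≤ c * re h x := by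
    have := mul_le_mul_of_nonneg_left h1 hF.pos.le
    rwa [← mul_assoc, mul_div_cancel₀ _ hF.pos.ne'] at this
  have := mul_le_mul_of_nonneg_left h3 (abs_nonneg κ)
  linarith

/-- The gradient maps the interior of the domain onto the whole space: a minimizer of
`F - ⟨y, ·⟩` over the interior exists by coercivity, and a minimizing sequence cannot reach the
boundary, where the slope towards the interior is `-∞`. -/
theorem exists_grad_eq (y : Euc n) : ∃ x ∈ interior (edom h), grad F x = y := by
  have hh := hF.legendre
  obtain ⟨u, hu⟩ := hh.interior_nonempty
  set U := interior (edom h) with hU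
  set ψ : Euc n → ℝ := fun x => re F x - inner ℝ y x with hψ
  have hψc : ContinuousOn ψ U := hF.continuousOn_re.sub (by fun_prop)
  have hψbd : ∀ x ∈ U, ψ u + inner ℝ (grad F u - y) (x - u) ≤ ψ x := fun x hx => by
    have := hF.add_inner_le (interior_subset hx) hu
    simp only [hψ, inner_sub_left, inner_sub_right] at *
    linarith
  have hψgrad : ∀ x ∈ U, ∀ w ∈ U, ψ x + inner ℝ (grad F x - y) (w - x) ≤ ψ w := fun x hx w hw => by
    have := hF.add_inner_le (interior_subset hw) hx
    simp only [hψ, inner_sub_left, inner_sub_right] at *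
    linarith
  obtain ⟨R, hR, hRle⟩ := hF.exists_forall_mul_norm_le (‖y‖ + (|ψ u| + 1))
  have hcoer : ∀ x ∈ U, ψ x ≤ ψ u → ‖x‖ ≤ max R 1 := by
    intro x hx hxu
    by_contra hcon
    push Not at hcon
    have h1 := hRle x (interior_subset hx) ((le_max_left _ _).trans hcon.le)
    have h2 : inner ℝ y x ≤ ‖y‖ * ‖x‖ := real_inner_le_norm y x
    have h3 : 1 < ‖x‖ := (le_max_right _ _).trans_lt hcon
    have h4 : (|ψ u| + 1) * 1 ≤ (|ψ u| + 1) * ‖x‖ :=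
      mul_le_mul_of_nonneg_left h3.le (by positivity)
    have h5 := le_abs_self (ψ u)
    simp only [hψ] at *
    linarith
  -- the infimum over the interior
  have hbdd : BddBelow (ψ '' {x ∈ U | ψ x ≤ ψ u}) := by
    refine ⟨ψ u - ‖grad F u - y‖ * (max R 1 + ‖u‖), ?_⟩
    rintro _ ⟨x, ⟨hx, hxu⟩, rfl⟩
    have h1 := hψbd x hx
    have h2 := (abs_le.1 (abs_real_inner_le_norm (grad F u - y) (x - u))).1
    have h3 : ‖x - u‖ ≤ max R 1 + ‖u‖ := (norm_sub_le x u).trans (by linarith [hcoer x hx hxu])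
    have h4 := mul_le_mul_of_nonneg_left h3 (norm_nonneg (grad F u - y))
    linarith
  set m := sInf (ψ '' {x ∈ U | ψ x ≤ ψ u}) with hm
  have hne : (ψ '' {x ∈ U | ψ x ≤ ψ u}).Nonempty := ⟨_, u, ⟨hu, le_rfl⟩, rfl⟩
  have hmle : ∀ x ∈ U, m ≤ ψ x := by
    intro x hx
    rcases le_or_gt (ψ x) (ψ u) with h1 | h1
    · exact csInf_le hbdd ⟨x, ⟨hx, h1⟩, rfl⟩
    · exact (csInf_le hbdd ⟨u, ⟨hu, le_rfl⟩, rfl⟩).trans h1.le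
  obtain ⟨v, -, hv, hvmem⟩ := exists_seq_tendsto_sInf hne hbdd
  choose x hx hxv using hvmem
  have hxb : ∀ k, x k ∈ Metric.closedBall (0 : Euc n) (max R 1) := fun k => by
    rw [mem_closedBall_zero_iff]
    exact hcoer _ (hx k).1 (hx k).2
  obtain ⟨a, -, φ, hφ, ha⟩ := (isCompact_closedBall (0 : Euc n) (max R 1)).tendsto_subseq hxb
  have hval : Tendsto (fun k => ψ (x (φ k))) atTop (𝓝 m) := by
    simp only [hxv]; exact hv.comp hφ.tendsto_atTop
  have hacl : a ∈ closure (edom h) :=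
    mem_closure_of_tendsto ha (Eventually.of_forall fun k => interior_subset (hx _).1)
  have haU : a ∈ U := by
    by_contra hnot
    have haf : a ∈ frontier (edom h) := ⟨hacl, hnot⟩
    have hmem : ∀ t ∈ Set.Ioc (0 : ℝ) 1, a + t • (u - a) ∈ U := fun t ht =>
      add_smul_sub_mem_interior hh.convex_edom hacl hu ht
    have hψseg : ∀ t ∈ Set.Ioc (0 : ℝ) 1, ψ (a + t • (u - a)) ≤ (1 - t) * m + t * ψ u := by
      intro t ht
      have h1 : ∀ k, ψ (x (φ k) + t • (u - x (φ k))) ≤ (1 - t) * ψ (x (φ k)) + t * ψ u := by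
        intro k
        have h2 := hF.convexOn_interior.2 (hx (φ k)).1 hu (sub_nonneg.2 ht.2) ht.1.le
          (sub_add_cancel 1 t)
        have h3 : (1 - t) • x (φ k) + t • u = x (φ k) + t • (u - x (φ k)) := by module
        rw [h3] at h2
        simp only [hψ, smul_eq_mul, inner_add_right, inner_smul_right, inner_sub_right] at h2 ⊢
        linarith
      refine le_of_tendsto_of_tendsto' ?_ ((hval.const_mul (1 - t)).add_const _) h1
      refine ((hψc.continuousAt (isOpen_interior.mem_nhds (hmem t ht))).tendsto).comp ?_
      exact ha.add ((ha.const_sub u).const_smul t)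
    have hslope := (hF.tendsto_inner_grad_atBot haf hu).eventually_lt_atBot (inner ℝ y (u - a))
    -- comparing with a point of the segment of negative slope, `ψ` exceeds its infimum near `a`
    obtain ⟨t, hts, ht⟩ := (hslope.and (Ioc_mem_nhdsGT (zero_lt_one' ℝ))).exists
    have hlim : Tendsto (fun s : ℝ => (1 - s) * m + s * ψ u - s * inner ℝ (grad F
        (a + t • (u - a)) - y) (u - a)) (𝓝[>] 0) (𝓝 m) := by
      have : Continuous fun s : ℝ => (1 - s) * m + s * ψ u - s * inner ℝ (grad F
        (a + t • (u - a)) - y) (u - a) := by fun_prop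
      simpa using (this.tendsto 0).mono_left nhdsWithin_le_nhds
    have hcmp : m - t * inner ℝ (grad F (a + t • (u - a)) - y) (u - a) ≤ m := by
      refine ge_of_tendsto hlim ?_
      filter_upwards [Ioc_mem_nhdsGT (zero_lt_one' ℝ)] with s hs
      have h1 := hψgrad _ (hmem t ht) _ (hmem s hs)
      have h2 := hmle _ (hmem t ht)
      have h3 := hψseg s hs
      have h4 : a + s • (u - a) - (a + t • (u - a)) = (s - t) • (u - a) := by module
      rw [h4, inner_smul_right] at h1
      linarith
    rw [inner_sub_left] at hcmp
    have := mul_pos ht.1 (sub_pos.2 hts)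
    linarith
  have hmin : ψ a = m :=
    tendsto_nhds_unique ((hψc.continuousAt (isOpen_interior.mem_nhds haU)).tendsto.comp ha) hval
  refine ⟨a, haU, ((hF.hasGradientAt haU).eq_of_add_inner_le ?_).symm⟩
  filter_upwards [isOpen_interior.mem_nhds haU] with w hw
  have := hmle w hw
  rw [← hmin] at this
  simp only [hψ, inner_sub_right] at *
  linarith

end IsEquivalentKernel

/-! ### The conjugate of an equivalent kernel -/

namespace IsEquivalentKernel

variable {h F : Euc n → EReal} {c C : ℝ} (hF : IsEquivalentKernel h F c C)
include hF

theorem conjugate_grad {x : Euc n} (hx : x ∈ interior (edom h)) :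
    conjugate F (grad F x) = ((inner ℝ (grad F x) x - re F x : ℝ) : EReal) := by
  refine le_antisymm (iSup_le fun w => ?_) ?_
  · by_cases hw : w ∈ edom F
    · rw [← coe_re (hF.ne_bot w) hw, ← EReal.coe_sub, EReal.coe_le_coe_iff]
      have := hF.add_inner_le (hF.edom_eq ▸ hw) hx
      rw [inner_sub_right] at this
      linarith
    · have : F w = ⊤ := not_lt_top_iff.1 hw
      rw [this, EReal.sub_top]
      exact bot_le
  · have hxd : x ∈ edom F := hF.edom_eq ▸ interior_subset hx
    rw [EReal.coe_sub, coe_re (hF.ne_bot x) hxd]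
    exact le_iSup (fun w : Euc n => ((inner ℝ (grad F x) w : ℝ) : EReal) - F w) x

theorem re_conjugate_grad {x : Euc n} (hx : x ∈ interior (edom h)) :
    re (conjugate F) (grad F x) = inner ℝ (grad F x) x - re F x := by
  rw [re, hF.conjugate_grad hx, EReal.toReal_coe]

theorem edom_conjugate : edom (conjugate F) = Set.univ := by
  refine Set.eq_univ_of_forall fun y => ?_
  obtain ⟨x, hx, rfl⟩ := hF.exists_grad_eq y
  change conjugate F _ < ⊤
  rw [hF.conjugate_grad hx]
  exact EReal.coe_lt_top _

/-- The inverse of the gradient is continuous: on a small sphere around `x₀` the Bregman distance to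
`x₀` is bounded away from zero, so by convexity it grows at least linearly outside of it, whereas it
is at most `‖∇F x - ∇F x₀‖ ‖x - x₀‖`. -/
theorem tendsto_of_tendsto_grad {ι : Type*} {l : Filter ι} {x : ι → Euc n} {x₀ : Euc n}
    (hx : ∀ i, x i ∈ interior (edom h)) (hx₀ : x₀ ∈ interior (edom h))
    (hg : Tendsto (fun i => grad F (x i)) l (𝓝 (grad F x₀))) : Tendsto x l (𝓝 x₀) := by
  obtain ⟨r, hr, hball⟩ := Metric.nhds_basis_closedBall.mem_iff.1 (isOpen_interior.mem_nhds hx₀)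
  rw [Metric.tendsto_nhds]
  intro ε' hε'
  obtain ⟨ε, hε, hεr, hεε'⟩ : ∃ ε > 0, ε ≤ r ∧ ε ≤ ε' :=
    ⟨min r ε', lt_min hr hε', min_le_left _ _, min_le_right _ _⟩
  have hsub : Metric.sphere x₀ ε ⊆ interior (edom h) := fun w hw =>
    hball (Metric.closedBall_subset_closedBall hεr (Metric.sphere_subset_closedBall hw))
  obtain ⟨δ, hδ, hδle⟩ : ∃ δ > 0, ∀ w ∈ Metric.sphere x₀ ε, δ ≤ bregR F w x₀ := by
    rcases (Metric.sphere x₀ ε).eq_empty_or_nonempty with hemp | hne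
    · exact ⟨1, one_pos, by simp [hemp]⟩
    · have hcont : ContinuousOn (fun w => bregR F w x₀) (Metric.sphere x₀ ε) :=
        ((hF.continuousOn_re.mono hsub).sub continuousOn_const).sub (by fun_prop)
      obtain ⟨w, hw, hwmin⟩ := (isCompact_sphere x₀ ε).exists_isMinOn hne hcont
      refine ⟨_, hF.bregR_pos (interior_subset (hsub hw)) hx₀ ?_, fun w' hw' => hwmin hw'⟩
      rintro rfl
      rw [mem_sphere_iff_norm, sub_self, norm_zero] at hw
      linarith
  filter_upwards [Metric.tendsto_nhds.1 hg (δ / ε) (div_pos hδ hε)] with i hi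
  refine lt_of_lt_of_le ?_ hεε'
  by_contra hcon
  push Not at hcon
  rw [dist_eq_norm] at hi hcon
  have hpos : 0 < ‖x i - x₀‖ := hε.trans_le hcon
  set t := ε / ‖x i - x₀‖ with ht
  have ht0 : 0 < t := div_pos hε hpos
  have ht1 : t ≤ 1 := (div_le_one hpos).2 hcon
  have htm : t * ‖x i - x₀‖ = ε := div_mul_cancel₀ _ hpos.ne'
  have h1 : δ ≤ bregR F (x₀ + t • (x i - x₀)) x₀ := by
    refine hδle _ ?_
    rw [mem_sphere_iff_norm, add_sub_cancel_left, norm_smul, Real.norm_of_nonneg ht0.le, htm]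
  have h2 : bregR F (x₀ + t • (x i - x₀)) x₀ ≤ t * bregR F (x i) x₀ := by
    have := hF.convexOn_interior.2 hx₀ (hx i) (sub_nonneg.2 ht1) ht0.le (sub_add_cancel 1 t)
    rw [show (1 - t) • x₀ + t • x i = x₀ + t • (x i - x₀) by module] at this
    simp only [smul_eq_mul] at this
    simp only [bregR, add_sub_cancel_left, inner_smul_right]
    linarith
  have h3 : bregR F (x i) x₀ ≤ ‖grad F (x i) - grad F x₀‖ * ‖x i - x₀‖ := by
    have e1 := bregR_add_bregR_swap F (x i) x₀
    have e2 := hF.bregR_nonneg (interior_subset hx₀) (hx i)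
    have e3 := real_inner_le_norm (grad F (x i) - grad F x₀) (x i - x₀)
    linarith
  have h4 : δ ≤ ε * ‖grad F (x i) - grad F x₀‖ := by
    have := mul_le_mul_of_nonneg_left h3 ht0.le
    rw [← htm]
    linarith
  rw [lt_div_iff₀ hε] at hi
  linarith


theorem hasGradientAt_conjugate {x : Euc n} (hx : x ∈ interior (edom h)) :
    HasGradientAt (re (conjugate F)) x (grad F x) := by
  choose X hXU hX using hF.exists_grad_eq
  have hXx : Tendsto X (𝓝 (grad F x)) (𝓝 x) :=
    hF.tendsto_of_tendsto_grad hXU hx (by simp only [hX]; exact tendsto_id)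
  rw [hasGradientAt_iff_isLittleO, Asymptotics.isLittleO_iff]
  intro ε hε
  filter_upwards [Metric.tendsto_nhds.1 hXx ε hε] with y hy
  rw [dist_eq_norm] at hy
  have e0 : re (conjugate F) y = inner ℝ y (X y) - re F (X y) := by
    have := hF.re_conjugate_grad (hXU y)
    rwa [hX y] at this
  have e1 := hF.add_inner_le (interior_subset (hXU y)) hx
  have e2 := hF.add_inner_le (interior_subset hx) (hXU y)
  rw [hX y] at e2
  have e3 := real_inner_le_norm (y - grad F x) (X y - x)
  have e4 : ‖y - grad F x‖ * ‖X y - x‖ ≤ ε * ‖y - grad F x‖ := by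
    rw [mul_comm]; exact mul_le_mul_of_nonneg_right hy.le (norm_nonneg _)
  rw [hF.re_conjugate_grad hx, e0, real_inner_comm (y - grad F x) x, Real.norm_eq_abs, abs_le]
  simp only [inner_sub_left, inner_sub_right] at *
  have := mul_nonneg hε.le (norm_nonneg (y - grad F x))
  constructor <;> linarith

theorem grad_conjugate_grad {x : Euc n} (hx : x ∈ interior (edom h)) :
    grad (conjugate F) (grad F x) = x :=
  (hF.hasGradientAt_conjugate hx).gradient

theorem grad_conjugate_mem (s : Euc n) : grad (conjugate F) s ∈ interior (edom h) := by
  obtain ⟨x, hx, rfl⟩ := hF.exists_grad_eq s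
  rwa [hF.grad_conjugate_grad hx]

theorem grad_grad_conjugate (s : Euc n) : grad F (grad (conjugate F) s) = s := by
  obtain ⟨x, hx, rfl⟩ := hF.exists_grad_eq s
  rw [hF.grad_conjugate_grad hx]

theorem continuous_grad_conjugate : Continuous (grad (conjugate F)) :=
  continuous_iff_continuousAt.2 fun s =>
    hF.tendsto_of_tendsto_grad hF.grad_conjugate_mem (hF.grad_conjugate_mem s)
      (by simp only [hF.grad_grad_conjugate]; exact tendsto_id)

/-- Duality of Bregman distances: `D_{F*}(s, ∇F(z)) = D_F(z, ∇F*(s))`. -/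
theorem bregman_conjugate (s : Euc n) {z : Euc n} (hz : z ∈ interior (edom h)) :
    bregman (conjugate F) s (grad F z) =
      ((bregR F z (grad (conjugate F) s) : ℝ) : EReal) := by
  have h1 : grad F z ∈ interior (edom (conjugate F)) := by simp [hF.edom_conjugate]
  have h2 := hF.conjugate_grad (hF.grad_conjugate_mem s)
  rw [hF.grad_grad_conjugate] at h2
  rw [bregman, if_pos h1, h2, hF.grad_conjugate_grad hz, hF.re_conjugate_grad hz, ← EReal.coe_sub,
    ← EReal.coe_sub, EReal.coe_eq_coe_iff, bregR, hF.grad_grad_conjugate, inner_sub_right,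
    inner_sub_right, real_inner_comm z s, real_inner_comm z (grad F z)]
  ring

/-- Bregman distances from an interior point have bounded sublevel sets in their second argument:
they bound the gradient, and the inverse of the gradient is continuous. -/
theorem isBounded_setOf_bregR_le {a : Euc n} (ha : a ∈ interior (edom h)) (M : ℝ) :
    Bornology.IsBounded {x | x ∈ interior (edom h) ∧ bregR F a x ≤ M} := by
  obtain ⟨r, hr, hball⟩ : ∃ r > 0, ∀ w ∈ Metric.closedBall a r,
      w ∈ interior (edom h) ∧ re F w ≤ re F a + 1 := by
    have h1 := (hF.continuousOn_re.continuousAt (isOpen_interior.mem_nhds ha)).tendsto.eventually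
      (gt_mem_nhds (show re F a < re F a + 1 by linarith))
    obtain ⟨r, hr, h2⟩ := Metric.nhds_basis_closedBall.eventually_iff.1
      (h1.and (isOpen_interior.mem_nhds ha))
    exact ⟨r, hr, fun w hw => ⟨(h2 hw).2, (h2 hw).1.le⟩⟩
  refine (((isCompact_closedBall (0 : Euc n) ((M + 1) / r)).image
    hF.continuous_grad_conjugate).isBounded).subset ?_
  rintro x ⟨hx, hxM⟩
  refine ⟨grad F x, ?_, hF.grad_conjugate_grad hx⟩
  rw [mem_closedBall_zero_iff, le_div_iff₀ hr]
  set g := grad F x with hg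
  set w := a + (r / ‖g‖) • g with hw
  have hgw : inner ℝ g (w - a) = r * ‖g‖ := by
    simp only [hw, add_sub_cancel_left, inner_smul_right, real_inner_self_eq_norm_sq]
    by_cases h0 : ‖g‖ = 0
    · simp [h0]
    · field_simp
  have hwb : w ∈ Metric.closedBall a r := by
    simp only [hw, Metric.mem_closedBall, dist_self_add_left, norm_smul, norm_div, norm_norm,
      Real.norm_of_nonneg hr.le]
    by_cases h0 : ‖g‖ = 0
    · simp [h0, hr.le]
    · rw [div_mul_cancel₀ _ h0]
  have h1 := hF.add_inner_le (interior_subset (hball w hwb).1) hx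
  have h2 := (hball w hwb).2
  rw [← hg, show w - x = (w - a) + (a - x) by abel, inner_add_right, hgw] at h1
  rw [bregR, ← hg] at hxM
  linarith

end IsEquivalentKernel

/-! ### The shifted kernels -/

namespace IsRelSmooth

variable {f h : Euc n → EReal} {L : ℝ}

theorem differentiableAt (hf : IsRelSmooth f h L) (hh : IsLegendre h) {x : Euc n}
    (hx : x ∈ interior (edom h)) : DifferentiableAt ℝ (re f) x :=
  differentiableAt_of_convexOn_add_sub isOpen_interior hx hf.convexPM.1 hf.convexPM.2
    ((hh.hasGradientAt hx).differentiableAt.const_mul L)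

theorem hasGradientAt (hf : IsRelSmooth f h L) (hh : IsLegendre h) {x : Euc n}
    (hx : x ∈ interior (edom h)) : HasGradientAt (re f) (grad f x) x :=
  (hf.differentiableAt hh hx).hasGradientAt

theorem abs_bregR_le (hf : IsRelSmooth f h L) (hh : IsLegendre h) {S : Set (Euc n)}
    (hS : ConvexPM f h L S) {a x : Euc n} (ha : a ∈ S) (hx : x ∈ interior (edom h)) (hxS : x ∈ S) :
    |bregR f a x| ≤ L * bregR h a x := by
  have gh := (hh.hasGradientAt hx).hasFDerivAt
  have gf := (hf.hasGradientAt hh hx).hasFDerivAt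
  have g1 : HasGradientAt (fun x => L * re h x + re f x) (L • grad h x + grad f x) x := by
    rw [hasGradientAt_iff_hasFDerivAt, map_add, map_smul]
    exact (gh.const_mul L).add gf
  have g2 : HasGradientAt (fun x => L * re h x - re f x) (L • grad h x - grad f x) x := by
    rw [hasGradientAt_iff_hasFDerivAt, map_sub, map_smul]
    exact (gh.const_mul L).sub gf
  have h1 := hS.1.add_inner_gradient_le g1 hxS ha
  have h2 := hS.2.add_inner_gradient_le g2 hxS ha
  rw [inner_add_left, real_inner_smul_left] at h1
  rw [inner_sub_left, real_inner_smul_left] at h2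
  simp only [bregR]
  rw [abs_le]
  constructor <;> linarith

end IsRelSmooth

namespace BasicAssumption

variable {f h : Fin N → Euc n → EReal} {g : Euc n → EReal} {L γ : Fin N → ℝ}
  (hb : BasicAssumption f h g L γ)
include hb

omit hb in
theorem cast_pos_of_index (i : Fin N) : (0 : ℝ) < N := by
  have : 0 < N := i.pos
  exact_mod_cast this

theorem h_ne_bot (i : Fin N) (x : Euc n) : h i x ≠ ⊥ := (hb.legendre i).ne_bot x

theorem f_ne_bot (i : Fin N) (x : Euc n) : f i x ≠ ⊥ := (hb.relSmooth i).proper.1 x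

theorem g_ne_bot (x : Euc n) : g x ≠ ⊥ := hb.g_proper.1 x

theorem hhat_of_mem (i : Fin N) {x : Euc n} (hx : x ∈ edom (h i)) :
    hhat f h γ i x = ((1 / γ i * re (h i) x - 1 / N * re (f i) x : ℝ) : EReal) := by
  rw [hhat, if_neg (ne_of_lt hx), EReal.coe_sub, EReal.coe_mul, EReal.coe_mul,
    coe_re (hb.h_ne_bot i x) hx, coe_re (hb.f_ne_bot i x) ((hb.relSmooth i).dom_subset hx)]

omit hb in
theorem hhat_of_notMem (i : Fin N) {x : Euc n} (hx : x ∉ edom (h i)) : hhat f h γ i x = ⊤ := by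
  rw [hhat, if_pos (not_lt_top_iff.1 hx)]

theorem re_hhat (i : Fin N) {x : Euc n} (hx : x ∈ edom (h i)) :
    re (hhat f h γ i) x = 1 / γ i * re (h i) x - 1 / N * re (f i) x := by
  rw [re, hb.hhat_of_mem i hx, EReal.toReal_coe]

theorem edom_hhat (i : Fin N) : edom (hhat f h γ i) = edom (h i) := by
  ext x
  by_cases hx : x ∈ edom (h i)
  · refine ⟨fun _ => hx, fun _ => ?_⟩
    change hhat f h γ i x < ⊤
    rw [hb.hhat_of_mem i hx]
    exact EReal.coe_lt_top _
  · refine ⟨fun h1 => ?_, fun h1 => absurd h1 hx⟩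
    exact absurd (hhat_of_notMem i hx) (ne_of_lt h1)

theorem hasGradientAt_hhat (i : Fin N) {x : Euc n} (hx : x ∈ interior (edom (h i))) :
    HasGradientAt (re (hhat f h γ i))
      ((1 / γ i : ℝ) • grad (h i) x - ((1 : ℝ) / (N : ℝ)) • grad (f i) x) x := by
  have gh := ((hb.legendre i).hasGradientAt hx).hasFDerivAt
  have gf := ((hb.relSmooth i).hasGradientAt (hb.legendre i) hx).hasFDerivAt
  have g1 : HasGradientAt (fun x => 1 / γ i * re (h i) x - 1 / N * re (f i) x)
      ((1 / γ i : ℝ) • grad (h i) x - ((1 : ℝ) / (N : ℝ)) • grad (f i) x) x := by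
    rw [hasGradientAt_iff_hasFDerivAt, map_sub, map_smul, map_smul]
    exact (gh.const_mul _).sub (gf.const_mul _)
  refine g1.congr_of_eventuallyEq ?_
  filter_upwards [isOpen_interior.mem_nhds hx] with y hy
  exact hb.re_hhat i (interior_subset hy)

theorem grad_hhat (i : Fin N) {x : Euc n} (hx : x ∈ interior (edom (h i))) :
    grad (hhat f h γ i) x =
      (1 / γ i : ℝ) • grad (h i) x - ((1 : ℝ) / (N : ℝ)) • grad (f i) x :=
  (hb.hasGradientAt_hhat i hx).gradient

theorem bregR_hhat (i : Fin N) {a x : Euc n} (ha : a ∈ edom (h i))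
    (hx : x ∈ interior (edom (h i))) :
    bregR (hhat f h γ i) a x = 1 / γ i * bregR (h i) a x - 1 / N * bregR (f i) a x := by
  simp only [bregR, hb.re_hhat i ha, hb.re_hhat i (interior_subset hx), hb.grad_hhat i hx,
    inner_sub_left, real_inner_smul_left]
  ring

theorem bregR_hhat_le (i : Fin N) {S : Set (Euc n)} (hSh : S ⊆ edom (h i))
    (hS : ConvexPM (f i) (h i) (L i) S) {a x : Euc n} (ha : a ∈ S)
    (hx : x ∈ interior (edom (h i))) (hxS : x ∈ S) :
    bregR (hhat f h γ i) a x ≤ (1 / γ i + L i / N) * bregR (h i) a x := by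
  have h1 := abs_le.1 ((hb.relSmooth i).abs_bregR_le (hb.legendre i) hS ha hx hxS)
  have h2 := mul_le_mul_of_nonneg_left h1.1 (one_div_pos.2 (cast_pos_of_index i)).le
  rw [hb.bregR_hhat i (hSh ha) hx]
  calc _ ≤ 1 / γ i * bregR (h i) a x + 1 / N * (L i * bregR (h i) a x) := by linarith
    _ = _ := by ring

/-- The shifted kernel `ĥᵢ` is equivalent to `hᵢ`, with constants `1/γᵢ ∓ Lᵢ/N`. -/
theorem isEquivalentKernel (i : Fin N) :
    IsEquivalentKernel (h i) (hhat f h γ i) (1 / γ i - L i / N) (1 / γ i + L i / N) where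
  legendre := hb.legendre i
  pos := by
    have h1 := hb.γ_pos i
    have h2 := hb.γ_lt i
    have h3 := cast_pos_of_index i
    rw [sub_pos, div_lt_div_iff₀ h3 h1]
    linarith
  ne_bot x := by
    by_cases hx : x ∈ edom (h i)
    · rw [hb.hhat_of_mem i hx]; exact EReal.coe_ne_bot _
    · rw [hhat_of_notMem i hx]; exact top_ne_bot
  edom_eq := hb.edom_hhat i
  differentiableAt x hx := (hb.hasGradientAt_hhat i hx).differentiableAt
  lower a ha x hx := by
    have h1 := abs_le.1 ((hb.relSmooth i).abs_bregR_le (hb.legendre i) (hb.relSmooth i).convexPM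
      ha hx hx)
    have h2 := mul_le_mul_of_nonneg_left h1.2 (one_div_pos.2 (cast_pos_of_index i)).le
    rw [hb.bregR_hhat i (interior_subset ha) hx]
    calc _ = 1 / γ i * bregR (h i) a x - 1 / N * (L i * bregR (h i) a x) := by ring
      _ ≤ _ := by linarith
  upper a ha x hx := hb.bregR_hhat_le i interior_subset (hb.relSmooth i).convexPM ha hx hx
  radial a ha u hu y hy := by
    have hN := cast_pos_of_index i
    have hγ := hb.γ_pos i
    have hh := hb.legendre i
    have haf : a ∈ edom (f i) := (hb.relSmooth i).dom_subset ha
    rw [hb.re_hhat i ha] at hy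
    set δ := y - (1 / γ i * re (h i) a - 1 / N * re (f i) a) with hδ
    have hδ0 : 0 < δ := sub_pos.2 hy
    have e1 := (tendsto_add_smul_sub a u).eventually (eventually_lt_re (hb.relSmooth i).lsc
      (hb.f_ne_bot i) haf (show re (f i) a - N * (δ / 2) < re (f i) a by
        linarith [mul_pos hN (half_pos hδ0)]))
    have e2 := (hh.tendsto_radial ha (interior_subset hu)).eventually
      (gt_mem_nhds (show re (h i) a < re (h i) a + γ i * (δ / 2) by
        linarith [mul_pos hγ (half_pos hδ0)]))
    filter_upwards [e1, e2, Ioc_mem_nhdsGT (zero_lt_one' ℝ)] with t h1 h2 ht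
    have hm := interior_subset
      (add_smul_sub_mem_interior hh.convex_edom (subset_closure ha) hu ht)
    have h3 := h1 ((hb.relSmooth i).dom_subset hm)
    rw [hb.re_hhat i hm]
    have h4 := mul_lt_mul_of_pos_left h2 (one_div_pos.2 hγ)
    have h5 := mul_lt_mul_of_pos_left h3 (one_div_pos.2 hN)
    have h6 : 1 / γ i * (re (h i) a + γ i * (δ / 2)) = 1 / γ i * re (h i) a + δ / 2 := by
      field_simp
    have h7 : 1 / (N : ℝ) * (re (f i) a - N * (δ / 2)) = 1 / N * re (f i) a - δ / 2 := by
      field_simp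
    rw [h6] at h4
    rw [h7] at h5
    linarith

end BasicAssumption

/-! ### Finite sums of extended reals -/

theorem coe_sum_ereal {ι : Type*} (t : Finset ι) (a : ι → ℝ) :
    ((∑ i ∈ t, a i : ℝ) : EReal) = ∑ i ∈ t, (a i : EReal) := by
  classical
  induction t using Finset.induction_on with
  | empty => simp
  | insert i t hi ih => rw [Finset.sum_insert hi, Finset.sum_insert hi, EReal.coe_add, ih]

theorem sum_ereal_ne_bot {ι : Type*} (t : Finset ι) {a : ι → EReal} (ha : ∀ i, a i ≠ ⊥) :
    ∑ i ∈ t, a i ≠ ⊥ := by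
  classical
  induction t using Finset.induction_on with
  | empty => simp
  | insert i t hi ih =>
    rw [Finset.sum_insert hi]
    exact EReal.add_ne_bot_iff.2 ⟨ha i, ih⟩

theorem sum_ereal_eq_top {ι : Type*} {t : Finset ι} {a : ι → EReal} (ha : ∀ i, a i ≠ ⊥) {j : ι}
    (hj : j ∈ t) (haj : a j = ⊤) : ∑ i ∈ t, a i = ⊤ := by
  classical
  rw [← Finset.add_sum_erase t a hj, haj]
  exact EReal.top_add_of_ne_bot (sum_ereal_ne_bot _ ha)

theorem coe_pos_mul_ne_bot {c : ℝ} (hc : 0 < c) {x : EReal} (hx : x ≠ ⊥) : (c : EReal) * x ≠ ⊥ := by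
  induction x with
  | bot => exact absurd rfl hx
  | coe x => rw [← EReal.coe_mul]; exact EReal.coe_ne_bot _
  | top => rw [EReal.coe_mul_top_of_pos hc]; exact top_ne_bot

theorem _root_.LowerSemicontinuous.add_ereal {X : Type*} [TopologicalSpace X] {F G : X → EReal}
    (hF : LowerSemicontinuous F) (hG : LowerSemicontinuous G) (hF' : ∀ x, F x ≠ ⊥)
    (hG' : ∀ x, G x ≠ ⊥) : LowerSemicontinuous fun x => F x + G x :=
  hF.add' hG fun x => EReal.continuousAt_add (Or.inr (hG' x)) (Or.inl (hF' x))

theorem _root_.LowerSemicontinuous.sum_ereal {X ι : Type*} [TopologicalSpace X] (t : Finset ι)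
    {F : ι → X → EReal} (hF : ∀ i, LowerSemicontinuous (F i)) (hF' : ∀ i x, F i x ≠ ⊥) :
    LowerSemicontinuous fun x => ∑ i ∈ t, F i x := by
  classical
  induction t using Finset.induction_on with
  | empty => simpa using lowerSemicontinuous_const
  | insert i t hi ih =>
    simp only [Finset.sum_insert hi]
    exact (hF i).add_ereal ih (hF' i) fun x => sum_ereal_ne_bot t fun j => hF' j x

theorem _root_.LowerSemicontinuous.const_mul_ereal {X : Type*} [TopologicalSpace X] {F : X → EReal}
    (hF : LowerSemicontinuous F) {c : ℝ} (hc : 0 < c) :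
    LowerSemicontinuous fun x => (c : EReal) * F x := by
  have h1 : Continuous fun x : EReal => (c : EReal) * x :=
    continuous_iff_continuousAt.2 fun x => EReal.Tendsto.const_mul tendsto_id
      (Or.inl (EReal.coe_ne_bot c)) (Or.inl (EReal.coe_ne_top c))
  refine h1.comp_lowerSemicontinuous hF fun x y hxy => ?_
  exact mul_le_mul_of_nonneg_left hxy (by exact_mod_cast hc.le)

/-! ### The cost, the Lyapunov function and the envelope -/

theorem mem_interior_of_mem_Cset {h : Fin N → Euc n → EReal} {x : Euc n} (hx : x ∈ Cset h)
    (i : Fin N) : x ∈ interior (edom (h i)) :=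
  Set.mem_iInter.1 hx i

/-- Real value of the Lyapunov function, with the residuals written in primal form. -/
def lyapR (f h : Fin N → Euc n → EReal) (g : Euc n → EReal) (γ : Fin N → ℝ) (z : Euc n)
    (s : Fin N → Euc n) : ℝ :=
  re (cost f g) z + ∑ i, bregR (hhat f h γ i) z (primal f h γ s i)

namespace BasicAssumption

variable {f h : Fin N → Euc n → EReal} {g : Euc n → EReal} {L γ : Fin N → ℝ}
  (hb : BasicAssumption f h g L γ)
include hb

theorem cost_ne_bot [NeZero N] (x : Euc n) : cost f g x ≠ ⊥ :=
  EReal.add_ne_bot_iff.2 ⟨coe_pos_mul_ne_bot (one_div_pos.2 (Nat.cast_pos.2 (NeZero.pos N)))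
    (sum_ereal_ne_bot _ fun i => hb.f_ne_bot i x), hb.g_ne_bot x⟩

theorem lowerSemicontinuous_cost [NeZero N] : LowerSemicontinuous (cost f g) := by
  have hN : (0 : ℝ) < 1 / N := one_div_pos.2 (Nat.cast_pos.2 (NeZero.pos N))
  refine ((LowerSemicontinuous.sum_ereal Finset.univ (fun i => (hb.relSmooth i).lsc)
    hb.f_ne_bot).const_mul_ereal hN).add_ereal hb.g_lsc (fun x => ?_) hb.g_ne_bot
  exact coe_pos_mul_ne_bot hN (sum_ereal_ne_bot _ fun i => hb.f_ne_bot i x)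

theorem cost_eq_coe {x : Euc n} (hx : ∀ i, x ∈ edom (h i)) (hg : x ∈ edom g) :
    cost f g x = ((1 / N * ∑ i, re (f i) x + re g x : ℝ) : EReal) := by
  rw [cost, EReal.coe_add, EReal.coe_mul, coe_sum_ereal, coe_re (hb.g_ne_bot x) hg]
  simp only [coe_re (hb.f_ne_bot _ x) ((hb.relSmooth _).dom_subset (hx _))]

theorem re_cost {x : Euc n} (hx : ∀ i, x ∈ edom (h i)) (hg : x ∈ edom g) :
    re (cost f g) x = 1 / N * ∑ i, re (f i) x + re g x := by
  rw [re, hb.cost_eq_coe hx hg, EReal.toReal_coe]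

theorem edom_cost_subset [NeZero N] : edom (cost f g) ⊆ edom g := by
  intro x hx
  by_contra hcon
  have h1 : g x = ⊤ := not_lt_top_iff.1 hcon
  refine (show cost f g x < ⊤ from hx).ne ?_
  rw [cost, h1]
  exact EReal.add_top_of_ne_bot (coe_pos_mul_ne_bot
    (one_div_pos.2 (Nat.cast_pos.2 (NeZero.pos N))) (sum_ereal_ne_bot _ fun i => hb.f_ne_bot i x))

theorem mem_edom_cost {x : Euc n} (hx : ∀ i, x ∈ edom (h i)) (hg : x ∈ edom g) :
    x ∈ edom (cost f g) := by
  change cost f g x < ⊤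
  rw [hb.cost_eq_coe hx hg]
  exact EReal.coe_lt_top _

theorem primal_mem (s : Fin N → Euc n) (i : Fin N) :
    primal f h γ s i ∈ interior (edom (h i)) :=
  (hb.isEquivalentKernel i).grad_conjugate_mem (s i)

theorem grad_primal (s : Fin N → Euc n) (i : Fin N) :
    grad (hhat f h γ i) (primal f h γ s i) = s i :=
  (hb.isEquivalentKernel i).grad_grad_conjugate (s i)

theorem objective_eq_coe {w : Euc n} (s : Euc n) (hw : ∀ i, w ∈ edom (h i)) (hg : w ∈ edom g) :
    g w + ∑ i, ((1 / γ i : ℝ) : EReal) * h i w - ((inner ℝ s w : ℝ) : EReal) =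
      ((re g w + ∑ i, 1 / γ i * re (h i) w - inner ℝ s w : ℝ) : EReal) := by
  rw [EReal.coe_sub, EReal.coe_add, coe_sum_ereal, coe_re (hb.g_ne_bot w) hg]
  simp only [EReal.coe_mul, coe_re (hb.h_ne_bot _ w) (hw _)]

theorem mem_edom_g_of_mem_Tmap {s ζ : Euc n} (hζ : ζ ∈ Tmap h g γ s) : ζ ∈ edom g := by
  have h1 : ∀ i, ((1 / γ i : ℝ) : EReal) * h i ζ ≠ ⊥ := fun i =>
    coe_pos_mul_ne_bot (one_div_pos.2 (hb.γ_pos i)) (hb.h_ne_bot i ζ)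
  have h2 := hζ.2.1
  by_contra hcon
  have h3 : g ζ = ⊤ := not_lt_top_iff.1 hcon
  refine ne_of_lt h2 ?_
  simp only [h3]
  rw [EReal.top_add_of_ne_bot (sum_ereal_ne_bot _ h1), EReal.top_sub_coe]

/-- The cost plus the Bregman distances to the primal table is, up to a constant depending on the
table only, the objective defining `T`. -/
theorem cost_add_bregR {w : Euc n} (s : Fin N → Euc n) (hw : ∀ i, w ∈ edom (h i))
    (hg : w ∈ edom g) :
    re (cost f g) w + ∑ i, bregR (hhat f h γ i) w (primal f h γ s i) =
      (re g w + ∑ i, 1 / γ i * re (h i) w - inner ℝ (∑ i, s i) w) +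
      ∑ i, (inner ℝ (s i) (primal f h γ s i) - re (hhat f h γ i) (primal f h γ s i)) := by
  rw [hb.re_cost hw hg, Finset.mul_sum, sum_inner]
  have : ∀ i, bregR (hhat f h γ i) w (primal f h γ s i) =
      1 / γ i * re (h i) w - 1 / N * re (f i) w - inner ℝ (s i) w +
      (inner ℝ (s i) (primal f h γ s i) - re (hhat f h γ i) (primal f h γ s i)) := by
    intro i
    rw [bregR, hb.grad_primal, hb.re_hhat i (hw i), inner_sub_right]
    ring
  simp only [this, Finset.sum_add_distrib, Finset.sum_sub_distrib]
  ring

/-- A point of `T(∑ᵢ sᵢ)` minimizes the cost plus the Bregman distances to the primal table. -/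
theorem lyapR_le_of_mem_Tmap {s : Fin N → Euc n} {ζ : Euc n} (hζ : ζ ∈ Tmap h g γ (∑ i, s i))
    {w : Euc n} (hw : ∀ i, w ∈ edom (h i)) (hg : w ∈ edom g) :
    lyapR f h g γ ζ s ≤
      re (cost f g) w + ∑ i, bregR (hhat f h γ i) w (primal f h γ s i) := by
  have hζC := hb.range_T _ hζ
  have hζd : ∀ i, ζ ∈ edom (h i) := fun i => interior_subset (mem_interior_of_mem_Cset hζC i)
  have h1 := hζ.2.2 w (Set.mem_univ w)
  simp only at h1
  rw [hb.objective_eq_coe _ hζd (hb.mem_edom_g_of_mem_Tmap hζ), hb.objective_eq_coe _ hw hg,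
    EReal.coe_le_coe_iff] at h1
  rw [lyapR, hb.cost_add_bregR s hw hg, hb.cost_add_bregR s hζd (hb.mem_edom_g_of_mem_Tmap hζ)]
  linarith

theorem bresidual_eq_coe (s : Fin N → Euc n) {z : Euc n} (hz : z ∈ Cset h) (i : Fin N) :
    bresidual f h γ z s i = ((bregR (hhat f h γ i) z (primal f h γ s i) : ℝ) : EReal) :=
  (hb.isEquivalentKernel i).bregman_conjugate (s i) (mem_interior_of_mem_Cset hz i)

theorem lyapunov_eq_coe (s : Fin N → Euc n) {z : Euc n} (hz : z ∈ Cset h) (hg : z ∈ edom g) :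
    lyapunov f h g γ z s = ((lyapR f h g γ z s : ℝ) : EReal) := by
  have hzd : ∀ i, z ∈ edom (h i) := fun i => interior_subset (mem_interior_of_mem_Cset hz i)
  rw [lyapunov, lyapR, EReal.coe_add, coe_sum_ereal, hb.cost_eq_coe hzd hg, hb.re_cost hzd hg]
  simp only [hb.bresidual_eq_coe s hz]

theorem bregman_hhat_primal (s : Fin N → Euc n) {w : Euc n} {i : Fin N} (hw : w ∈ edom (h i)) :
    bregman (hhat f h γ i) w (primal f h γ s i) =
      ((bregR (hhat f h γ i) w (primal f h γ s i) : ℝ) : EReal) := by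
  have hF := hb.isEquivalentKernel i
  refine bregman_eq_coe (hF.ne_bot w) (hF.edom_eq.symm ▸ hw) ?_
  rw [hF.edom_eq]
  exact hb.primal_mem s i

theorem bregman_hhat_primal_eq_top (s : Fin N → Euc n) {w : Euc n} {i : Fin N}
    (hw : w ∉ edom (h i)) : bregman (hhat f h γ i) w (primal f h γ s i) = ⊤ := by
  have hF := hb.isEquivalentKernel i
  rw [bregman, if_pos (by rw [hF.edom_eq]; exact hb.primal_mem s i), hhat_of_notMem i hw,
    EReal.top_sub_coe, EReal.top_sub_coe]

theorem bregman_hhat_primal_ne_bot (s : Fin N → Euc n) (w : Euc n) (i : Fin N) :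
    bregman (hhat f h γ i) w (primal f h γ s i) ≠ ⊥ := by
  by_cases hw : w ∈ edom (h i)
  · rw [hb.bregman_hhat_primal s hw]; exact EReal.coe_ne_bot _
  · rw [hb.bregman_hhat_primal_eq_top s hw]; exact top_ne_bot

omit hb in
theorem liftedCost_const [NeZero N] (w : Euc n) : liftedCost f g (fun _ => w) = cost f g w := by
  have h1 : (((1 : ℝ) / (N : ℝ) : ℝ) : EReal) * ∑ _i : Fin N, g w = g w := by
    rw [Finset.sum_const, Finset.card_univ, Fintype.card_fin, EReal.nsmul_eq_mul, ← mul_assoc]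
    have : (((1 : ℝ) / (N : ℝ) : ℝ) : EReal) * ((N : ℕ) : EReal) = 1 := by
      rw [← EReal.coe_natCast, ← EReal.coe_mul, one_div,
        inv_mul_cancel₀ (Nat.cast_ne_zero.2 (NeZero.ne N)), EReal.coe_one]
    rw [this, one_mul]
  simp only [liftedCost, h1, implies_true, if_true, add_zero, cost]

/-- The Bregman-Moreau envelope at the primal table is attained at a point of `T`, hence equals the
Lyapunov function. -/
theorem envelope_eq [NeZero N] {s : Fin N → Euc n} {ζ : Euc n}
    (hζ : ζ ∈ Tmap h g γ (∑ i, s i)) :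
    envelope f h g γ (primal f h γ s) = ((lyapR f h g γ ζ s : ℝ) : EReal) := by
  have hN : (0 : ℝ) < 1 / N := one_div_pos.2 (Nat.cast_pos.2 (NeZero.pos N))
  have hζC := hb.range_T _ hζ
  have hζd : ∀ i, ζ ∈ edom (h i) := fun i => interior_subset (mem_interior_of_mem_Cset hζC i)
  have hζg := hb.mem_edom_g_of_mem_Tmap hζ
  refine le_antisymm ?_ (le_iInf fun w => ?_)
  · refine (iInf_le _ (fun _ => ζ)).trans_eq ?_
    rw [liftedCost_const, lyapR, EReal.coe_add, coe_sum_ereal, hb.cost_eq_coe hζd hζg,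
      hb.re_cost hζd hζg]
    simp only [hb.bregman_hhat_primal s (hζd _)]
  · have hbot : ∑ i, bregman (hhat f h γ i) (w i) (primal f h γ s i) ≠ ⊥ :=
      sum_ereal_ne_bot _ fun i => hb.bregman_hhat_primal_ne_bot s (w i) i
    by_cases hcons : ∀ i j, w i = w j
    · obtain ⟨w₀, rfl⟩ : ∃ w₀, w = fun _ => w₀ := ⟨w 0, funext fun i => hcons i 0⟩
      rw [liftedCost_const]
      by_cases hw : ∀ i, w₀ ∈ edom (h i)
      · by_cases hg : w₀ ∈ edom g
        · simp only [hb.bregman_hhat_primal s (hw _)]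
          rw [hb.cost_eq_coe hw hg, ← hb.re_cost hw hg, ← coe_sum_ereal, ← EReal.coe_add,
            EReal.coe_le_coe_iff]
          exact hb.lyapR_le_of_mem_Tmap hζ hw hg
        · have : cost f g w₀ = ⊤ := by
            by_contra hne
            exact hg (hb.edom_cost_subset (lt_top_iff_ne_top.2 hne))
          rw [this, EReal.top_add_of_ne_bot hbot]
          exact le_top
      · push Not at hw
        obtain ⟨j, hj⟩ := hw
        rw [sum_ereal_eq_top (fun i => hb.bregman_hhat_primal_ne_bot s w₀ i) (Finset.mem_univ j)
          (hb.bregman_hhat_primal_eq_top s hj), EReal.add_top_of_ne_bot (hb.cost_ne_bot w₀)]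
        exact le_top
    · rw [liftedCost, if_neg hcons, EReal.add_top_of_ne_bot, EReal.top_add_of_ne_bot hbot]
      · exact le_top
      · exact EReal.add_ne_bot_iff.2
          ⟨coe_pos_mul_ne_bot hN (sum_ereal_ne_bot _ fun i => hb.f_ne_bot i _),
            coe_pos_mul_ne_bot hN (sum_ereal_ne_bot _ fun i => hb.g_ne_bot _)⟩

end BasicAssumption

/-! ### Sure properties of a run -/

theorem _root_.LowerSemicontinuous.le_of_tendsto {X ι : Type*} [TopologicalSpace X] {F : X → EReal}
    (hF : LowerSemicontinuous F) {l : Filter ι} [l.NeBot] {u : ι → X} {a : X} {y : EReal}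
    (hu : Tendsto u l (𝓝 a)) (hy : Tendsto (fun k => F (u k)) l (𝓝 y)) : F a ≤ y := by
  by_contra hcon
  push Not at hcon
  obtain ⟨b, hyb, hba⟩ := exists_between hcon
  exact absurd hyb (not_lt_of_ge (ge_of_tendsto hy ((hu.eventually (hF a b hba)).mono
    fun _ hk => hk.le)))

theorem exists_subseq_of_mem_limitSet {u : ℕ → Euc n} {a : Euc n} (ha : a ∈ limitSet u) :
    ∃ ψ : ℕ → ℕ, StrictMono ψ ∧ Tendsto (u ∘ ψ) atTop (𝓝 a) :=
  MapClusterPt.tendsto_subseq ha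

theorem interior_edom_eq_univ_of_Cset_eq_univ {h : Fin N → Euc n → EReal} (hC : Cset h = Set.univ)
    (i : Fin N) : interior (edom (h i)) = Set.univ :=
  Set.eq_univ_of_forall fun _ => mem_interior_of_mem_Cset (hC ▸ Set.mem_univ _) i

/-- If the residuals vanish, the cost and the Lyapunov function have the same limit. -/
theorem tendsto_re_cost_of_tendsto_lyapR {f h : Fin N → Euc n → EReal} {g : Euc n → EReal}
    {γ : Fin N → ℝ} {z : ℕ → Euc n} {s : ℕ → Fin N → Euc n} {ℓ : ℝ}
    (hℓ : Tendsto (fun k => lyapR f h g γ (z k) (s k)) atTop (𝓝 ℓ))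
    (hres : ∀ i, Tendsto (fun k => bregR (hhat f h γ i) (z k) (primal f h γ (s k) i)) atTop (𝓝 0)) :
    Tendsto (fun k => re (cost f g) (z k)) atTop (𝓝 ℓ) := by
  have h1 := hℓ.sub (tendsto_finsetSum Finset.univ fun i _ => hres i)
  simpa [lyapR] using h1

namespace BasicAssumption

variable {f h : Fin N → Euc n → EReal} {g : Euc n → EReal} {L γ : Fin N → ℝ}
  (hb : BasicAssumption f h g L γ)
include hb

theorem bregR_hhat_nonneg (s : Fin N → Euc n) {w : Euc n} {i : Fin N} (hw : w ∈ edom (h i)) :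
    0 ≤ bregR (hhat f h γ i) w (primal f h γ s i) :=
  (hb.isEquivalentKernel i).bregR_nonneg hw (hb.primal_mem s i)

theorem mem_edom_of_mem_Tmap {s z : Euc n} (hz : z ∈ Tmap h g γ s) (i : Fin N) : z ∈ edom (h i) :=
  interior_subset (mem_interior_of_mem_Cset (hb.range_T _ hz) i)

theorem mem_edom_cost_of_mem_Tmap {s z : Euc n} (hz : z ∈ Tmap h g γ s) : z ∈ edom (cost f g) :=
  hb.mem_edom_cost (hb.mem_edom_of_mem_Tmap hz) (hb.mem_edom_g_of_mem_Tmap hz)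

theorem re_cost_le_lyapR {s : Fin N → Euc n} {z : Euc n} (hz : ∀ i, z ∈ edom (h i)) :
    re (cost f g) z ≤ lyapR f h g γ z s := by
  have := Finset.sum_nonneg fun i (_ : i ∈ Finset.univ) => hb.bregR_hhat_nonneg s (hz i)
  rw [lyapR]
  linarith

/-- First-order optimality of a point of `T` for a convex cost. -/
theorem re_cost_sub_le_of_isConvexFun [NeZero N] (hconv : IsConvexFun (cost f g))
    {s : Fin N → Euc n} {ζ : Euc n} (hζ : ζ ∈ Tmap h g γ (∑ i, s i)) {w : Euc n}
    (hw : ∀ i, w ∈ edom (h i)) (hwc : w ∈ edom (cost f g)) :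
    re (cost f g) ζ - re (cost f g) w ≤
      ∑ i, inner ℝ (grad (hhat f h γ i) ζ - s i) (w - ζ) := by
  have hζd := hb.mem_edom_of_mem_Tmap hζ
  have hζi := fun i => mem_interior_of_mem_Cset (hb.range_T _ hζ) i
  have hslope : Tendsto (fun t : ℝ => ∑ i, ((re (hhat f h γ i) (ζ + t • (w - ζ))
      - re (hhat f h γ i) ζ) / t - inner ℝ (s i) (w - ζ))) (𝓝[>] 0)
      (𝓝 (∑ i, (inner ℝ (grad (hhat f h γ i) ζ) (w - ζ) - inner ℝ (s i) (w - ζ)))) :=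
    tendsto_finsetSum _ fun i _ =>
      (((hb.isEquivalentKernel i).hasGradientAt (hζi i)).tendsto_slope_right _).sub_const _
  simp only [inner_sub_left]
  refine ge_of_tendsto hslope ?_
  filter_upwards [Ioc_mem_nhdsGT (zero_lt_one' ℝ)] with t ht
  set wt := ζ + t • (w - ζ) with hwt
  have hcomb : (1 - t) • ζ + t • w = wt := by rw [hwt]; module
  have hwtd : ∀ i, wt ∈ edom (h i) := fun i => by
    rw [← hcomb]
    exact (hb.legendre i).convex_edom (hζd i) (hw i) (sub_nonneg.2 ht.2) ht.1.le
      (sub_add_cancel 1 t)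
  have hζc := hb.mem_edom_cost_of_mem_Tmap hζ
  have hwtc : wt ∈ edom (cost f g) := by
    rw [← hcomb]
    exact hconv.1 hζc hwc (sub_nonneg.2 ht.2) ht.1.le (sub_add_cancel 1 t)
  have h1 := hconv.2 hζc hwc (sub_nonneg.2 ht.2) ht.1.le (sub_add_cancel 1 t)
  rw [hcomb] at h1
  simp only [smul_eq_mul] at h1
  have h2 := hb.lyapR_le_of_mem_Tmap hζ hwtd (hb.edom_cost_subset hwtc)
  rw [lyapR] at h2
  have h3 : ∑ i, bregR (hhat f h γ i) wt (primal f h γ s i) -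
      ∑ i, bregR (hhat f h γ i) ζ (primal f h γ s i) =
      t * ∑ i, ((re (hhat f h γ i) wt - re (hhat f h γ i) ζ) / t - inner ℝ (s i) (w - ζ)) := by
    rw [← Finset.sum_sub_distrib, Finset.mul_sum]
    refine Finset.sum_congr rfl fun i _ => ?_
    have : inner ℝ (s i) (wt - primal f h γ s i) =
        inner ℝ (s i) (ζ - primal f h γ s i) + t * inner ℝ (s i) (w - ζ) := by
      rw [← inner_smul_right, ← inner_add_right, hwt]
      congr 1
      abel
    rw [bregR, bregR, hb.grad_primal, this, mul_sub, mul_div_cancel₀ _ ht.1.ne']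
    ring
  have h4 : t * (re (cost f g) ζ - re (cost f g) w) ≤
      t * ∑ i, ((re (hhat f h γ i) wt - re (hhat f h γ i) ζ) / t - inner ℝ (s i) (w - ζ)) := by
    rw [← h3]
    linarith
  exact le_of_mul_le_mul_left h4 ht.1

/-- For a convex cost, moving the whole table to `ζ` decreases the sum of the Bregman distances from
a point `w` by at least the excess of the Lyapunov function over the cost at `w`. -/
theorem sum_bregVal_le_of_isConvexFun [NeZero N] (hconv : IsConvexFun (cost f g))
    {s : Fin N → Euc n} {ζ : Euc n} (hζ : ζ ∈ Tmap h g γ (∑ i, s i)) {w : Euc n}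
    (hw : ∀ i, w ∈ edom (h i)) (hwc : w ∈ edom (cost f g)) (e : Fin N → ℝ) :
    ∑ i, bregVal (hhat f h γ i) (e i) w ζ ≤
      ∑ i, bregVal (hhat f h γ i) (e i) w (primal f h γ s i)
        - (lyapR f h g γ ζ s - re (cost f g) w) := by
  have h1 := hb.re_cost_sub_le_of_isConvexFun hconv hζ hw hwc
  have h2 : ∀ i, bregVal (hhat f h γ i) (e i) w (primal f h γ s i) =
      bregVal (hhat f h γ i) (e i) w ζ + bregR (hhat f h γ i) ζ (primal f h γ s i) +
        inner ℝ (grad (hhat f h γ i) ζ - s i) (w - ζ) := fun i => by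
    have := bregVal_three_point (hhat f h γ i) (e i) w ζ (primal f h γ s i)
    rwa [hb.grad_primal] at this
  simp only [h2, Finset.sum_add_distrib, lyapR]
  linarith

end BasicAssumption

namespace IsRun

variable {f h : Fin N → Euc n → EReal} {g : Euc n → EReal} {L γ : Fin N → ℝ}
  {xinit : Euc n} {z : ℕ → Euc n} {s : ℕ → Fin N → Euc n} {st : ℕ → Euc n}
  {I : ℕ → Finset (Fin N)} (hr : IsRun f h g γ xinit z s st I)
include hr

theorem st_eq_sum (k : ℕ) : st k = ∑ i, s k i := by
  induction k with
  | zero => exact hr.st_zero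
  | succ k ih =>
    rw [hr.st_succ, ih]
    have : ∑ i ∈ I (k + 1), (s (k + 1) i - s k i) = ∑ i, (s (k + 1) i - s k i) :=
      Finset.sum_subset (Finset.subset_univ _) fun i _ hi => by
        rw [hr.s_succ_notMem k i hi, sub_self]
    rw [this, Finset.sum_sub_distrib, add_sub_cancel]

theorem z_mem_Tmap (k : ℕ) : z k ∈ Tmap h g γ (∑ i, s k i) :=
  hr.st_eq_sum k ▸ hr.z_mem k

variable (hb : BasicAssumption f h g L γ)
include hb

theorem z_mem_Cset (k : ℕ) : z k ∈ Cset h := hb.range_T _ (hr.z_mem k)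

theorem z_mem_interior (k : ℕ) (i : Fin N) : z k ∈ interior (edom (h i)) :=
  mem_interior_of_mem_Cset (hr.z_mem_Cset hb k) i

theorem z_mem_edom (k : ℕ) (i : Fin N) : z k ∈ edom (h i) :=
  interior_subset (hr.z_mem_interior hb k i)

theorem z_mem_edom_g (k : ℕ) : z k ∈ edom g := hb.mem_edom_g_of_mem_Tmap (hr.z_mem k)

theorem z_mem_edom_cost (k : ℕ) : z k ∈ edom (cost f g) :=
  hb.mem_edom_cost_of_mem_Tmap (hr.z_mem k)

theorem coe_re_cost [NeZero N] (k : ℕ) :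
    ((re (cost f g) (z k) : ℝ) : EReal) = cost f g (z k) :=
  coe_re (hb.cost_ne_bot _) (hr.z_mem_edom_cost hb k)

theorem s_succ_eq_grad {k : ℕ} {i : Fin N} (hi : i ∈ I (k + 1)) :
    s (k + 1) i = grad (hhat f h γ i) (z k) := by
  rw [hr.s_succ_mem k i hi, hb.grad_hhat i (hr.z_mem_interior hb k i)]

theorem primal_succ_of_mem {k : ℕ} {i : Fin N} (hi : i ∈ I (k + 1)) :
    primal f h γ (s (k + 1)) i = z k := by
  rw [primal, hr.s_succ_eq_grad hb hi,
    (hb.isEquivalentKernel i).grad_conjugate_grad (hr.z_mem_interior hb k i)]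

omit hb in
theorem primal_succ_of_notMem {k : ℕ} {i : Fin N} (hi : i ∉ I (k + 1)) :
    primal f h γ (s (k + 1)) i = primal f h γ (s k) i := by
  rw [primal, hr.s_succ_notMem k i hi, primal]

theorem primal_zero (hx : xinit ∈ Cset h) (i : Fin N) : primal f h γ (s 0) i = xinit := by
  have hxi := mem_interior_of_mem_Cset hx i
  rw [primal, hr.s_zero, ← hb.grad_hhat i hxi,
    (hb.isEquivalentKernel i).grad_conjugate_grad hxi]

theorem lyapunov_eq (k : ℕ) :
    lyapunov f h g γ (z k) (s k) = ((lyapR f h g γ (z k) (s k) : ℝ) : EReal) :=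
  hb.lyapunov_eq_coe _ (hr.z_mem_Cset hb k) (hr.z_mem_edom_g hb k)

theorem envelope_eq [NeZero N] (k : ℕ) :
    envelope f h g γ (primal f h γ (s k)) = ((lyapR f h g γ (z k) (s k) : ℝ) : EReal) :=
  hb.envelope_eq (hr.z_mem_Tmap k)

theorem residual_nonneg (k : ℕ) (i : Fin N) :
    0 ≤ bregR (hhat f h γ i) (z k) (primal f h γ (s k) i) :=
  hb.bregR_hhat_nonneg (s k) (hr.z_mem_edom hb k i)

/-- Sure descent: the updated entries of the table lose their residual. -/
theorem lyapR_succ_le (k : ℕ) :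
    lyapR f h g γ (z (k + 1)) (s (k + 1)) ≤ lyapR f h g γ (z k) (s k) -
      ∑ i ∈ I (k + 1), bregR (hhat f h γ i) (z k) (primal f h γ (s k) i) := by
  classical
  refine (hb.lyapR_le_of_mem_Tmap (hr.z_mem_Tmap (k + 1)) (hr.z_mem_edom hb k)
    (hr.z_mem_edom_g hb k)).trans_eq ?_
  have h1 : ∀ i, bregR (hhat f h γ i) (z k) (primal f h γ (s (k + 1)) i) =
      bregR (hhat f h γ i) (z k) (primal f h γ (s k) i) -
        if i ∈ I (k + 1) then bregR (hhat f h γ i) (z k) (primal f h γ (s k) i) else 0 := by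
    intro i
    by_cases hi : i ∈ I (k + 1)
    · rw [hr.primal_succ_of_mem hb hi, if_pos hi, bregR_self, sub_self]
    · rw [hr.primal_succ_of_notMem hi, if_neg hi, sub_zero]
  simp only [h1, Finset.sum_sub_distrib, Finset.sum_ite_mem, Finset.univ_inter, lyapR]
  ring

theorem lyapR_antitone : Antitone fun k => lyapR f h g γ (z k) (s k) := by
  refine antitone_nat_of_succ_le fun k => (hr.lyapR_succ_le hb k).trans ?_
  have := Finset.sum_nonneg fun i (_ : i ∈ I (k + 1)) => hr.residual_nonneg hb k i
  linarith

theorem lyapR_zero_le (hx : xinit ∈ Cset h) (hg : xinit ∈ edom g) :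
    lyapR f h g γ (z 0) (s 0) ≤ re (cost f g) xinit := by
  have h1 := hb.lyapR_le_of_mem_Tmap (hr.z_mem_Tmap 0)
    (fun i => interior_subset (mem_interior_of_mem_Cset hx i)) hg
  simpa [hr.primal_zero hb hx] using h1

theorem re_cost_le_lyapR (k : ℕ) : re (cost f g) (z k) ≤ lyapR f h g γ (z k) (s k) :=
  hb.re_cost_le_lyapR (hr.z_mem_edom hb k)

theorem residual_le (k : ℕ) (i : Fin N) :
    bregR (hhat f h γ i) (z k) (primal f h γ (s k) i) ≤
      lyapR f h g γ (z k) (s k) - re (cost f g) (z k) := by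
  have := Finset.single_le_sum (fun j _ => hr.residual_nonneg hb k j) (Finset.mem_univ i)
  rw [lyapR]
  linarith

theorem le_re_cost [NeZero N] {xs : Euc n} (hxs : xs ∈ argminOn (cost f g) (closure (Cset h)))
    (k : ℕ) : re (cost f g) xs ≤ re (cost f g) (z k) := by
  have h1 := hxs.2.2 (z k) (subset_closure (hr.z_mem_Cset hb k))
  rw [← hr.coe_re_cost hb k, ← coe_re (hb.cost_ne_bot xs) hxs.2.1] at h1
  exact_mod_cast h1

theorem le_lyapR [NeZero N] {xs : Euc n} (hxs : xs ∈ argminOn (cost f g) (closure (Cset h)))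
    (k : ℕ) : re (cost f g) xs ≤ lyapR f h g γ (z k) (s k) :=
  (hr.le_re_cost hb hxs k).trans (hr.re_cost_le_lyapR hb k)

theorem exists_tendsto_lyapR [NeZero N] :
    Tendsto (fun k => lyapR f h g γ (z k) (s k)) atTop (𝓝 (⨅ k, lyapR f h g γ (z k) (s k))) := by
  obtain ⟨xs, hxs⟩ := hb.exists_sol
  refine tendsto_atTop_ciInf (hr.lyapR_antitone hb) ⟨re (cost f g) xs, ?_⟩
  rintro _ ⟨k, rfl⟩
  exact hr.le_lyapR hb hxs k

/-- Along a subsequence on which `z` converges, the entries of the primal table have the same limit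
if the residuals vanish. -/
theorem tendsto_primal_subseq (hK : KernelAssumption h)
    (hres : ∀ i, Tendsto (fun k => bregR (hhat f h γ i) (z k) (primal f h γ (s k) i)) atTop (𝓝 0))
    {ψ : ℕ → ℕ} (hψ : StrictMono ψ) {a : Euc n} (ha : Tendsto (z ∘ ψ) atTop (𝓝 a)) (i : Fin N) :
    Tendsto (fun k => primal f h γ (s (ψ k)) i) atTop (𝓝 a) := by
  have hF := hb.isEquivalentKernel i
  refine (hb.legendre i).tendsto_of_bregR_tendsto_zero_left
    (hK.isBregmanConsistent (hb.legendre i)) (fun k => hr.z_mem_interior hb (ψ k) i)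
    (fun k => hb.primal_mem _ i) ha ?_
  have h1 : Tendsto (fun k => (1 / γ i - L i / N)⁻¹ *
      bregR (hhat f h γ i) (z (ψ k)) (primal f h γ (s (ψ k)) i)) atTop (𝓝 0) := by
    simpa using ((hres i).comp hψ.tendsto_atTop).const_mul (1 / γ i - L i / N)⁻¹
  refine squeeze_zero (fun k => (hb.legendre i).bregR_nonneg (hr.z_mem_edom hb _ i)
    (hb.primal_mem _ i)) (fun k => ?_) h1
  rw [le_inv_mul_iff₀ hF.pos]
  exact hF.mul_bregR_le (hr.z_mem_edom hb _ i) (hb.primal_mem _ i)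

/-- Limit points of `z` belong to the domains of the kernels, and the kernel Bregman distances of
the primal table from them vanish along the subsequence. -/
theorem tendsto_bregR_subseq (hK : KernelAssumption h)
    (hres : ∀ i, Tendsto (fun k => bregR (hhat f h γ i) (z k) (primal f h γ (s k) i)) atTop (𝓝 0))
    {ψ : ℕ → ℕ} (hψ : StrictMono ψ) {a : Euc n} (ha : Tendsto (z ∘ ψ) atTop (𝓝 a)) (i : Fin N) :
    a ∈ edom (h i) ∧
      Tendsto (fun k => bregR (h i) a (primal f h γ (s (ψ k)) i)) atTop (𝓝 0) := by
  have had : a ∈ edom (h i) := (hK i).1.mem_of_tendsto ha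
    (Eventually.of_forall fun k => hr.z_mem_edom hb (ψ k) i)
  exact ⟨had, (hK.isBregmanConsistent (hb.legendre i)).tendsto _ a (fun k => hb.primal_mem _ i) had
    (hr.tendsto_primal_subseq hb hK hres hψ ha i)⟩

/-- The cost takes the limit value of the Lyapunov function at every limit point of `z`. -/
theorem cost_eq_of_mem_limitSet [NeZero N] (hK : KernelAssumption h)
    (hPM : ∀ i, ConvexPM (f i) (h i) (L i) (edom (h i))) {ℓ : ℝ}
    (hℓ : Tendsto (fun k => lyapR f h g γ (z k) (s k)) atTop (𝓝 ℓ))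
    (hres : ∀ i, Tendsto (fun k => bregR (hhat f h γ i) (z k) (primal f h γ (s k) i)) atTop (𝓝 0))
    {a : Euc n} (ha : a ∈ limitSet z) : cost f g a = (ℓ : EReal) := by
  obtain ⟨ψ, hψ, hza⟩ := exists_subseq_of_mem_limitSet ha
  have h1 := fun i => hr.tendsto_bregR_subseq hb hK hres hψ hza i
  have hle : cost f g a ≤ (ℓ : EReal) := by
    refine hb.lowerSemicontinuous_cost.le_of_tendsto hza ?_
    simp only [Function.comp_apply, ← hr.coe_re_cost hb]
    exact EReal.tendsto_coe.2 ((tendsto_re_cost_of_tendsto_lyapR hℓ hres).comp hψ.tendsto_atTop)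
  have hac : a ∈ edom (cost f g) := hle.trans_lt (EReal.coe_lt_top ℓ)
  refine le_antisymm hle ?_
  rw [← coe_re (hb.cost_ne_bot a) hac, EReal.coe_le_coe_iff]
  have h2 : Tendsto (fun k => re (cost f g) a + ∑ i, (1 / γ i + L i / N) *
      bregR (h i) a (primal f h γ (s (ψ k)) i)) atTop (𝓝 (re (cost f g) a)) := by
    simpa using (tendsto_finsetSum Finset.univ fun i _ =>
      ((h1 i).2.const_mul (1 / γ i + L i / N))).const_add (re (cost f g) a)
  refine le_of_tendsto_of_tendsto' (hℓ.comp hψ.tendsto_atTop) h2 fun k => ?_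
  refine (hb.lyapR_le_of_mem_Tmap (hr.z_mem_Tmap (ψ k)) (fun i => (h1 i).1)
    (hb.edom_cost_subset hac)).trans ?_
  gcongr with i
  exact hb.bregR_hhat_le i subset_rfl (hPM i) (h1 i).1 (hb.primal_mem _ i)
    (interior_subset (hb.primal_mem _ i))

/-- When the kernels are finite everywhere, limit points of `z` are stationary: in the limit, the
cost is minorized by its value at `a` minus a combination of Bregman distances of the kernels to
`a`, which is `o(‖w - a‖)`. -/
theorem isRegSubgradient_of_mem_limitSet [NeZero N] (hC : Cset h = Set.univ) {ℓ : ℝ}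
    (hℓ : Tendsto (fun k => lyapR f h g γ (z k) (s k)) atTop (𝓝 ℓ))
    (hres : ∀ i, Tendsto (fun k => bregR (hhat f h γ i) (z k) (primal f h γ (s k) i)) atTop (𝓝 0))
    {a : Euc n} (ha : a ∈ limitSet z) : IsRegSubgradient (cost f g) a 0 := by
  have hK := kernelAssumption_of_Cset_eq_univ hC
  have hU := interior_edom_eq_univ_of_Cset_eq_univ hC
  have hmem : ∀ (w : Euc n) i, w ∈ interior (edom (h i)) := fun w i => hU i ▸ Set.mem_univ w
  have hPM : ∀ i, ConvexPM (f i) (h i) (L i) (edom (h i)) := fun i => by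
    have h1 : edom (h i) = interior (edom (h i)) :=
      (Set.subset_univ _).antisymm (hU i ▸ interior_subset) |>.trans (hU i).symm
    rw [h1]
    exact (hb.relSmooth i).convexPM
  have hca := hr.cost_eq_of_mem_limitSet hb hK hPM hℓ hres ha
  obtain ⟨ψ, hψ, hza⟩ := exists_subseq_of_mem_limitSet ha
  have hlow : ∀ w ∈ edom (cost f g),
      ℓ ≤ re (cost f g) w + ∑ i, (1 / γ i + L i / N) * bregR (h i) w a := by
    intro w hw
    have h2 : Tendsto (fun k => re (cost f g) w + ∑ i, (1 / γ i + L i / N) *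
        bregR (h i) w (primal f h γ (s (ψ k)) i)) atTop
        (𝓝 (re (cost f g) w + ∑ i, (1 / γ i + L i / N) * bregR (h i) w a)) :=
      (tendsto_finsetSum Finset.univ fun i _ =>
        (((hb.legendre i).tendsto_bregR_of_mem_interior (hmem a i)
          (hr.tendsto_primal_subseq hb hK hres hψ hza i)).const_mul _)).const_add _
    refine le_of_tendsto_of_tendsto' (hℓ.comp hψ.tendsto_atTop) h2 fun k => ?_
    refine (hb.lyapR_le_of_mem_Tmap (hr.z_mem_Tmap (ψ k)) (fun i => interior_subset (hmem w i))
      (hb.edom_cost_subset hw)).trans ?_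
    gcongr with i
    exact hb.bregR_hhat_le i interior_subset (hb.relSmooth i).convexPM (hmem w i)
      (hb.primal_mem _ i) (hb.primal_mem _ i)
  have hsmall : (fun w => ∑ i, (1 / γ i + L i / N) * bregR (h i) w a) =o[𝓝 a] fun w => w - a :=
    Asymptotics.IsLittleO.fun_sum fun i _ =>
      (hasGradientAt_iff_isLittleO.1 ((hb.legendre i).hasGradientAt (hmem a i))).const_mul_left _
  refine ⟨by rw [hca]; exact EReal.coe_lt_top ℓ, ?_⟩
  rw [le_liminf_iff]
  intro y hy
  obtain ⟨b, hyb, hb0⟩ := EReal.lt_iff_exists_real_btwn.1 hy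
  have hb0' : b < 0 := by exact_mod_cast hb0
  filter_upwards [(Asymptotics.isLittleO_iff.1 hsmall (neg_pos.2 hb0')).filter_mono
    nhdsWithin_le_nhds, self_mem_nhdsWithin] with w hw hwa
  have hpos : 0 < ‖w - a‖ := norm_pos_iff.2 (sub_ne_zero.2 hwa)
  refine hyb.trans_le ?_
  rw [hca, inner_zero_left, EReal.coe_zero, sub_zero]
  by_cases hwc : w ∈ edom (cost f g)
  · rw [← coe_re (hb.cost_ne_bot w) hwc, ← EReal.coe_sub, ← EReal.coe_div, EReal.coe_le_coe_iff,
      le_div_iff₀ hpos]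
    have h3 := hlow w hwc
    have h4 := (le_abs_self _).trans hw
    linarith
  · have : cost f g w = ⊤ := not_lt_top_iff.1 hwc
    rw [this, EReal.top_sub_coe, EReal.top_div_of_pos_ne_top (by exact_mod_cast hpos)
      (EReal.coe_ne_top _)]
    exact le_top

end IsRun

/-! ### Convergence of the iterates for a convex cost -/

/-- A sequence dominated by a nonnegative, antitone and summable one is `o(1/k)`. -/
theorem isLittleO_one_div_of_antitone_of_summable {a u : ℕ → ℝ} (ha : Antitone a)
    (hs : Summable a) (hu : ∀ k, 0 ≤ u k) (hua : ∀ k, u k ≤ a k) :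
    u =o[atTop] fun k : ℕ => 1 / (k : ℝ) := by
  have hS := hs.hasSum.tendsto_sum_nat
  have h1 : Tendsto (fun k : ℕ => 2 * (∑ j ∈ Finset.range k, a j - ∑ j ∈ Finset.range (k / 2), a j))
      atTop (𝓝 0) := by
    simpa using (hS.sub (hS.comp (Nat.tendsto_div_const_atTop two_ne_zero))).const_mul 2
  -- the terms with index between `k / 2` and `k` are all at least `a k`
  have h2 : ∀ k : ℕ, k * a k ≤
      2 * (∑ j ∈ Finset.range k, a j - ∑ j ∈ Finset.range (k / 2), a j) := by
    intro k
    rw [← Finset.sum_Ico_eq_sub _ (Nat.div_le_self k 2)]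
    have h3 := Finset.card_nsmul_le_sum (Finset.Ico (k / 2) k) a (a k)
      fun j hj => ha (Finset.mem_Ico.1 hj).2.le
    rw [Nat.card_Ico, nsmul_eq_mul] at h3
    have h4 : (k : ℝ) ≤ 2 * ((k - k / 2 : ℕ) : ℝ) := by
      exact_mod_cast (by omega : k ≤ 2 * (k - k / 2))
    have h5 := mul_le_mul_of_nonneg_right h4 ((hu k).trans (hua k))
    linarith
  rw [Asymptotics.isLittleO_iff]
  intro c hc
  filter_upwards [h1.eventually (gt_mem_nhds hc), eventually_gt_atTop 0] with k hk hk0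
  have hk0' : (0 : ℝ) < k := Nat.cast_pos.2 hk0
  rw [Real.norm_of_nonneg (hu k), Real.norm_of_nonneg (one_div_pos.2 hk0').le, mul_one_div,
    le_div_iff₀ hk0']
  have := mul_le_mul_of_nonneg_left (hua k) hk0'.le
  linarith [h2 k]

/-- Pointwise convergence of a sequence of affine functions on a set follows from convergence at
finitely many points of the set, namely points spanning its affine hull. -/
theorem exists_finite_forall_tendsto_affine {E : Type*} [NormedAddCommGroup E]
    [InnerProductSpace ℝ E] [FiniteDimensional ℝ E] (S : Set E) :
    ∃ T ⊆ S, T.Finite ∧ ∀ (c : ℕ → ℝ) (σ : ℕ → E),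
      (∀ w ∈ T, ∃ y, Tendsto (fun k => c k - inner ℝ (σ k) w) atTop (𝓝 y)) →
      ∀ w ∈ S, ∃ y, Tendsto (fun k => c k - inner ℝ (σ k) w) atTop (𝓝 y) := by
  obtain ⟨T, hTS, hspan, hind⟩ := exists_affineIndependent ℝ E S
  refine ⟨T, hTS, finite_set_of_fin_dim_affineIndependent ℝ hind, fun c σ hT w hw => ?_⟩
  have hw' : w ∈ affineSpan ℝ T := hspan ▸ subset_affineSpan ℝ S hw
  refine affineSpan_induction (p := fun w => ∃ y, Tendsto (fun k => c k - inner ℝ (σ k) w) atTop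
    (𝓝 y)) hw' hT ?_
  rintro t u v w ⟨yu, hu⟩ ⟨yv, hv⟩ ⟨yw, hw⟩
  refine ⟨t * (yu - yv) + yw, (((hu.sub hv).const_mul t).add hw).congr fun k => ?_⟩
  simp only [vsub_eq_sub, vadd_eq_add, inner_add_right, inner_smul_right, inner_sub_right]
  ring

theorem mem_edom_of_mem_argminOn {F : Euc n → EReal} {h : Fin N → Euc n → EReal}
    (hcl : ∀ i, IsClosed (edom (h i))) {w : Euc n}
    (hw : w ∈ argminOn F (closure (Cset h))) (i : Fin N) : w ∈ edom (h i) :=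
  closure_minimal (fun _ hx => interior_subset (mem_interior_of_mem_Cset hx i)) (hcl i) hw.1

namespace BasicAssumption

variable {f h : Fin N → Euc n → EReal} {g : Euc n → EReal} {L γ : Fin N → ℝ}
  (hb : BasicAssumption f h g L γ)
include hb

/-- The weighted sum of the Bregman distances from `w` to the primal table is an affine function of
`w` up to a function independent of the table. -/
theorem sum_mul_bregR_eq (q : Fin N → ℝ) (s : Fin N → Euc n) (w : Euc n) :
    ∑ i, q i * bregR (hhat f h γ i) w (primal f h γ s i) =
      ∑ i, q i * re (hhat f h γ i) w +
      (∑ i, q i * (inner ℝ (s i) (primal f h γ s i) - re (hhat f h γ i) (primal f h γ s i)) -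
        inner ℝ (∑ i, q i • s i) w) := by
  rw [sum_inner]
  simp only [bregR, hb.grad_primal, real_inner_smul_left, inner_sub_right]
  rw [← Finset.sum_sub_distrib, ← Finset.sum_add_distrib]
  exact Finset.sum_congr rfl fun i _ => by ring

/-- The weighted Bregman distances to a sequence of primal tables converge at every point of `S` as
soon as they do at the points of a suitable finite subset, the same for all sequences. -/
theorem exists_finite_forall_tendsto_bregR (S : Set (Euc n)) (q : Fin N → ℝ) :
    ∃ T ⊆ S, T.Finite ∧ ∀ s : ℕ → Fin N → Euc n,
      (∀ w ∈ T, ∃ y, Tendsto (fun k => ∑ i, q i * bregR (hhat f h γ i) w (primal f h γ (s k) i))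
        atTop (𝓝 y)) →
      ∀ w ∈ S, ∃ y, Tendsto (fun k => ∑ i, q i * bregR (hhat f h γ i) w (primal f h γ (s k) i))
        atTop (𝓝 y) := by
  obtain ⟨T, hTS, hfin, hT⟩ := exists_finite_forall_tendsto_affine S
  refine ⟨T, hTS, hfin, fun s hs w hw => ?_⟩
  obtain ⟨y, hy⟩ := hT
    (fun k => ∑ i, q i * (inner ℝ (s k i) (primal f h γ (s k) i)
      - re (hhat f h γ i) (primal f h γ (s k) i))) (fun k => ∑ i, q i • s k i) (fun v hv => by
      obtain ⟨y, hy⟩ := hs v hv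
      refine ⟨_, (hy.sub_const (∑ i, q i * re (hhat f h γ i) v)).congr fun k => ?_⟩
      rw [hb.sum_mul_bregR_eq]
      ring) w hw
  refine ⟨_, (hy.const_add (∑ i, q i * re (hhat f h γ i) w)).congr fun k => ?_⟩
  rw [hb.sum_mul_bregR_eq]

end BasicAssumption

namespace IsRun

variable {f h : Fin N → Euc n → EReal} {g : Euc n → EReal} {L γ : Fin N → ℝ}
  {xinit : Euc n} {z : ℕ → Euc n} {s : ℕ → Fin N → Euc n} {st : ℕ → Euc n}
  {I : ℕ → Finset (Fin N)} (hr : IsRun f h g γ xinit z s st I)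
  (hb : BasicAssumption f h g L γ)
include hr hb

/-- If the costs of the iterates tend to the minimum, limit points are minimizers. -/
theorem mem_argminOn_of_mem_limitSet [NeZero N] {xs : Euc n}
    (hxs : xs ∈ argminOn (cost f g) (closure (Cset h)))
    (hcost : Tendsto (fun k => re (cost f g) (z k)) atTop (𝓝 (re (cost f g) xs))) {a : Euc n}
    (ha : a ∈ limitSet z) : a ∈ argminOn (cost f g) (closure (Cset h)) := by
  obtain ⟨ψ, hψ, hza⟩ := exists_subseq_of_mem_limitSet ha
  have hle : cost f g a ≤ cost f g xs := by
    refine hb.lowerSemicontinuous_cost.le_of_tendsto hza ?_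
    simp only [Function.comp_apply, ← hr.coe_re_cost hb]
    rw [← coe_re (hb.cost_ne_bot xs) hxs.2.1]
    exact EReal.tendsto_coe.2 (hcost.comp hψ.tendsto_atTop)
  exact ⟨mem_closure_of_tendsto hza (Eventually.of_forall fun k => hr.z_mem_Cset hb (ψ k)),
    hle.trans_lt hxs.2.1, fun w hw => hle.trans (hxs.2.2 w hw)⟩

/-- Convergence of the whole sequence when the iterates are bounded and the weighted Bregman
distances to the primal table converge at every minimizer: at a limit point of `z` the limit of
these distances is zero, after correcting the boundary values of the shifted kernels. -/
theorem exists_tendsto_of_isBounded [NeZero N] (hK : KernelAssumption h)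
    (hconv : IsConvexFun (cost f g)) {xs : Euc n}
    (hxs : xs ∈ argminOn (cost f g) (closure (Cset h)))
    (hlyap : Tendsto (fun k => lyapR f h g γ (z k) (s k)) atTop (𝓝 (re (cost f g) xs)))
    (hres : ∀ i, Tendsto (fun k => bregR (hhat f h γ i) (z k) (primal f h γ (s k) i)) atTop (𝓝 0))
    (hbdd : Bornology.IsBounded (Set.range z)) {q : Fin N → ℝ} (hq : ∀ i, 0 < q i)
    (hV : ∀ w ∈ argminOn (cost f g) (closure (Cset h)), ∃ y, Tendsto
      (fun k => ∑ i, q i * bregR (hhat f h γ i) w (primal f h γ (s k) i)) atTop (𝓝 y)) :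
    ∃ a ∈ argminOn (cost f g) (closure (Cset h)), Tendsto z atTop (𝓝 a) ∧
      ∀ i, Tendsto (fun k => primal f h γ (s k) i) atTop (𝓝 a) := by
  obtain ⟨a, -, ψ, hψ, hza⟩ := tendsto_subseq_of_bounded hbdd (fun k => Set.mem_range_self k)
  have hcost := tendsto_re_cost_of_tendsto_lyapR hlyap hres
  have haA : a ∈ argminOn (cost f g) (closure (Cset h)) :=
    hr.mem_argminOn_of_mem_limitSet hb hxs hcost (hza.mapClusterPt.of_comp hψ.tendsto_atTop)
  refine ⟨a, haA, ?_⟩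
  have had := fun i => mem_edom_of_mem_argminOn (fun i => (hK i).1) haA i
  choose e he hlow using fun i => (hb.isEquivalentKernel i).exists_boundary_value (had i)
  have hnn : ∀ i, ∀ x ∈ interior (edom (h i)), 0 ≤ bregVal (hhat f h γ i) (e i) a x :=
    fun i x hx => (mul_nonneg (hb.isEquivalentKernel i).pos.le
      ((hb.legendre i).bregR_nonneg (had i) hx)).trans (hlow i x hx).1
  have hxm : ∀ k i, primal f h γ (s k) i ∈ interior (edom (h i)) := fun k i => hb.primal_mem _ i
  -- the corrected weighted distances converge, and vanish along the subsequence
  have hV0 : Tendsto (fun k => ∑ i, q i * bregVal (hhat f h γ i) (e i) a (primal f h γ (s k) i))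
      atTop (𝓝 0) := by
    obtain ⟨y, hy⟩ := hV a haA
    have h1 := hy.add_const (∑ i, q i * (e i - re (hhat f h γ i) a))
    have h2 : (fun k => ∑ i, q i * bregR (hhat f h γ i) a (primal f h γ (s k) i) +
        ∑ i, q i * (e i - re (hhat f h γ i) a)) =
        fun k => ∑ i, q i * bregVal (hhat f h γ i) (e i) a (primal f h γ (s k) i) := by
      funext k
      rw [← Finset.sum_add_distrib]
      exact Finset.sum_congr rfl fun i _ => by simp only [bregR, bregVal]; ring
    rw [h2] at h1
    have h3 : Tendsto (fun k => ∑ i, q i * bregVal (hhat f h γ i) (e i) a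
        (primal f h γ (s (ψ k)) i)) atTop (𝓝 0) := by
      have h4 : Tendsto (fun k => ∑ i, q i * ((1 / γ i + L i / N) *
          bregR (h i) a (primal f h γ (s (ψ k)) i))) atTop (𝓝 0) := by
        simpa using tendsto_finsetSum Finset.univ fun i _ =>
          ((hr.tendsto_bregR_subseq hb hK hres hψ hza i).2.const_mul
            (1 / γ i + L i / N)).const_mul (q i)
      refine squeeze_zero (fun k => Finset.sum_nonneg fun i _ =>
        mul_nonneg (hq i).le (hnn i _ (hxm _ i))) (fun k => ?_) h4
      exact Finset.sum_le_sum fun i _ => mul_le_mul_of_nonneg_left (hlow i _ (hxm _ i)).2 (hq i).le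
    rwa [tendsto_nhds_unique (h1.comp hψ.tendsto_atTop) h3] at h1
  have hx0 : ∀ i, Tendsto (fun k => bregVal (hhat f h γ i) (e i) a (primal f h γ (s k) i))
      atTop (𝓝 0) := by
    intro i
    have h1 : Tendsto (fun k => (q i)⁻¹ * ∑ j, q j * bregVal (hhat f h γ j) (e j) a
        (primal f h γ (s k) j)) atTop (𝓝 0) := by simpa using hV0.const_mul (q i)⁻¹
    refine squeeze_zero (fun k => hnn i _ (hxm k i)) (fun k => ?_) h1
    rw [le_inv_mul_iff₀ (hq i)]
    exact Finset.single_le_sum (f := fun j => q j * bregVal (hhat f h γ j) (e j) a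
      (primal f h γ (s k) j)) (fun j _ => mul_nonneg (hq j).le (hnn j _ (hxm k j)))
      (Finset.mem_univ i)
  have hcrit : ∀ (i : Fin N) (x : ℕ → Euc n), (∀ k, x k ∈ interior (edom (h i))) →
      Tendsto (fun k => bregVal (hhat f h γ i) (e i) a (x k)) atTop (𝓝 0) →
      Tendsto x atTop (𝓝 a) := by
    intro i x hx hx0
    refine (hb.legendre i).tendsto_of_bregR_tendsto_zero (hK.isBregmanConsistent (hb.legendre i))
      (had i) hx ?_
    have h1 : Tendsto (fun k => (1 / γ i - L i / N)⁻¹ * bregVal (hhat f h γ i) (e i) a (x k))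
        atTop (𝓝 0) := by simpa using hx0.const_mul (1 / γ i - L i / N)⁻¹
    refine squeeze_zero (fun k => (hb.legendre i).bregR_nonneg (had i) (hx k)) (fun k => ?_) h1
    rw [le_inv_mul_iff₀ (hb.isEquivalentKernel i).pos]
    exact (hlow i _ (hx k)).1
  refine ⟨hcrit 0 z (fun k => hr.z_mem_interior hb k 0) ?_, fun i => hcrit i _ (hxm · i) (hx0 i)⟩
  have hsum : Tendsto (fun k => ∑ i, bregVal (hhat f h γ i) (e i) a (primal f h γ (s k) i))
      atTop (𝓝 0) := by simpa using tendsto_finsetSum Finset.univ fun i _ => hx0 i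
  refine squeeze_zero (fun k => hnn 0 _ (hr.z_mem_interior hb k 0)) (fun k => ?_) hsum
  have h1 := hb.sum_bregVal_le_of_isConvexFun hconv (hr.z_mem_Tmap k) had haA.2.1 e
  have h2 := Finset.single_le_sum (f := fun j => bregVal (hhat f h γ j) (e j) a (z k))
    (fun j _ => hnn j _ (hr.z_mem_interior hb k j)) (Finset.mem_univ (0 : Fin N))
  have h3 := hr.le_lyapR hb haA k
  linarith

/-- With kernels finite everywhere, the iterates are bounded if the Bregman distances from some
point to the primal table are. -/
theorem isBounded_range_of_Cset_eq_univ [NeZero N] (hC : Cset h = Set.univ)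
    (hconv : IsConvexFun (cost f g)) {xs : Euc n}
    (hxs : xs ∈ argminOn (cost f g) (closure (Cset h))) {q : Fin N → ℝ} (hq : ∀ i, 0 < q i)
    (hV : ∃ y, Tendsto (fun k => ∑ i, q i * bregR (hhat f h γ i) xs (primal f h γ (s k) i)) atTop
      (𝓝 y)) : Bornology.IsBounded (Set.range z) := by
  have hmem : ∀ (w : Euc n) i, w ∈ interior (edom (h i)) := fun w i =>
    interior_edom_eq_univ_of_Cset_eq_univ hC i ▸ Set.mem_univ w
  have hnn : ∀ (x : Euc n) i, 0 ≤ bregR (hhat f h γ i) xs x := fun x i =>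
    (hb.isEquivalentKernel i).bregR_nonneg (interior_subset (hmem xs i)) (hmem x i)
  obtain ⟨y, hy⟩ := hV
  obtain ⟨M, hM⟩ := hy.bddAbove_range
  have hM' : ∀ k i, bregR (hhat f h γ i) xs (primal f h γ (s k) i) ≤ (q i)⁻¹ * M := by
    intro k i
    rw [le_inv_mul_iff₀ (hq i)]
    exact (Finset.single_le_sum (f := fun j => q j * bregR (hhat f h γ j) xs
      (primal f h γ (s k) j)) (fun j _ => mul_nonneg (hq j).le (hnn _ j))
      (Finset.mem_univ i)).trans (hM ⟨k, rfl⟩)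
  refine ((hb.isEquivalentKernel 0).isBounded_setOf_bregR_le (hmem xs 0)
    (∑ i, (q i)⁻¹ * M)).subset ?_
  rintro _ ⟨k, rfl⟩
  refine ⟨hmem _ 0, ?_⟩
  have h1 := hb.sum_bregVal_le_of_isConvexFun hconv (hr.z_mem_Tmap k)
    (fun i => interior_subset (hmem xs i)) hxs.2.1 fun i => re (hhat f h γ i) xs
  change ∑ i, bregR (hhat f h γ i) xs (z k) ≤
    ∑ i, bregR (hhat f h γ i) xs (primal f h γ (s k) i) - _ at h1
  have h2 := Finset.single_le_sum (f := fun j => bregR (hhat f h γ j) xs (z k))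
    (fun j _ => hnn _ j) (Finset.mem_univ (0 : Fin N))
  have h3 := hr.le_lyapR hb hxs k
  have h4 := Finset.sum_le_sum fun i (_ : i ∈ Finset.univ) => hM' k i
  linarith

end IsRun

/-! ### Nonnegative supermartingales -/

section Supermartingale

variable {Ω : Type*} {mΩ : MeasurableSpace Ω} {μ : Measure Ω} [IsProbabilityMeasure μ]
  {ℱ : Filtration ℕ mΩ} {X R : ℕ → Ω → ℝ}

/-- The decrements of a process bounded below that decreases in conditional expectation are almost
surely summable, because the sum of their expectations is finite. -/
theorem ae_summable_of_condExp_le (hX : ∀ k, Integrable (X k) μ) (hR : ∀ k, Integrable (R k) μ)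
    (hR0 : ∀ k ω, 0 ≤ R k ω) (m : ℝ) (hm : ∀ k ω, m ≤ X k ω)
    (h : ∀ k, μ[X (k + 1) | ℱ k] ≤ᵐ[μ] fun ω => X k ω - R k ω) :
    ∀ᵐ ω ∂μ, Summable fun k => R k ω := by
  have h1 : ∀ k, ∫ ω, R k ω ∂μ ≤ ∫ ω, X k ω ∂μ - ∫ ω, X (k + 1) ω ∂μ := by
    intro k
    have h2 := integral_mono_ae integrable_condExp ((hX k).sub (hR k)) (h k)
    rw [integral_condExp (ℱ.le k)] at h2
    simp only [Pi.sub_apply] at h2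
    rw [integral_sub (hX k) (hR k)] at h2
    linarith
  have h3 : ∀ K, ∑ k ∈ Finset.range K, ∫ ω, R k ω ∂μ ≤ ∫ ω, X 0 ω ∂μ - m := by
    intro K
    have h4 := Finset.sum_le_sum fun k (_ : k ∈ Finset.range K) => h1 k
    rw [Finset.sum_range_sub' (fun k => ∫ ω, X k ω ∂μ)] at h4
    have h5 : m ≤ ∫ ω, X K ω ∂μ := by
      have := integral_mono (integrable_const m) (hX K) (hm K)
      simpa using this
    linarith
  have h6 : ∫⁻ ω, ∑' k, ENNReal.ofReal (R k ω) ∂μ ≠ ⊤ := by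
    rw [lintegral_tsum fun k => (hR k).aestronglyMeasurable.aemeasurable.ennreal_ofReal]
    refine ne_top_of_le_ne_top (ENNReal.ofReal_ne_top (r := ∫ ω, X 0 ω ∂μ - m))
      (ENNReal.tsum_le_of_sum_range_le fun K => ?_)
    have h7 : ∀ k, ∫⁻ ω, ENNReal.ofReal (R k ω) ∂μ = ENNReal.ofReal (∫ ω, R k ω ∂μ) := fun k =>
      (ofReal_integral_eq_lintegral_ofReal (hR k) (Eventually.of_forall (hR0 k))).symm
    simp only [h7]
    rw [← ENNReal.ofReal_sum_of_nonneg fun k _ => integral_nonneg (hR0 k)]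
    exact ENNReal.ofReal_le_ofReal (h3 K)
  filter_upwards [ae_lt_top' (AEMeasurable.tsum fun k =>
    (hR k).aestronglyMeasurable.aemeasurable.ennreal_ofReal) h6] with ω hω
  refine (ENNReal.summable_toReal hω.ne).congr fun k => ?_
  rw [ENNReal.toReal_ofReal (hR0 k ω)]

/-- Almost sure convergence of nonnegative supermartingales. -/
theorem ae_exists_tendsto_of_condExp_le (hX : ∀ k, Integrable (X k) μ)
    (hXm : ∀ k, StronglyMeasurable[ℱ k] (X k)) (hX0 : ∀ k ω, 0 ≤ X k ω)
    (h : ∀ k, μ[X (k + 1) | ℱ k] ≤ᵐ[μ] X k) :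
    ∀ᵐ ω ∂μ, ∃ y, Tendsto (fun k => X k ω) atTop (𝓝 y) := by
  have hsub := (supermartingale_nat hXm hX h).neg
  have hint : ∀ k, ∫ ω, X k ω ∂μ ≤ ∫ ω, X 0 ω ∂μ := by
    intro k
    induction k with
    | zero => exact le_rfl
    | succ k ih =>
      refine le_trans ?_ ih
      rw [← integral_condExp (ℱ.le k)]
      exact integral_mono_ae integrable_condExp (hX k) (h k)
  have hbd : ∀ k, eLpNorm ((-X) k) 1 μ ≤ ((∫ ω, X 0 ω ∂μ).toNNReal : ENNReal) := by
    intro k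
    rw [Pi.neg_apply, eLpNorm_neg, eLpNorm_one_eq_lintegral_enorm,
      ← ofReal_integral_norm_eq_lintegral_enorm (hX k)]
    have : ∀ ω, ‖X k ω‖ = X k ω := fun ω => Real.norm_of_nonneg (hX0 k ω)
    simp only [this]
    exact ENNReal.ofReal_le_ofReal (hint k)
  filter_upwards [hsub.exists_ae_tendsto_of_bdd hbd] with ω hω
  obtain ⟨y, hy⟩ := hω
  exact ⟨-y, by simpa using hy.neg⟩

/-- One step of the randomized rule: a decrease which is a sum of terms activated by the selected
indices becomes, in conditional expectation, the combination of these terms with the selection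
probabilities. -/
theorem RandomizedRule.condExp_le {p : Fin N → ℝ} {I : ℕ → Ω → Finset (Fin N)}
    (hrule : RandomizedRule μ ℱ p I) {k : ℕ} {Y Y' : Ω → ℝ} {B : Fin N → Ω → ℝ}
    (hY : Integrable Y μ) (hYm : StronglyMeasurable[ℱ k] Y) (hY' : Integrable Y' μ)
    (hBm : ∀ i, StronglyMeasurable[ℱ k] (B i)) {M : ℝ} (hBM : ∀ i ω, ‖B i ω‖ ≤ M)
    (hle : ∀ ω, Y' ω ≤ Y ω - ∑ i ∈ I (k + 1) ω, B i ω) :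
    μ[Y' | ℱ k] ≤ᵐ[μ] fun ω => Y ω - ∑ i, p i * B i ω := by
  classical
  set A : Fin N → Set Ω := fun i => {ω | i ∈ I (k + 1) ω} with hA
  set ind : Fin N → Ω → ℝ := fun i => (A i).indicator fun _ => 1 with hind
  have hAm : ∀ i, MeasurableSet (A i) := fun i => ℱ.le (k + 1) _ (hrule.meas k i)
  have hindint : ∀ i, Integrable (ind i) μ := fun i =>
    (integrable_const (1 : ℝ)).indicator (hAm i)
  have hBint : ∀ i, Integrable (B i * ind i) μ := fun i =>
    (hindint i).bdd_mul ((hBm i).mono (ℱ.le k)).aestronglyMeasurable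
      (Eventually.of_forall (hBM i))
  have hsum : ∀ ω, ∑ i ∈ I (k + 1) ω, B i ω = (∑ i, B i * ind i) ω := by
    intro ω
    simp only [Finset.sum_apply, Pi.mul_apply, hind, hA, Set.indicator_apply, Set.mem_ofPred_eq,
      mul_ite, mul_one, mul_zero, Finset.sum_ite_mem, Finset.univ_inter]
  have hsumint : Integrable (∑ i, B i * ind i) μ := integrable_finsetSum' _ fun i _ => hBint i
  have h1 : μ[Y' | ℱ k] ≤ᵐ[μ] μ[Y - ∑ i, B i * ind i | ℱ k] :=
    condExp_mono hY' (hY.sub hsumint) (Eventually.of_forall fun ω => by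
      simpa only [Pi.sub_apply, ← hsum ω] using hle ω)
  have h2 : ∀ᵐ ω ∂μ, ∀ i, (μ[B i * ind i | ℱ k]) ω = B i ω * p i := by
    rw [ae_all_iff]
    intro i
    filter_upwards [condExp_stronglyMeasurable_mul_of_bound (ℱ.le k) (hBm i) (hindint i) M
      (Eventually.of_forall (hBM i)), hrule.prob k i] with ω e1 e2
    rw [e1, Pi.mul_apply]
    congr 1
  filter_upwards [h1, condExp_sub hY hsumint (ℱ k),
    condExp_finsetSum (fun i (_ : i ∈ Finset.univ) => hBint i) (ℱ k), h2] with ω e1 e2 e3 e4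
  refine e1.trans_eq ?_
  rw [e2, Pi.sub_apply, e3, Finset.sum_apply, condExp_of_stronglyMeasurable (ℱ.le k) hYm hY]
  simp only [e4, mul_comm]

end Supermartingale

/-! ### Measurability -/

theorem measurable_grad (F : Euc n → EReal) : Measurable (grad F) :=
  (InnerProductSpace.toDual ℝ (Euc n)).symm.continuous.measurable.comp
    (measurable_fderiv ℝ (re F))

theorem _root_.LowerSemicontinuous.measurable_re {F : Euc n → EReal} (hF : LowerSemicontinuous F) :
    Measurable (re F) :=
  hF.measurable.ereal_toReal

namespace BasicAssumption

variable {f h : Fin N → Euc n → EReal} {g : Euc n → EReal} {L γ : Fin N → ℝ}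
  (hb : BasicAssumption f h g L γ) {Ω : Type*} {m : MeasurableSpace Ω}
include hb

theorem measurable_re_hhat {y : Ω → Euc n} (hy : Measurable y) {i : Fin N}
    (hmem : ∀ ω, y ω ∈ edom (h i)) : Measurable fun ω => re (hhat f h γ i) (y ω) := by
  simp only [hb.re_hhat i (hmem _)]
  exact (((hb.legendre i).lsc.measurable_re.comp hy).const_mul _).sub
    (((hb.relSmooth i).lsc.measurable_re.comp hy).const_mul _)

theorem measurable_bregR_hhat {w y : Ω → Euc n} (hw : Measurable w) (hy : Measurable y) {i : Fin N}
    (hwmem : ∀ ω, w ω ∈ edom (h i)) (hmem : ∀ ω, y ω ∈ edom (h i)) :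
    Measurable fun ω => bregR (hhat f h γ i) (w ω) (y ω) :=
  ((hb.measurable_re_hhat hw hwmem).sub (hb.measurable_re_hhat hy hmem)).sub
    (((measurable_grad _).comp hy).inner (hw.sub hy))

end BasicAssumption

/-! ### The randomized algorithm -/

section Randomized

variable {f h : Fin N → Euc n → EReal} {g : Euc n → EReal} {L γ : Fin N → ℝ}
  (hb : BasicAssumption f h g L γ) {xinit : Euc n} (hx : xinit ∈ Cset h)
  {Ω : Type*} {mΩ : MeasurableSpace Ω} {μ : Measure Ω} [IsProbabilityMeasure μ]
  {ℱ : Filtration ℕ mΩ} {p : Fin N → ℝ}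
  {z : ℕ → Ω → Euc n} {s : ℕ → Ω → Fin N → Euc n} {st : ℕ → Ω → Euc n}
  {I : ℕ → Ω → Finset (Fin N)}
  (hrule : RandomizedRule μ ℱ p I) (hz : ∀ k, StronglyMeasurable[ℱ k] (z k))
  (hrun : ∀ ω, IsRun f h g γ xinit (fun k => z k ω) (fun k => s k ω) (fun k => st k ω)
    (fun k => I k ω))

include hb hrule hz hrun

omit [IsProbabilityMeasure μ] in
theorem measurable_table (k : ℕ) (i : Fin N) : Measurable[ℱ k] fun ω => s k ω i := by
  classical
  induction k with
  | zero =>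
    have : (fun ω => s 0 ω i) = fun _ =>
        (1 / γ i : ℝ) • grad (h i) xinit - ((1 : ℝ) / (N : ℝ)) • grad (f i) xinit :=
      funext fun ω => (hrun ω).s_zero i
    rw [this]
    exact measurable_const
  | succ k ih =>
    have : (fun ω => s (k + 1) ω i) = fun ω =>
        if i ∈ I (k + 1) ω then grad (hhat f h γ i) (z k ω) else s k ω i := by
      funext ω
      split_ifs with hi
      · exact (hrun ω).s_succ_eq_grad hb hi
      · exact (hrun ω).s_succ_notMem k i hi
    rw [this]
    exact Measurable.ite (hrule.meas k i)
      (((measurable_grad _).comp (hz k).measurable).mono (ℱ.mono k.le_succ) le_rfl)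
      (ih.mono (ℱ.mono k.le_succ) le_rfl)

omit [IsProbabilityMeasure μ] in
theorem measurable_primal (k : ℕ) (i : Fin N) :
    Measurable[ℱ k] fun ω => primal f h γ (s k ω) i :=
  (measurable_grad _).comp (measurable_table hb hrule hz hrun k i)

omit [IsProbabilityMeasure μ] in
theorem stronglyMeasurable_residual (k : ℕ) (i : Fin N) :
    StronglyMeasurable[ℱ k] fun ω =>
      bregR (hhat f h γ i) (z k ω) (primal f h γ (s k ω) i) :=
  (hb.measurable_bregR_hhat (hz k).measurable (measurable_primal hb hrule hz hrun k i)
    (fun ω => (hrun ω).z_mem_edom hb k i)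
    fun _ => interior_subset (hb.primal_mem _ i)).stronglyMeasurable

omit [IsProbabilityMeasure μ] in
theorem stronglyMeasurable_lyapR [NeZero N] (k : ℕ) :
    StronglyMeasurable[ℱ k] fun ω => lyapR f h g γ (z k ω) (s k ω) := by
  refine StronglyMeasurable.add ?_ ?_
  · exact (hb.lowerSemicontinuous_cost.measurable_re.comp (hz k).measurable).stronglyMeasurable
  · exact Finset.stronglyMeasurable_fun_sum _ fun i _ =>
      stronglyMeasurable_residual hb hrule hz hrun k i

omit hrule hz [IsProbabilityMeasure μ] in
include hx in
/-- The Lyapunov function is bounded above by its initial value, the envelope at the initial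
table. -/
theorem lyapR_le_envelope [NeZero N] (k : ℕ) (ω : Ω) :
    lyapR f h g γ (z k ω) (s k ω) ≤ (envelope f h g γ fun _ => xinit).toReal := by
  refine ((hrun ω).lyapR_antitone hb (Nat.zero_le k)).trans_eq ?_
  have h1 := (hrun ω).envelope_eq hb 0
  have h2 : primal f h γ (s 0 ω) = fun _ => xinit :=
    funext fun i => (hrun ω).primal_zero hb hx i
  rw [h2] at h1
  rw [h1, EReal.toReal_coe]

include hx in
theorem integrable_lyapR [NeZero N] (k : ℕ) :
    Integrable (fun ω => lyapR f h g γ (z k ω) (s k ω)) μ := by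
  obtain ⟨xs, hxs⟩ := hb.exists_sol
  refine Integrable.of_bound
    ((stronglyMeasurable_lyapR hb hrule hz hrun k).mono (ℱ.le k)).aestronglyMeasurable
    (max |re (cost f g) xs| |(envelope f h g γ fun _ => xinit).toReal|)
    (Eventually.of_forall fun ω => ?_)
  exact abs_le_max_abs_abs ((hrun ω).le_lyapR hb hxs k) (lyapR_le_envelope hb hx hrun k ω)

include hx in
theorem condExp_lyapR_le [NeZero N] (k : ℕ) :
    μ[fun ω => lyapR f h g γ (z (k + 1) ω) (s (k + 1) ω) | ℱ k] ≤ᵐ[μ] fun ω =>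
      lyapR f h g γ (z k ω) (s k ω) -
        (⨅ i, p i) * ∑ i, bregR (hhat f h γ i) (z k ω) (primal f h γ (s k ω) i) := by
  obtain ⟨xs, hxs⟩ := hb.exists_sol
  have h1 := hrule.condExp_le (integrable_lyapR hb hx hrule hz hrun k)
    (stronglyMeasurable_lyapR hb hrule hz hrun k) (integrable_lyapR hb hx hrule hz hrun (k + 1))
    (stronglyMeasurable_residual hb hrule hz hrun k)
    (M := (envelope f h g γ fun _ => xinit).toReal - re (cost f g) xs)
    (fun i ω => by
      rw [Real.norm_of_nonneg ((hrun ω).residual_nonneg hb k i)]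
      have e1 := (hrun ω).residual_le hb k i
      have e2 := (hrun ω).le_re_cost hb hxs k
      have e3 := lyapR_le_envelope hb hx hrun k ω
      linarith)
    fun ω => (hrun ω).lyapR_succ_le hb k
  filter_upwards [h1] with ω hω
  refine hω.trans ?_
  rw [Finset.mul_sum]
  gcongr with i
  · exact (hrun ω).residual_nonneg hb k i
  · exact ciInf_le (Set.finite_range p).bddBelow i

include hx in
/-- The residuals are almost surely summable. -/
theorem ae_summable_residual [NeZero N] : ∀ᵐ ω ∂μ, ∀ i, Summable fun k =>
    bregR (hhat f h γ i) (z k ω) (primal f h γ (s k ω) i) := by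
  obtain ⟨xs, hxs⟩ := hb.exists_sol
  have hpmin : 0 < ⨅ i, p i := by
    obtain ⟨i, hi⟩ := exists_eq_ciInf_of_finite (f := p)
    exact hi ▸ hrule.p_pos i
  have hnn : ∀ k ω, 0 ≤ ∑ i, bregR (hhat f h γ i) (z k ω) (primal f h γ (s k ω) i) := fun k ω =>
    Finset.sum_nonneg fun i _ => (hrun ω).residual_nonneg hb k i
  have hRm : ∀ k, Measurable fun ω =>
      (⨅ i, p i) * ∑ i, bregR (hhat f h γ i) (z k ω) (primal f h γ (s k ω) i) := fun k =>
    (Finset.measurable_sum _ fun i _ => ((stronglyMeasurable_residual hb hrule hz hrun k i).mono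
      (ℱ.le k)).measurable).const_mul _
  have h1 := ae_summable_of_condExp_le (ℱ := ℱ)
    (fun k => integrable_lyapR hb hx hrule hz hrun k)
    (R := fun k ω => (⨅ i, p i) * ∑ i, bregR (hhat f h γ i) (z k ω) (primal f h γ (s k ω) i))
    (fun k => Integrable.of_bound (hRm k).aestronglyMeasurable
      ((⨅ i, p i) * ((envelope f h g γ fun _ => xinit).toReal - re (cost f g) xs))
      (Eventually.of_forall fun ω => by
        rw [Real.norm_of_nonneg (mul_nonneg hpmin.le (hnn k ω))]
        refine mul_le_mul_of_nonneg_left ?_ hpmin.le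
        have e1 := lyapR_le_envelope hb hx hrun k ω
        have e2 := (hrun ω).le_re_cost hb hxs k
        simp only [lyapR] at e1 e2
        linarith))
    (fun k ω => mul_nonneg hpmin.le (hnn k ω)) (re (cost f g) xs)
    (fun k ω => (hrun ω).le_lyapR hb hxs k) (condExp_lyapR_le hb hx hrule hz hrun)
  filter_upwards [h1] with ω hω i
  have h2 := hω.mul_left (⨅ i, p i)⁻¹
  simp only [inv_mul_cancel_left₀ hpmin.ne'] at h2
  exact h2.of_nonneg_of_le (fun k => (hrun ω).residual_nonneg hb k i) fun k =>
    Finset.single_le_sum (f := fun i => bregR (hhat f h γ i) (z k ω) (primal f h γ (s k ω) i))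
      (fun j _ => (hrun ω).residual_nonneg hb k j) (Finset.mem_univ i)

omit hb hz hrun [IsProbabilityMeasure μ] in
theorem RandomizedRule.inv_pos (i : Fin N) : 0 < (p i)⁻¹ := _root_.inv_pos.2 (hrule.p_pos i)

variable (hconv : IsConvexFun (cost f g)) {w : Euc n} (hw : ∀ i, w ∈ edom (h i))
  (hwA : w ∈ argminOn (cost f g) (closure (Cset h)))

omit hrule hz in
include hconv hw hwA in
theorem sum_bregR_z_le [NeZero N] (k : ℕ) (ω : Ω) :
    ∑ i, bregR (hhat f h γ i) w (z k ω) ≤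
      ∑ i, bregR (hhat f h γ i) w (primal f h γ (s k ω) i) -
        (lyapR f h g γ (z k ω) (s k ω) - re (cost f g) w) :=
  hb.sum_bregVal_le_of_isConvexFun hconv ((hrun ω).z_mem_Tmap k) hw hwA.2.1
    fun i => re (hhat f h γ i) w

omit hrule hz in
include hx hconv hw hwA in
/-- A deterministic bound for the Bregman distances from a minimizer to the primal table, which makes
them integrable at every iteration. -/
theorem sum_bregR_primal_le [NeZero N] (k : ℕ) (ω : Ω) :
    ∑ i, bregR (hhat f h γ i) w (primal f h γ (s k ω) i) ≤
      2 ^ k * ∑ i, bregR (hhat f h γ i) w xinit := by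
  induction k with
  | zero =>
    have := (hrun ω).primal_zero hb hx
    simp only [this, pow_zero, one_mul, le_refl]
  | succ k ih =>
    have h1 : ∀ i, bregR (hhat f h γ i) w (primal f h γ (s (k + 1) ω) i) ≤
        bregR (hhat f h γ i) w (primal f h γ (s k ω) i) + bregR (hhat f h γ i) w (z k ω) := by
      intro i
      have e1 := hb.bregR_hhat_nonneg (s k ω) (hw i)
      have e2 := (hb.isEquivalentKernel i).bregR_nonneg (hw i) ((hrun ω).z_mem_interior hb k i)
      by_cases hi : i ∈ I (k + 1) ω
      · have := (hrun ω).primal_succ_of_mem hb hi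
        rw [this]
        linarith
      · have := (hrun ω).primal_succ_of_notMem (i := i) hi
        rw [this]
        linarith
    have h2 := Finset.sum_le_sum fun i (_ : i ∈ Finset.univ) => h1 i
    rw [Finset.sum_add_distrib] at h2
    have h3 := sum_bregR_z_le hb hrun hconv hw hwA k ω
    have h4 := (hrun ω).le_lyapR hb hwA k
    rw [pow_succ]
    linarith

include hx hconv hw hwA in
/-- The weighted Bregman distances from a minimizer form a supermartingale whose decrements dominate
the gaps of the Lyapunov function. -/
theorem weighted_bregR_supermartingale [NeZero N] :
    (∀ k, StronglyMeasurable[ℱ k] fun ω =>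
      ∑ i, (p i)⁻¹ * bregR (hhat f h γ i) w (primal f h γ (s k ω) i)) ∧
    (∀ k, Integrable (fun ω =>
      ∑ i, (p i)⁻¹ * bregR (hhat f h γ i) w (primal f h γ (s k ω) i)) μ) ∧
    (∀ k ω, 0 ≤ ∑ i, (p i)⁻¹ * bregR (hhat f h γ i) w (primal f h γ (s k ω) i)) ∧
    ∀ k, μ[fun ω => ∑ i, (p i)⁻¹ * bregR (hhat f h γ i) w (primal f h γ (s (k + 1) ω) i) | ℱ k]
      ≤ᵐ[μ] fun ω => ∑ i, (p i)⁻¹ * bregR (hhat f h γ i) w (primal f h γ (s k ω) i) -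
        (lyapR f h g γ (z k ω) (s k ω) - re (cost f g) w) := by
  classical
  have hnn : ∀ k ω i, 0 ≤ bregR (hhat f h γ i) w (primal f h γ (s k ω) i) := fun k ω i =>
    hb.bregR_hhat_nonneg (s k ω) (hw i)
  have hnnz : ∀ k ω i, 0 ≤ bregR (hhat f h γ i) w (z k ω) := fun k ω i =>
    (hb.isEquivalentKernel i).bregR_nonneg (hw i) ((hrun ω).z_mem_interior hb k i)
  have hq := hrule.inv_pos
  set S : ℝ := ∑ i, bregR (hhat f h γ i) w xinit with hS
  have hle : ∀ k ω i, bregR (hhat f h γ i) w (primal f h γ (s k ω) i) ≤ 2 ^ k * S :=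
    fun k ω i => (Finset.single_le_sum (f := fun i => bregR (hhat f h γ i) w
      (primal f h γ (s k ω) i)) (fun j _ => hnn k ω j) (Finset.mem_univ i)).trans
      (sum_bregR_primal_le hb hx hrun hconv hw hwA k ω)
  have hlez : ∀ k ω i, bregR (hhat f h γ i) w (z k ω) ≤ 2 ^ k * S := fun k ω i => by
    have e1 := Finset.single_le_sum (f := fun i => bregR (hhat f h γ i) w (z k ω))
      (fun j _ => hnnz k ω j) (Finset.mem_univ i)
    have e2 := sum_bregR_z_le hb hrun hconv hw hwA k ω
    have e3 := (hrun ω).le_lyapR hb hwA k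
    have e4 := sum_bregR_primal_le hb hx hrun hconv hw hwA k ω
    linarith
  have hmx : ∀ k i, StronglyMeasurable[ℱ k] fun ω =>
      bregR (hhat f h γ i) w (primal f h γ (s k ω) i) := fun k i =>
    (hb.measurable_bregR_hhat measurable_const (measurable_primal hb hrule hz hrun k i)
      (fun _ => hw i) fun ω => interior_subset (hb.primal_mem _ i)).stronglyMeasurable
  have hmz : ∀ k i, StronglyMeasurable[ℱ k] fun ω => bregR (hhat f h γ i) w (z k ω) := fun k i =>
    (hb.measurable_bregR_hhat measurable_const (hz k).measurable
      (fun _ => hw i) fun ω => (hrun ω).z_mem_edom hb k i).stronglyMeasurable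
  have hVm : ∀ k, StronglyMeasurable[ℱ k] fun ω =>
      ∑ i, (p i)⁻¹ * bregR (hhat f h γ i) w (primal f h γ (s k ω) i) := fun k =>
    Finset.stronglyMeasurable_fun_sum _ fun i _ => (hmx k i).const_mul _
  have hV0 : ∀ k ω, 0 ≤ ∑ i, (p i)⁻¹ * bregR (hhat f h γ i) w (primal f h γ (s k ω) i) :=
    fun k ω => Finset.sum_nonneg fun i _ => mul_nonneg (hq i).le (hnn k ω i)
  have hVint : ∀ k, Integrable (fun ω =>
      ∑ i, (p i)⁻¹ * bregR (hhat f h γ i) w (primal f h γ (s k ω) i)) μ := fun k =>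
    Integrable.of_bound ((hVm k).mono (ℱ.le k)).aestronglyMeasurable
      (∑ i, (p i)⁻¹ * (2 ^ k * S)) (Eventually.of_forall fun ω => by
        rw [Real.norm_of_nonneg (hV0 k ω)]
        exact Finset.sum_le_sum fun i _ => mul_le_mul_of_nonneg_left (hle k ω i) (hq i).le)
  refine ⟨hVm, hVint, hV0, fun k => ?_⟩
  have h1 := hrule.condExp_le (hVint k) (hVm k) (hVint (k + 1))
    (B := fun i ω => (p i)⁻¹ * (bregR (hhat f h γ i) w (primal f h γ (s k ω) i) -
      bregR (hhat f h γ i) w (z k ω)))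
    (fun i => ((hmx k i).sub (hmz k i)).const_mul _)
    (M := ∑ i, (p i)⁻¹ * (2 ^ k * S))
    (fun i ω => by
      have hS0 : 0 ≤ 2 ^ k * S := (hnn k ω i).trans (hle k ω i)
      rw [norm_mul, Real.norm_of_nonneg (hq i).le]
      refine le_trans (mul_le_mul_of_nonneg_left ?_ (hq i).le) (Finset.single_le_sum
        (f := fun i => (p i)⁻¹ * (2 ^ k * S)) (fun j _ => mul_nonneg (hq j).le hS0)
        (Finset.mem_univ i))
      rw [Real.norm_eq_abs, abs_le]
      constructor <;> linarith [hnn k ω i, hle k ω i, hnnz k ω i, hlez k ω i])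
    (fun ω => by
      rw [← Finset.univ_inter (I (k + 1) ω), ← Finset.sum_ite_mem, ← Finset.sum_sub_distrib]
      refine (Finset.sum_congr rfl fun i _ => ?_).le
      split_ifs with hi
      · have := (hrun ω).primal_succ_of_mem hb hi
        rw [this]
        ring
      · have := (hrun ω).primal_succ_of_notMem (i := i) hi
        rw [this, sub_zero])
  filter_upwards [h1] with ω hω
  refine hω.trans ?_
  have h2 : ∀ i, p i * ((p i)⁻¹ * (bregR (hhat f h γ i) w (primal f h γ (s k ω) i) -
      bregR (hhat f h γ i) w (z k ω))) = bregR (hhat f h γ i) w (primal f h γ (s k ω) i) -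
      bregR (hhat f h γ i) w (z k ω) := fun i => mul_inv_cancel_left₀ (hrule.p_pos i).ne' _
  simp only [h2, Finset.sum_sub_distrib]
  have h3 := sum_bregR_z_le hb hrun hconv hw hwA k ω
  linarith

include hx hconv hw hwA in
theorem ae_summable_gap [NeZero N] : ∀ᵐ ω ∂μ, Summable fun k =>
    lyapR f h g γ (z k ω) (s k ω) - re (cost f g) w := by
  obtain ⟨-, hVint, hV0, hle⟩ :=
    weighted_bregR_supermartingale hb hx hrule hz hrun hconv hw hwA
  exact ae_summable_of_condExp_le hVint
    (fun k => (integrable_lyapR hb hx hrule hz hrun k).sub (integrable_const _))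
    (fun k ω => sub_nonneg.2 ((hrun ω).le_lyapR hb hwA k)) 0 hV0 hle

include hx hconv hw hwA in
theorem ae_exists_tendsto_weighted_bregR [NeZero N] : ∀ᵐ ω ∂μ, ∃ y, Tendsto
    (fun k => ∑ i, (p i)⁻¹ * bregR (hhat f h γ i) w (primal f h γ (s k ω) i)) atTop (𝓝 y) := by
  obtain ⟨hVm, hVint, hV0, hle⟩ :=
    weighted_bregR_supermartingale hb hx hrule hz hrun hconv hw hwA
  refine ae_exists_tendsto_of_condExp_le (ℱ := ℱ) hVint hVm hV0 fun k => (hle k).trans ?_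
  exact Eventually.of_forall fun ω =>
    sub_le_self _ (sub_nonneg.2 ((hrun ω).le_lyapR hb hwA k))

end Randomized

/-! ### Rates and boundedness from the gaps of the Lyapunov function -/

theorem iInf_eq_of_mem_argminOn {F : Euc n → EReal} {S : Set (Euc n)} {x : Euc n}
    (hx : x ∈ argminOn F S) : ⨅ w ∈ S, F w = F x :=
  le_antisymm (iInf₂_le x hx.1) (le_iInf₂ hx.2.2)

namespace IsRun

variable {f h : Fin N → Euc n → EReal} {g : Euc n → EReal} {L γ : Fin N → ℝ}
  {xinit : Euc n} {z : ℕ → Euc n} {s : ℕ → Fin N → Euc n} {st : ℕ → Euc n}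
  {I : ℕ → Finset (Fin N)} (hr : IsRun f h g γ xinit z s st I)
  (hb : BasicAssumption f h g L γ)
include hr hb

theorem iInf_cost_le_iInf_lyapR [NeZero N] :
    ⨅ x ∈ Cset h, cost f g x ≤ ((⨅ k, lyapR f h g γ (z k) (s k) : ℝ) : EReal) := by
  refine ge_of_tendsto' (EReal.tendsto_coe.2 (hr.exists_tendsto_lyapR hb)) fun k => ?_
  refine (iInf₂_le (z k) (hr.z_mem_Cset hb k)).trans ?_
  rw [← hr.coe_re_cost hb k]
  exact EReal.coe_le_coe_iff.2 (hr.re_cost_le_lyapR hb k)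

theorem iInf_lyapR_le_cost [NeZero N] (hx : xinit ∈ Cset h) :
    ((⨅ k, lyapR f h g γ (z k) (s k) : ℝ) : EReal) ≤ cost f g xinit := by
  by_cases hd : xinit ∈ edom (cost f g)
  · rw [← coe_re (hb.cost_ne_bot xinit) hd]
    refine EReal.coe_le_coe_iff.2 (le_trans ?_ (hr.lyapR_zero_le hb hx (hb.edom_cost_subset hd)))
    exact (hr.lyapR_antitone hb).le_of_tendsto (hr.exists_tendsto_lyapR hb) 0
  · exact le_top.trans_eq (not_lt_top_iff.1 hd).symm

/-- The best cost found so far has a gap of order `o(1/k)` when the gaps of the Lyapunov function,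
which are nonincreasing, are summable. -/
theorem isLittleO_inf'_cost_of_summable [NeZero N] {xs : Euc n}
    (hxs : xs ∈ argminOn (cost f g) (closure (Cset h)))
    (hgap : Summable fun k => lyapR f h g γ (z k) (s k) - re (cost f g) xs) :
    (fun k : ℕ => ((Finset.range (k + 1)).inf' Finset.nonempty_range_add_one
        (fun l => cost f g (z l))).toReal - re (cost f g) xs)
      =o[atTop] (fun k : ℕ => 1 / (k : ℝ)) := by
  refine isLittleO_one_div_of_antitone_of_summable
    (fun k l hkl => sub_le_sub_right (hr.lyapR_antitone hb hkl) _) hgap (fun k => ?_) fun k => ?_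
  · obtain ⟨l, -, hl⟩ := Finset.exists_mem_eq_inf' Finset.nonempty_range_add_one
      (s := Finset.range (k + 1)) (fun l => cost f g (z l))
    rw [hl]
    exact sub_nonneg.2 (hr.le_re_cost hb hxs l)
  · obtain ⟨l, -, hl⟩ := Finset.exists_mem_eq_inf' Finset.nonempty_range_add_one
      (s := Finset.range (k + 1)) (fun l => cost f g (z l))
    have h1 : cost f g (z l) ≤ cost f g (z k) :=
      hl ▸ Finset.inf'_le (fun l => cost f g (z l)) (Finset.self_mem_range_succ k)
    rw [hl]
    refine sub_le_sub_right (le_trans ?_ (hr.re_cost_le_lyapR hb k)) _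
    rw [← hr.coe_re_cost hb l, ← hr.coe_re_cost hb k] at h1
    exact EReal.coe_le_coe_iff.1 h1

/-- The iterates stay in a sublevel set of the cost. -/
theorem isBounded_range_of_levelBoundedOn [NeZero N]
    (hL : LevelBoundedOn (cost f g) (closure (Cset h))) : Bornology.IsBounded (Set.range z) := by
  refine (hL (lyapR f h g γ (z 0) (s 0))).subset ?_
  rintro _ ⟨k, rfl⟩
  refine ⟨subset_closure (hr.z_mem_Cset hb k), ?_⟩
  rw [← hr.coe_re_cost hb k]
  exact EReal.coe_le_coe_iff.2
    ((hr.re_cost_le_lyapR hb k).trans (hr.lyapR_antitone hb (Nat.zero_le k)))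

end IsRun

end BFinito

end

theorem mainTheorem1 {n N : ℕ} [NeZero N]
    (f h : Fin N → Euc n → EReal) (g : Euc n → EReal) (L γ : Fin N → ℝ)
    (hbasic : BasicAssumption f h g L γ)
    (xinit : Euc n) (hxinit : xinit ∈ Cset h)
    {Ω : Type*} {mΩ : MeasurableSpace Ω} (μ : Measure Ω) [IsProbabilityMeasure μ]
    (ℱ : Filtration ℕ mΩ)
    (p : Fin N → ℝ)
    (z : ℕ → Ω → Euc n) (s : ℕ → Ω → Fin N → Euc n) (st : ℕ → Ω → Euc n)
    (I : ℕ → Ω → Finset (Fin N))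
    (hrule : RandomizedRule μ ℱ p I)
    (hz : ∀ k, StronglyMeasurable[ℱ k] (z k))
    (hrun : ∀ ω, IsRun f h g γ xinit (fun k => z k ω) (fun k => s k ω) (fun k => st k ω)
      (fun k => I k ω)) :
    -- along the iterates all the quantities involved are finite
    (∀ k ω, cost f g (z k ω) ≠ ⊥ ∧ cost f g (z k ω) ≠ ⊤ ∧
      lyapunov f h g γ (z k ω) (s k ω) ≠ ⊥ ∧ lyapunov f h g γ (z k ω) (s k ω) ≠ ⊤ ∧
      ∀ i, 0 ≤ bresidual f h γ (z k ω) (s k ω) i ∧ bresidual f h γ (z k ω) (s k ω) i ≠ ⊤) ∧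
    -- expected descent of the Lyapunov function
    (∀ k, Integrable (fun ω => (lyapunov f h g γ (z k ω) (s k ω)).toReal) μ) ∧
    (∀ k, μ[fun ω => (lyapunov f h g γ (z (k + 1) ω) (s (k + 1) ω)).toReal | ℱ k]
      ≤ᵐ[μ] fun ω => (lyapunov f h g γ (z k ω) (s k ω)).toReal
        - (⨅ i, p i) * ∑ i, (bresidual f h γ (z k ω) (s k ω) i).toReal) ∧
    -- the Lyapunov function is the Bregman-Moreau envelope
    (∀ k ω, lyapunov f h g γ (z k ω) (s k ω) = envelope f h g γ (primal f h γ (s k ω))) ∧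
    ∃ φstar : Ω → ℝ,
      -- the envelope surely decreases to the finite value `φstar`
      (∀ ω, Antitone (fun k => envelope f h g γ (primal f h γ (s k ω))) ∧
        Tendsto (fun k => envelope f h g γ (primal f h γ (s k ω))) atTop
          (𝓝 ((φstar ω : ℝ) : EReal)) ∧
        (⨅ x ∈ Cset h, cost f g x) ≤ ((φstar ω : ℝ) : EReal)) ∧
      ∀ᵐ ω ∂μ,
        -- the residuals are summable, and in particular vanish
        (∀ i, Summable (fun k => (bresidual f h γ (z k ω) (s k ω) i).toReal) ∧
          Tendsto (fun k => bresidual f h γ (z k ω) (s k ω) i) atTop (𝓝 0)) ∧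
        -- the cost converges to `φstar`
        (Tendsto (fun k => cost f g (z k ω)) atTop (𝓝 ((φstar ω : ℝ) : EReal)) ∧
          ((φstar ω : ℝ) : EReal) ≤ cost f g xinit) ∧
        -- the cost is constant on the limit set
        (KernelAssumption h → (∀ i, ConvexPM (f i) (h i) (L i) (edom (h i))) →
          ∀ x ∈ limitSet (fun k => z k ω), cost f g x = ((φstar ω : ℝ) : EReal)) ∧
        -- limit points are stationary
        (Cset h = Set.univ →
          ∀ x ∈ limitSet (fun k => z k ω), IsRegSubgradient (cost f g) x 0) ∧
        -- convex cost and closed domains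
        (IsConvexFun (cost f g) → (∀ i, IsClosed (edom (h i))) →
          (Tendsto (fun k => cost f g (z k ω)) atTop
              (𝓝 (⨅ x ∈ closure (Cset h), cost f g x)) ∧
            (fun k : ℕ =>
              ((Finset.range (k + 1)).inf' Finset.nonempty_range_add_one
                (fun l => cost f g (z l ω))).toReal
                - (⨅ x ∈ closure (Cset h), cost f g x).toReal)
              =o[atTop] (fun k : ℕ => 1 / (k : ℝ))) ∧
          (∀ x ∈ limitSet (fun k => z k ω), x ∈ argminOn (cost f g) (closure (Cset h))) ∧
          ((KernelAssumption h ∧ LevelBoundedOn (cost f g) (closure (Cset h))) ∨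
              Cset h = Set.univ →
            ∃ x ∈ argminOn (cost f g) (closure (Cset h)),
              Tendsto (fun k => z k ω) atTop (𝓝 x) ∧
              ∀ i, Tendsto (fun k => primal f h γ (s k ω) i) atTop (𝓝 x))) := by
  have hcoe : ∀ k ω, lyapunov f h g γ (z k ω) (s k ω) =
      ((lyapR f h g γ (z k ω) (s k ω) : ℝ) : EReal) := fun k ω => (hrun ω).lyapunov_eq hbasic k
  have henv : ∀ k ω, envelope f h g γ (primal f h γ (s k ω)) =
      ((lyapR f h g γ (z k ω) (s k ω) : ℝ) : EReal) := fun k ω => (hrun ω).envelope_eq hbasic k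
  have hres : ∀ k ω i, bresidual f h γ (z k ω) (s k ω) i =
      ((bregR (hhat f h γ i) (z k ω) (primal f h γ (s k ω) i) : ℝ) : EReal) := fun k ω i =>
    hbasic.bresidual_eq_coe _ ((hrun ω).z_mem_Cset hbasic k) i
  have hcost : ∀ k ω, cost f g (z k ω) = ((re (cost f g) (z k ω) : ℝ) : EReal) := fun k ω =>
    ((hrun ω).coe_re_cost hbasic k).symm
  simp only [hcoe, henv, hres, EReal.toReal_coe]
  refine ⟨fun k ω => ⟨hbasic.cost_ne_bot _, (hrun ω).z_mem_edom_cost hbasic k |>.ne,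
      EReal.coe_ne_bot _, EReal.coe_ne_top _, fun i => ⟨EReal.coe_nonneg.2
      ((hrun ω).residual_nonneg hbasic k i), EReal.coe_ne_top _⟩⟩,
    integrable_lyapR hbasic hxinit hrule hz hrun, condExp_lyapR_le hbasic hxinit hrule hz hrun,
    fun _ _ => trivial, fun ω => ⨅ k, lyapR f h g γ (z k ω) (s k ω),
    fun ω => ⟨fun k l hkl => EReal.coe_le_coe_iff.2 ((hrun ω).lyapR_antitone hbasic hkl),
      EReal.tendsto_coe.2 ((hrun ω).exists_tendsto_lyapR hbasic),
      (hrun ω).iInf_cost_le_iInf_lyapR hbasic⟩, ?_⟩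
  obtain ⟨xs, hxs⟩ := hbasic.exists_sol
  -- a finite set of minimizers controls the weighted Bregman distances from all of them
  obtain ⟨S, hSA, hSfin, hS⟩ := hbasic.exists_finite_forall_tendsto_bregR
    (argminOn (cost f g) (closure (Cset h))) fun i => (p i)⁻¹
  have hconvex : ∀ᵐ ω ∂μ, IsConvexFun (cost f g) → (∀ i, IsClosed (edom (h i))) →
      (Summable fun k => lyapR f h g γ (z k ω) (s k ω) - re (cost f g) xs) ∧
      ∀ w ∈ argminOn (cost f g) (closure (Cset h)), ∃ y, Tendsto (fun k =>
        ∑ i, (p i)⁻¹ * bregR (hhat f h γ i) w (primal f h γ (s k ω) i)) atTop (𝓝 y) := by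
    simp only [eventually_imp_distrib_left]
    intro hconv hcl
    have h1 := ae_summable_gap hbasic hxinit hrule hz hrun hconv
      (mem_edom_of_mem_argminOn hcl hxs) hxs
    have h2 := (ae_ball_iff hSfin.countable).2 fun w hw =>
      ae_exists_tendsto_weighted_bregR hbasic hxinit hrule hz hrun hconv
        (mem_edom_of_mem_argminOn hcl (hSA hw)) (hSA hw)
    filter_upwards [h1, h2] with ω hω1 hω2
    exact ⟨hω1, hS (fun k => s k ω) hω2⟩
  filter_upwards [ae_summable_residual hbasic hxinit hrule hz hrun, hconvex] with ω hsum hω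
  have hr := hrun ω
  have hres0 : ∀ i, Tendsto (fun k => bregR (hhat f h γ i) (z k ω) (primal f h γ (s k ω) i))
      atTop (𝓝 0) := fun i => (hsum i).tendsto_atTop_zero
  have hℓ := hr.exists_tendsto_lyapR hbasic
  refine ⟨fun i => ⟨hsum i, EReal.tendsto_coe.2 (hres0 i)⟩, ⟨?_,
    hr.iInf_lyapR_le_cost hbasic hxinit⟩,
    fun hK hPM x hx => hr.cost_eq_of_mem_limitSet hbasic hK hPM hℓ hres0 hx,
    fun hC x hx => hr.isRegSubgradient_of_mem_limitSet hbasic hC hℓ hres0 hx,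
    fun hconv hcl => ?_⟩
  · simp only [hcost]
    exact EReal.tendsto_coe.2 (tendsto_re_cost_of_tendsto_lyapR hℓ hres0)
  obtain ⟨hgap, hV⟩ := hω hconv hcl
  have hlim : Tendsto (fun k => lyapR f h g γ (z k ω) (s k ω)) atTop (𝓝 (re (cost f g) xs)) :=
    tendsto_sub_nhds_zero_iff.1 hgap.tendsto_atTop_zero
  have hclim := tendsto_re_cost_of_tendsto_lyapR hlim hres0
  rw [iInf_eq_of_mem_argminOn hxs]
  refine ⟨⟨?_, hr.isLittleO_inf'_cost_of_summable hbasic hxs hgap⟩,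
    fun x hx => hr.mem_argminOn_of_mem_limitSet hbasic hxs hclim hx, fun hcase => ?_⟩
  · simp only [hcost, ← coe_re (hbasic.cost_ne_bot xs) hxs.2.1]
    exact EReal.tendsto_coe.2 hclim
  have hq := hrule.inv_pos
  rcases hcase with ⟨hK, hL⟩ | hC
  · exact hr.exists_tendsto_of_isBounded hbasic hK hconv hxs hlim hres0
      (hr.isBounded_range_of_levelBoundedOn hbasic hL) hq hV
  · exact hr.exists_tendsto_of_isBounded hbasic (kernelAssumption_of_Cset_eq_univ hC) hconv hxs
      hlim hres0 (hr.isBounded_range_of_Cset_eq_univ hbasic hC hconv hxs hq (hV xs hxs)) hq hV
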